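/- Let $\mathsf{k}$ be a field. Monomials in $\mathsf{k}[x,y]$ are identified with their exponent vectors. For a monomial ideal $I$ let $\mathrm{G}(I)$ be its minimal set of monomial generators, $\mu(I)=|\mathrm{G}(I)|$, and $\mathrm{G}^{*}(I)$ the set $\mathrm{G}(I)$ without the generator of maximal $y$-degree. Put $\operatorname{red}(I)=I:\gcd(I)$ and, for $\bullet\in\{x,y\}$, $\operatorname{dist}_\bullet(I)=\max\{\deg_\bullet g: g\in \mathrm{G}(\operatorname{red}(I))\}$, with $\operatorname{dist}_\bullet(g,h)=\operatorname{dist}_\bullet((g,h))$ for monomials $g,h$. The ideal $I$ is anchored if $\operatorname{red}(I)=I$. The integral closure $\overline{I}$ consists of the monomials $f$ with $f^n\in I^n$ for some $n\ge1$. Further, $P(I)$ is the set of $f\in\mathrm{G}(I)$ with $f\notin\overline{(g,h)}$ for all monomials $g,h\in I\setminus\{f\}$, and $P^*(I)$ is the set of $f\in\mathrm{G}(I)$ with $f^n\in\mathrm{G}(I^n)$ for all $n\ge1$. The link of monomial ideals is $I\odot J=\operatorname{red}(I)\,y^{\operatorname{dist}_yJ}+\operatorname{red}(J)\,x^{\operatorname{dist}_xI}$,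 and its link point is $x^{\operatorname{dist}_xI}y^{\operatorname{dist}_yJ}$. For $u,v\ge1$, an anchored monomial ideal $J$ and an integer $r\ge\operatorname{dist}_y(J)/v$, let $L$, $M$, $R$ be the sets of those $f\in\mathrm{G}((x^u,y^v)^{r+1}J)$ with $\deg_yf\ge rv$, with $rv\le\deg_yf<(r+1)v$, and with $\deg_yf<rv$, respectively, and let $x^\alpha y^\beta$ be the element of $L$ of least $y$-degree. The $r$-segments of $(x^u,y^v)J$ are $$\mathsf A=(L):y^\beta,\quad \mathsf H=(M\cup\{x^{\alpha-u}y^{\beta+v}\}):x^{\alpha-u}y^\beta,\quad \mathsf B=(R\cup\{x^\alpha y^\beta\}):x^\alpha ,$$ and the $r$-segments of $(g,h)J$ are those of $\operatorname{red}((g,h))J$. Let $I\subseteq\mathsf{k}[x,y]$ be an anchored, non-principal monomial ideal, and let $P=\{g_1,\dots,g_{k+1}\}$ with $P(I)\subseteq P\subseteq P^*(I)$, the $g_i$ ordered in descending $y$-degree. Put $u_i=\operatorname{dist}_x(g_i,g_{i+1})$, $v_i=\operatorname{dist}_y(g_i,g_{i+1})$, $\delta_P=\max_{1\le i\le k}\min\{u_i,v_i\}-1$,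 and $d_P=\min\{\operatorname{dist}_xI,\operatorname{dist}_yI\}-2$ if $|P|>2$, $d_P=0$ if $|P|=2$. Let $D\ge(\mu(I)-|P|)\delta_P+|P|d_P$ and $$s\ge D+\Big\lceil D\cdot\max_{1\le i\le k}\frac{\operatorname{dist}_yI}{v_i}\Big\rceil+1,\qquad r=s-D-1 .$$ Let $\mathsf A_i,\mathsf H_i,\mathsf B_i$ be the $r$-segments of $(g_i,g_{i+1})I^D$ for $1\le i\le k$, and let $$\mathsf C_0=\mathsf A_1,\quad \mathsf C_k=\mathsf B_k,\quad \mathsf C_i=\mathsf B_i\,y^{(r+1)v_{i+1}-\operatorname{dist}_y\mathsf B_{i+1}}+\mathsf A_{i+1}\,x^{(r+1)u_i-\operatorname{dist}_x\mathsf A_i}\quad(1\le i<k).$$ Then $I^s=\mathsf C_0\odot\cdots\odot\mathsf C_k$. For $1\le i\le k$ let $h_i$ be the link point of $(\mathsf C_0\odot\cdots\odot\mathsf C_{i-1})\odot(\mathsf C_i\odot\cdots\odot\mathsf C_k)$, and let $h_0=y^{\operatorname{dist}_y(I^s)}$, $h_{k+1}=x^{\operatorname{dist}_x(I^s)}$.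 Put $q_i=\gcd(h_i,h_{i+1})$ for $0\le i\le k$ and $\hat q_i=h_i/x^{u_i}$ for $1\le i\le k$; here $x^{u_i}$ divides $h_i$. Then, with $\uplus$ denoting disjoint unions, $$\mathrm G(I^s)=\mathrm G(q_0\mathsf C_0)\uplus\biguplus_{i=1}^k\mathrm G^*(q_i\mathsf C_i),$$ $$\mathrm G(I^{s+1})=g_1\,\mathrm G(q_0\mathsf C_0)\uplus\biguplus_{i=1}^k g_{i+1}\big(\mathrm G^*(q_i\mathsf C_i)\uplus\mathrm G^*(\hat q_i\mathsf H_i)\big),$$ $$\mathrm G(I^{s+2})=g_1^2\,\mathrm G(q_0\mathsf C_0)\uplus\biguplus_{i=1}^k g_{i+1}^2\big(\mathrm G^*(q_i\mathsf C_i)\uplus\mathrm G^*(\hat q_i\mathsf H_i)\big)\uplus\biguplus_{i=1}^k g_ig_{i+1}\,\mathrm G^*(\hat q_i\mathsf H_i).$$ Moreover, $$\mathrm G(I^{s+1})=\biguplus_{f\in\mathrm G(I^s)}f\cdot G_f,$$ where $G_f=\{g_i\}$ if $\deg_yh_i+v_i\le\deg_yf$ for some $1\le i\le k$ and, in case $i\ge2$,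 also $\deg_yf<\deg_yh_{i-1}$; $G_f=\{g_i,g_{i+1}\}$ if $\deg_yh_i\le\deg_yf<\deg_yh_i+v_i$ for some $1\le i\le k$; and $G_f=\{g_{k+1}\}$ if $\deg_yf<\deg_yh_k$. -/

import Mathlib

open scoped Pointwise

noncomputable section

namespace BivariateMonomial

/-- Monomials `x^a y^b` in two variables, identified with their exponent vectors: index `0` is the
`x`-degree, index `1` the `y`-degree.  Multiplication of monomials is addition of exponents,
divisibility is the pointwise order, `gcd` is the pointwise minimum `⊓`, and an exact quotient is a
difference. -/
abbrev Mon : Type := Fin 2 →₀ ℕ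

/-- The monomial `x^a y^b`. -/
def xy (a b : ℕ) : Mon := Finsupp.single 0 a + Finsupp.single 1 b

variable (K : Type*) [Field K]

/-- The ideal `(E)` of `K[x,y]` generated by a set `E` of monomials. -/
def genBy (E : Set Mon) : Ideal (MvPolynomial (Fin 2) K) :=
  Ideal.span ((fun m : Mon => MvPolynomial.monomial m (1 : K)) '' E)

variable {K}

/-- `I` is a monomial ideal. -/
def IsMonomialIdeal (I : Ideal (MvPolynomial (Fin 2) K)) : Prop :=
  ∃ E : Set Mon, I = genBy K E

/-- The monomials contained in `I`. -/
def mons (I : Ideal (MvPolynomial (Fin 2) K)) : Set Mon :=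
  {m | MvPolynomial.monomial m (1 : K) ∈ I}

/-- `G(I)`: the minimal monomial generators of a monomial ideal `I`, that is, the monomials of `I`
that are minimal with respect to divisibility. -/
def mingens (I : Ideal (MvPolynomial (Fin 2) K)) : Set Mon :=
  {m | Minimal (fun m' => m' ∈ mons I) m}

/-- `μ(I)`: the number of minimal generators. -/
def mu (I : Ideal (MvPolynomial (Fin 2) K)) : ℕ := (mingens I).ncard

/-- `G*(I)`: the minimal generators of `I` without the one of maximal `y`-degree. -/
def mingensStar (I : Ideal (MvPolynomial (Fin 2) K)) : Set Mon :=
  {m | m ∈ mingens I ∧ ∃ m' ∈ mingens I, m 1 < m' 1}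

/-- `m · I` for a monomial `m`. -/
def mulMon (m : Mon) (I : Ideal (MvPolynomial (Fin 2) K)) : Ideal (MvPolynomial (Fin 2) K) :=
  genBy K {m} * I

/-- The colon ideal `I : m` for a monomial `m`. -/
def colonMon (I : Ideal (MvPolynomial (Fin 2) K)) (m : Mon) : Ideal (MvPolynomial (Fin 2) K) :=
  Submodule.colon I {MvPolynomial.monomial m (1 : K)}

/-- The greatest common divisor of all monomials of `I`. -/
def gcdMon (I : Ideal (MvPolynomial (Fin 2) K)) : Mon :=
  xy (sInf ((fun m : Mon => m 0) '' mons I)) (sInf ((fun m : Mon => m 1) '' mons I))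

/-- `I : gcd(I)`. -/
def red (I : Ideal (MvPolynomial (Fin 2) K)) : Ideal (MvPolynomial (Fin 2) K) :=
  colonMon I (gcdMon I)

/-- `I` is anchored if `I : gcd(I) = I`. -/
def Anchored (I : Ideal (MvPolynomial (Fin 2) K)) : Prop := red I = I

/-- The `x`-distance (`c = 0`) or `y`-distance (`c = 1`) of a monomial ideal `I`: the maximal
degree, in that variable, of a minimal generator of `I : gcd(I)`. -/
def idist (c : Fin 2) (I : Ideal (MvPolynomial (Fin 2) K)) : ℕ :=
  sSup ((fun m : Mon => m c) '' mingens (red I))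

variable (K) in
/-- The distance of a pair of monomials, that is, of the ideal generated by the pair. -/
def pdist (c : Fin 2) (g h : Mon) : ℕ := idist c (genBy K {g, h})

/-- The (monomials of the) integral closure of a monomial ideal. -/
def intClosure (I : Ideal (MvPolynomial (Fin 2) K)) : Set Mon :=
  {f | ∃ n : ℕ, 1 ≤ n ∧ n • f ∈ mons (I ^ n)}

/-- `P(I)`: the persistent generators. -/
def persistent (I : Ideal (MvPolynomial (Fin 2) K)) : Set Mon :=
  {f | f ∈ mingens I ∧
    ∀ g ∈ mons I \ {f}, ∀ h ∈ mons I \ {f}, f ∉ intClosure (genBy K {g, h})}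

/-- `P*(I)`: the weakly persistent generators. -/
def weaklyPersistent (I : Ideal (MvPolynomial (Fin 2) K)) : Set Mon :=
  {f | f ∈ mingens I ∧ ∀ n : ℕ, 1 ≤ n → n • f ∈ mingens (I ^ n)}

variable (K) in
/-- `δ_P` for `P = {g_1, …, g_{k+1}}`. -/
def deltaP (g : ℕ → Mon) (k : ℕ) : ℕ :=
  (Finset.Icc 1 k).sup (fun i => min (pdist K 0 (g i) (g (i + 1))) (pdist K 1 (g i) (g (i + 1)))) - 1

/-- `d_P` for a set `P` of weakly persistent generators of `I`. -/
def dP (I : Ideal (MvPolynomial (Fin 2) K)) (P : Finset Mon) : ℕ :=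
  if 2 < P.card then min (idist 0 I) (idist 1 I) - 2 else 0

/-- `r_y(P, D) = ⌈D · max_i dist_y(I) / dist_y(g_i, g_{i+1})⌉`. -/
def rY (I : Ideal (MvPolynomial (Fin 2) K)) (g : ℕ → Mon) (k D : ℕ) : ℕ :=
  ⌈(D : ℚ≥0) * (Finset.Icc 1 k).sup
    (fun i => (idist 1 I : ℚ≥0) / (pdist K 1 (g i) (g (i + 1)) : ℚ≥0))⌉₊

/-! ### Links -/

/-- The link `I ⊙ J` with respect to `y`. -/
def link (I J : Ideal (MvPolynomial (Fin 2) K)) : Ideal (MvPolynomial (Fin 2) K) :=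
  mulMon (xy 0 (idist 1 J)) (red I) + mulMon (xy (idist 0 I) 0) (red J)

/-- The iterated link `C_a ⊙ C_{a+1} ⊙ ⋯ ⊙ C_{a+n}`. -/
def iterLink (C : ℕ → Ideal (MvPolynomial (Fin 2) K)) (a : ℕ) :
    ℕ → Ideal (MvPolynomial (Fin 2) K)
  | 0 => C a
  | n + 1 => link (iterLink C a n) (C (a + n + 1))

/-- The link points `h_0, …, h_{k+1}` of `C_0 ⊙ ⋯ ⊙ C_k`: for `1 ≤ i ≤ k`, the point `h_i` is the
link point of `(C_0 ⊙ ⋯ ⊙ C_{i-1}) ⊙ (C_i ⊙ ⋯ ⊙ C_k)`, while `h_0` and `h_{k+1}` are the pure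
powers `y^{dist_y}` and `x^{dist_x}` of the whole link. -/
def linkPoint (C : ℕ → Ideal (MvPolynomial (Fin 2) K)) (k i : ℕ) : Mon :=
  if i = 0 then xy 0 (idist 1 (iterLink C 0 k))
  else if i ≤ k then xy (idist 0 (iterLink C 0 (i - 1))) (idist 1 (iterLink C i (k - i)))
  else xy (idist 0 (iterLink C 0 k)) 0

/-! ### Segments of `(x^u, y^v) J` -/

section Segments

variable (u v : ℕ) (J : Ideal (MvPolynomial (Fin 2) K)) (r : ℕ)

/-- `(x^u, y^v)^{r+1} J`. -/
def stair : Ideal (MvPolynomial (Fin 2) K) := genBy K {xy u 0, xy 0 v} ^ (r + 1) * J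

def segL : Set Mon := {f | f ∈ mingens (stair u v J r) ∧ r * v ≤ f 1}

def segM : Set Mon := {f | f ∈ mingens (stair u v J r) ∧ r * v ≤ f 1 ∧ f 1 < (r + 1) * v}

def segR : Set Mon := {f | f ∈ mingens (stair u v J r) ∧ f 1 < r * v}

/-- The minimal `y`-degree of an element of `L`. -/
def segBeta : ℕ := sInf ((fun f : Mon => f 1) '' segL u v J r)

/-- The `x`-degree of the (unique) element `x^α y^β` of `L` of minimal `y`-degree. -/
def segAlpha : ℕ :=
  sInf ((fun f : Mon => f 0) '' {f | f ∈ segL u v J r ∧ f 1 = segBeta u v J r})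

/-- The segment `A = (L) : y^β`. -/
def segA : Ideal (MvPolynomial (Fin 2) K) :=
  colonMon (genBy K (segL u v J r)) (xy 0 (segBeta u v J r))

/-- The segment `H = (M ∪ {x^{α-u} y^{β+v}}) : x^{α-u} y^β`. -/
def segH : Ideal (MvPolynomial (Fin 2) K) :=
  colonMon
    (genBy K (segM u v J r ∪ {xy (segAlpha u v J r - u) (segBeta u v J r + v)}))
    (xy (segAlpha u v J r - u) (segBeta u v J r))

/-- The segment `B = (R ∪ {x^α y^β}) : x^α`. -/
def segB : Ideal (MvPolynomial (Fin 2) K) :=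
  colonMon
    (genBy K (segR u v J r ∪ {xy (segAlpha u v J r) (segBeta u v J r)}))
    (xy (segAlpha u v J r) 0)

end Segments

/-! ### Stable components -/

section Stable

variable (I : Ideal (MvPolynomial (Fin 2) K)) (g : ℕ → Mon) (k D s i : ℕ)

/-- The `(s-D-1)`-segment `A_i` of `(g_i, g_{i+1}) I^D`, i.e. of `(x^{u_i}, y^{v_i}) I^D` with
`u_i = dist_x(g_i, g_{i+1})`, `v_i = dist_y(g_i, g_{i+1})`. -/
def compA : Ideal (MvPolynomial (Fin 2) K) :=
  segA (pdist K 0 (g i) (g (i + 1))) (pdist K 1 (g i) (g (i + 1))) (I ^ D) (s - D - 1)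

/-- The `(s-D-1)`-segment `B_i` of `(g_i, g_{i+1}) I^D`. -/
def compB : Ideal (MvPolynomial (Fin 2) K) :=
  segB (pdist K 0 (g i) (g (i + 1))) (pdist K 1 (g i) (g (i + 1))) (I ^ D) (s - D - 1)

/-- The stable component `H_i`, `1 ≤ i ≤ k`: the `(s-D-1)`-segment `H` of
`(g_i, g_{i+1}) I^D`. -/
def stableH : Ideal (MvPolynomial (Fin 2) K) :=
  segH (pdist K 0 (g i) (g (i + 1))) (pdist K 1 (g i) (g (i + 1))) (I ^ D) (s - D - 1)

/-- The stable component `C_i`, `0 ≤ i ≤ k`.  Here `C_0 = A_1`, `C_k = B_k`, and otherwise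
`C_i = B_i y^{(r+1) v_{i+1} - dist_y B_{i+1}} + A_{i+1} x^{(r+1) u_i - dist_x A_i}`, where
`r + 1 = s - D`. -/
def stableC : Ideal (MvPolynomial (Fin 2) K) :=
  if i = 0 then compA I g D s 1
  else if i = k then compB I g D s k
  else
    mulMon (xy 0 ((s - D) * pdist K 1 (g (i + 1)) (g (i + 2)) - idist 1 (compB I g D s (i + 1))))
        (compB I g D s i)
      + mulMon (xy ((s - D) * pdist K 0 (g i) (g (i + 1)) - idist 0 (compA I g D s i)) 0)
        (compA I g D s (i + 1))

end Stable

variable (K) in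
/-- The set of those `g_j` by which a minimal generator `f` of `I^s` is multiplied to obtain
minimal generators of `I^{s+1}`; `h_i` are the link points and `v_i = dist_y(g_i, g_{i+1})`. -/
def multipliers (g h : ℕ → Mon) (k : ℕ) (f : Mon) : Set Mon :=
  {m | (∃ i, 1 ≤ i ∧ i ≤ k ∧ h i 1 + pdist K 1 (g i) (g (i + 1)) ≤ f 1 ∧
          (i = 1 ∨ f 1 < h (i - 1) 1) ∧ m = g i) ∨
       (∃ i, 1 ≤ i ∧ i ≤ k ∧ h i 1 ≤ f 1 ∧ f 1 < h i 1 + pdist K 1 (g i) (g (i + 1)) ∧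
          (m = g i ∨ m = g (i + 1))) ∨
       (f 1 < h k 1 ∧ m = g (k + 1))}

end BivariateMonomial

end

open BivariateMonomial

/-! ### Monomials in products, powers and quotients of monomial ideals -/

namespace BivariateMonomial

variable {K : Type*} [Field K]

/-! A monomial ideal containing a power of `x` is encoded by its profile `φ`, where `φ y` is the
least `x`-degree of a monomial in row `y`. Minimal generators are the drops of `φ`
(`HasProf.mem_mingens`), and if a power of `y` is present too, distances and links are read off from
`φ`.

The `g_i` run along the lower boundary of the Newton polygon of `I` (`genChain_of_persistent`).
Convexity allows products of generators to be traded for products of chain members. In a product of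
minimal weight, at most `D` factors therefore lie outside some adjacent pair, so `I^(M+D)` is the
sum of the pieces `(g_i, g_{i+1})^M I^D` for every `M` (`GenChain.exists_adjacent_factor`,
`GenChain.pieces`).

Write `g_i = x^(a i) y^(b i)` and `n = r`, so that `s = n + 1 + D`. The bound on `r` makes the
`y`-distance of `I^D` at most `n v_i`, and then only piece `i` matters in rows `n b_i + b_{i+1} ≤ y
< (n+1) b_i` (`Pieces.le_iff_rep`). Multiplication by `g_{i+1}` identifies the profiles of `I^s` and
`I^(s+1)` on a window reaching beyond these rows (`Pieces.shift`). The windows of `g_i` and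
`g_{i+1}` overlap, and comparing the two identifications there gives `φ (y + v_i) + u_i = φ y`
(`Pieces.period`). Hence each such range of rows contains a drop.

Let `η_i` be the first drop in the range. The link points are `(φ (η_i), η_i)`, and `C_i` and `H_i`
are the slices of `φ` in rows from `η_{i+1}` to `η_i` and from `η_i` to `η_i + v_i`. Linking
concatenates slices (`hasProf_iterLink`). In the next power `η_i` moves up by `b_i`
(`Pieces.firstDrop_succ`), so the argument repeats. The rest is bookkeeping by `y`-degree: `g_{i+1}`
multiplies the generators in rows `η_{i+1} ≤ y < η_i + v_i`, and the overlaps of these sections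
produce the copies of `H_i` (`Thresholds.decomposition`). -/

theorem mem_mons {I : Ideal (MvPolynomial (Fin 2) K)} {m : Mon} :
    m ∈ mons I ↔ MvPolynomial.monomial m (1 : K) ∈ I := Iff.rfl

theorem mem_mons_genBy {E : Set Mon} {m : Mon} : m ∈ mons (genBy K E) ↔ ∃ e ∈ E, e ≤ m := by
  rw [mem_mons, genBy, MvPolynomial.mem_ideal_span_monomial_image]
  simp

theorem genBy_isMonomialIdeal (E : Set Mon) : IsMonomialIdeal (genBy K E) := ⟨E, rfl⟩

theorem mem_genBy {E : Set Mon} {p : MvPolynomial (Fin 2) K} :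
    p ∈ genBy K E ↔ ∀ m ∈ p.support, m ∈ mons (genBy K E) := by
  simp only [mem_mons_genBy]
  rw [genBy, MvPolynomial.mem_ideal_span_monomial_image]

theorem IsMonomialIdeal.mem_iff {I : Ideal (MvPolynomial (Fin 2) K)} (hI : IsMonomialIdeal I)
    {p : MvPolynomial (Fin 2) K} : p ∈ I ↔ ∀ m ∈ p.support, m ∈ mons I := by
  obtain ⟨E, rfl⟩ := hI
  exact mem_genBy

theorem IsMonomialIdeal.ext {I J : Ideal (MvPolynomial (Fin 2) K)} (hI : IsMonomialIdeal I)
    (hJ : IsMonomialIdeal J) (h : ∀ m, m ∈ mons I ↔ m ∈ mons J) : I = J := by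
  ext p
  rw [hI.mem_iff, hJ.mem_iff]
  simp only [h]

theorem mons_mono {I : Ideal (MvPolynomial (Fin 2) K)} {m n : Mon} (hm : m ∈ mons I)
    (h : m ≤ n) : n ∈ mons I := by
  rw [mem_mons] at *
  have : MvPolynomial.monomial n (1 : K) =
      MvPolynomial.monomial (n - m) 1 * MvPolynomial.monomial m 1 := by
    rw [MvPolynomial.monomial_mul, tsub_add_cancel_of_le h, one_mul]
  rw [this]
  exact I.mul_mem_left _ hm

theorem isMonomialIdeal_of_mem {I : Ideal (MvPolynomial (Fin 2) K)}
    (h : ∀ p ∈ I, ∀ m ∈ p.support, m ∈ mons I) : IsMonomialIdeal I := by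
  refine ⟨mons I, le_antisymm (fun p hp => ?_) ?_⟩
  · rw [mem_genBy]
    intro m hm
    rw [mem_mons_genBy]
    exact ⟨m, h p hp m hm, le_rfl⟩
  · rw [genBy, Ideal.span_le]
    rintro _ ⟨m, hm, rfl⟩
    exact hm

theorem genBy_mul (E F : Set Mon) : genBy K E * genBy K F = genBy K (E + F) := by
  rw [genBy, genBy, genBy, Ideal.span_mul_span']
  congr 1
  ext p
  simp only [Set.mem_mul, Set.mem_image, Set.mem_add]
  constructor
  · rintro ⟨_, ⟨a, ha, rfl⟩, _, ⟨b, hb, rfl⟩, rfl⟩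
    exact ⟨a + b, ⟨a, ha, b, hb, rfl⟩, by simp [MvPolynomial.monomial_mul]⟩
  · rintro ⟨_, ⟨a, ha, b, hb, rfl⟩, rfl⟩
    exact ⟨_, ⟨a, ha, rfl⟩, _, ⟨b, hb, rfl⟩, by simp [MvPolynomial.monomial_mul]⟩

theorem genBy_add (E F : Set Mon) : genBy K E + genBy K F = genBy K (E ∪ F) := by
  rw [genBy, genBy, genBy, Set.image_union, Ideal.span_union, Submodule.add_eq_sup]

theorem genBy_zero : genBy K {0} = 1 := by
  simp [genBy]

section closure
variable {I J : Ideal (MvPolynomial (Fin 2) K)}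

theorem IsMonomialIdeal.mul (hI : IsMonomialIdeal I) (hJ : IsMonomialIdeal J) :
    IsMonomialIdeal (I * J) := by
  obtain ⟨E, rfl⟩ := hI
  obtain ⟨F, rfl⟩ := hJ
  exact ⟨_, genBy_mul E F⟩

theorem IsMonomialIdeal.add (hI : IsMonomialIdeal I) (hJ : IsMonomialIdeal J) :
    IsMonomialIdeal (I + J) := by
  obtain ⟨E, rfl⟩ := hI
  obtain ⟨F, rfl⟩ := hJ
  exact ⟨_, genBy_add E F⟩

theorem IsMonomialIdeal.pow (hI : IsMonomialIdeal I) (n : ℕ) : IsMonomialIdeal (I ^ n) := by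
  induction n with
  | zero => exact ⟨{0}, by rw [pow_zero, genBy_zero]⟩
  | succ n ih => rw [pow_succ]; exact ih.mul hI

theorem mem_mons_mul (hI : IsMonomialIdeal I) (hJ : IsMonomialIdeal J) {m : Mon} :
    m ∈ mons (I * J) ↔ ∃ a ∈ mons I, ∃ b ∈ mons J, a + b ≤ m := by
  obtain ⟨E, rfl⟩ := hI
  obtain ⟨F, rfl⟩ := hJ
  simp only [genBy_mul, mem_mons_genBy, Set.mem_add]
  constructor
  · rintro ⟨_, ⟨a, ha, b, hb, rfl⟩, h⟩
    exact ⟨a, ⟨a, ha, le_rfl⟩, b, ⟨b, hb, le_rfl⟩, h⟩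
  · rintro ⟨a, ⟨a', ha', ha⟩, b, ⟨b', hb', hb⟩, h⟩
    exact ⟨_, ⟨a', ha', b', hb', rfl⟩, (add_le_add ha hb).trans h⟩

theorem mem_mons_add (hI : IsMonomialIdeal I) (hJ : IsMonomialIdeal J) {m : Mon} :
    m ∈ mons (I + J) ↔ m ∈ mons I ∨ m ∈ mons J := by
  obtain ⟨E, rfl⟩ := hI
  obtain ⟨F, rfl⟩ := hJ
  simp only [genBy_add, mem_mons_genBy, Set.mem_union, or_and_right, exists_or]

theorem mem_colonMon {m : Mon} {p : MvPolynomial (Fin 2) K} :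
    p ∈ colonMon I m ↔ p * MvPolynomial.monomial m 1 ∈ I := by
  rw [colonMon, Submodule.mem_colon_singleton, smul_eq_mul]

theorem mem_mons_colonMon {m f : Mon} : f ∈ mons (colonMon I m) ↔ f + m ∈ mons I := by
  rw [mem_mons, mem_colonMon, MvPolynomial.monomial_mul, one_mul, mem_mons]

theorem IsMonomialIdeal.colonMon (hI : IsMonomialIdeal I) (m : Mon) :
    IsMonomialIdeal (colonMon I m) := by
  refine isMonomialIdeal_of_mem fun p hp f hf => ?_
  rw [mem_colonMon, hI.mem_iff] at hp
  rw [mem_mons_colonMon]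
  apply hp
  rw [MvPolynomial.mem_support_iff] at *
  simpa [MvPolynomial.coeff_mul_monomial] using hf

theorem IsMonomialIdeal.mulMon (hI : IsMonomialIdeal I) (m : Mon) :
    IsMonomialIdeal (mulMon m I) := (genBy_isMonomialIdeal _).mul hI

theorem mem_mons_mulMon (hI : IsMonomialIdeal I) {m f : Mon} :
    f ∈ mons (mulMon m I) ↔ ∃ a ∈ mons I, m + a = f := by
  rw [mulMon, mem_mons_mul (genBy_isMonomialIdeal _) hI]
  simp only [mem_mons_genBy, Set.mem_singleton_iff, exists_eq_left]
  constructor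
  · rintro ⟨a, ha, b, hb, h⟩
    have hm : m ≤ f := ha.trans ((le_add_of_nonneg_right zero_le).trans h)
    refine ⟨f - m, mons_mono hb ?_, add_tsub_cancel_of_le hm⟩
    rw [le_tsub_iff_left hm]
    exact (add_le_add ha le_rfl).trans h
  · rintro ⟨a, ha, rfl⟩
    exact ⟨m, le_rfl, a, ha, le_rfl⟩

theorem mem_mons_one (m : Mon) : m ∈ mons (1 : Ideal (MvPolynomial (Fin 2) K)) := by
  rw [mem_mons, Ideal.one_eq_top]; trivial

theorem mem_mons_pow (hI : IsMonomialIdeal I) {n : ℕ} {m : Mon} :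
    m ∈ mons (I ^ n) ↔
      ∃ s : Multiset Mon, s.card = n ∧ (∀ a ∈ s, a ∈ mons I) ∧ s.sum ≤ m := by
  induction n generalizing m with
  | zero =>
    rw [pow_zero]
    exact iff_of_true (mem_mons_one m) ⟨0, by simp⟩
  | succ n ih =>
    rw [pow_succ, mem_mons_mul (hI.pow n) hI]
    constructor
    · rintro ⟨a, ha, b, hb, h⟩
      obtain ⟨s, hs, hs', hs''⟩ := ih.1 ha
      refine ⟨b ::ₘ s, by simp [hs], ?_, ?_⟩
      · intro c hc
        rcases Multiset.mem_cons.1 hc with rfl | hc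
        exacts [hb, hs' c hc]
      · rw [Multiset.sum_cons, add_comm]
        exact (add_le_add hs'' le_rfl).trans h
    · rintro ⟨s, hs, hs', h⟩
      obtain ⟨b, hb⟩ := Multiset.card_pos_iff_exists_mem.1 (by omega : 0 < s.card)
      obtain ⟨t, rfl⟩ := Multiset.exists_cons_of_mem hb
      refine ⟨t.sum, ih.2 ⟨t, by simpa using hs, fun a ha => hs' a (Multiset.mem_cons_of_mem ha),
        le_rfl⟩, b, hs' b hb, ?_⟩
      rwa [Multiset.sum_cons, add_comm] at h

theorem sum_mem_mons_pow (hI : IsMonomialIdeal I) {s : Multiset Mon}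
    (hs : ∀ a ∈ s, a ∈ mons I) : s.sum ∈ mons (I ^ s.card) :=
  (mem_mons_pow hI).2 ⟨s, rfl, hs, le_rfl⟩

end closure

/-! ### Monomials as pairs of exponents -/

@[simp] theorem xy_apply_zero (a b : ℕ) : xy a b 0 = a := by simp [xy]

@[simp] theorem xy_apply_one (a b : ℕ) : xy a b 1 = b := by simp [xy]

theorem mon_ext {m n : Mon} (h₀ : m 0 = n 0) (h₁ : m 1 = n 1) : m = n := by
  ext i; fin_cases i
  exacts [h₀, h₁]

theorem mon_le_iff {m n : Mon} : m ≤ n ↔ m 0 ≤ n 0 ∧ m 1 ≤ n 1 := by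
  rw [Finsupp.le_def, Fin.forall_fin_two]

@[simp] theorem xy_eta (m : Mon) : xy (m 0) (m 1) = m := mon_ext (by simp) (by simp)

theorem exists_minimal_le {I : Ideal (MvPolynomial (Fin 2) K)} {m : Mon} (hm : m ∈ mons I) :
    ∃ f ∈ mingens I, f ≤ m := by
  obtain ⟨f, hf, hf'⟩ := exists_minimal_le_of_wellFoundedLT (fun m' => m' ∈ mons I) m hm
  exact ⟨f, hf', hf⟩

/-! ### Profiles -/

/-- The monomial ideal `I` has profile `φ`: the monomial `x^a y^b` is in `I` iff `φ b ≤ a`. -/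
structure HasProf (I : Ideal (MvPolynomial (Fin 2) K)) (φ : ℕ → ℕ) : Prop where
  isMon : IsMonomialIdeal I
  mem : ∀ m : Mon, m ∈ mons I ↔ φ (m 1) ≤ m 0

/-- The sequence `φ` attains a new strict minimum at `y`. -/
def Drop (φ : ℕ → ℕ) (y : ℕ) : Prop := ∀ z < y, φ y < φ z

namespace HasProf
variable {I J : Ideal (MvPolynomial (Fin 2) K)} {φ ψ : ℕ → ℕ}

theorem mem_xy (h : HasProf I φ) {a b : ℕ} : xy a b ∈ mons I ↔ φ b ≤ a := by
  simpa using h.mem (xy a b)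

theorem antitone (h : HasProf I φ) : Antitone φ := by
  intro y z hyz
  have := h.mem_xy (a := φ y) (b := y)
  rw [← h.mem_xy]
  exact mons_mono (this.2 le_rfl) (by rw [mon_le_iff]; simpa using hyz)

theorem eq (h : HasProf I φ) (h' : HasProf J φ) : I = J :=
  h.isMon.ext h'.isMon fun m => by rw [h.mem, h'.mem]

/-- A row contributes at most its leftmost monomial, and that one is minimal exactly when no lower
row reaches equally far left. -/
theorem mem_mingens (h : HasProf I φ) {m : Mon} :
    m ∈ mingens I ↔ m 0 = φ (m 1) ∧ Drop φ (m 1) := by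
  constructor
  · intro hm
    have hm1 := (h.mem m).1 hm.1
    constructor
    · refine le_antisymm ?_ hm1
      have := hm.2 (y := xy (φ (m 1)) (m 1)) (h.mem_xy.2 le_rfl) (by rw [mon_le_iff]; simpa)
      simpa using (mon_le_iff.1 this).1
    · intro z hz
      by_contra! hc
      have := hm.2 (y := xy (m 0) z) (h.mem_xy.2 (hc.trans hm1))
        (by rw [mon_le_iff]; simpa using hz.le)
      have := (mon_le_iff.1 this).2
      simp at this
      omega
  · rintro ⟨h0, hd⟩
    refine ⟨(h.mem m).2 h0.ge, fun n hn hnm => ?_⟩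
    rw [mon_le_iff] at hnm ⊢
    have hn := (h.mem n).1 hn
    by_cases hlt : n 1 < m 1
    · have := hd _ hlt; omega
    · have : n 1 = m 1 := by omega
      rw [this] at hn
      omega

/-- The pure power of `x` makes every row nonempty, so the infimum is attained and never the default
value of `sInf ∅`. -/
theorem of_mem (hI : IsMonomialIdeal I) {a : ℕ} (ha : xy a 0 ∈ mons I) :
    HasProf I (fun y => sInf {x | xy x y ∈ mons I}) := by
  refine ⟨hI, fun m => ?_⟩
  have hne : {x | xy x (m 1) ∈ mons I}.Nonempty :=
    ⟨a, mons_mono ha (by rw [mon_le_iff]; simp)⟩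
  constructor
  · intro hm
    exact Nat.sInf_le (by simpa using hm)
  · intro hm
    exact mons_mono (Nat.sInf_mem hne) (by rw [mon_le_iff]; simpa using hm)

theorem congr (h : HasProf I φ) (h' : ∀ y, φ y = ψ y) : HasProf I ψ := by
  rwa [← funext h']

/-- A zero of `φ` is a pure power of `y`; a pure power of `x` is present in any case, as `φ 0` is
finite. -/
theorem gcdMon_eq (h : HasProf I φ) {d : ℕ} (hd : φ d = 0) : gcdMon I = 0 := by
  rw [gcdMon]
  have h0 : sInf ((fun m : Mon => m 0) '' mons I) = 0 :=
    Nat.sInf_eq_zero.2 (Or.inl ⟨xy 0 d, h.mem_xy.2 hd.le, by simp⟩)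
  have h1 : sInf ((fun m : Mon => m 1) '' mons I) = 0 :=
    Nat.sInf_eq_zero.2 (Or.inl ⟨xy (φ 0) 0, h.mem_xy.2 le_rfl, by simp⟩)
  rw [h0, h1]
  simp [xy]

theorem red_eq (h : HasProf I φ) {d : ℕ} (hd : φ d = 0) : red I = I := by
  refine (h.isMon.colonMon _).ext h.isMon fun m => ?_
  rw [mem_mons_colonMon, h.gcdMon_eq hd, add_zero]

theorem idist_zero (h : HasProf I φ) {d : ℕ} (hd : φ d = 0) : idist 0 I = φ 0 := by
  rw [idist, h.red_eq hd]
  refine IsGreatest.csSup_eq ⟨⟨xy (φ 0) 0, h.mem_mingens.2 (by simp [Drop]), by simp⟩, ?_⟩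
  rintro _ ⟨m, hm, rfl⟩
  rw [h.mem_mingens] at hm
  simp only [hm.1]
  exact h.antitone (Nat.zero_le _)

theorem idist_one (h : HasProf I φ) {d : ℕ} (hd : φ d = 0) (hd' : ∀ y < d, φ y ≠ 0) :
    idist 1 I = d := by
  rw [idist, h.red_eq hd]
  refine IsGreatest.csSup_eq ⟨⟨xy 0 d, h.mem_mingens.2 ?_, by simp⟩, ?_⟩
  · simp only [xy_apply_zero, xy_apply_one, hd, true_and]
    intro z hz
    rw [hd]
    exact Nat.pos_of_ne_zero (hd' z hz)
  · rintro _ ⟨m, hm, rfl⟩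
    rw [h.mem_mingens] at hm
    by_contra! hc
    have := hm.2 d hc
    omega

theorem mem_mulMon (h : HasProf I φ) (q : Mon) {m : Mon} :
    m ∈ mons (mulMon q I) ↔ q 1 ≤ m 1 ∧ φ (m 1 - q 1) + q 0 ≤ m 0 := by
  rw [mem_mons_mulMon h.isMon]
  constructor
  · rintro ⟨a, ha, rfl⟩
    rw [h.mem] at ha
    simp
    omega
  · rintro ⟨h1, h2⟩
    refine ⟨xy (m 0 - q 0) (m 1 - q 1), h.mem_xy.2 (by omega), mon_ext ?_ ?_⟩ <;> simp <;> omega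

/-- The profile of a link. -/
theorem link (h : HasProf I φ) (h' : HasProf J ψ) {d e : ℕ} (hd : φ d = 0)
    (he : ψ e = 0) (he' : ∀ y < e, ψ y ≠ 0) :
    HasProf (link I J) (fun y => if y < e then ψ y + φ 0 else φ (y - e)) := by
  have hr1 := h.red_eq hd
  have hr2 := h'.red_eq he
  have hd1 := h.idist_zero hd
  have hd2 := h'.idist_one he he'
  refine ⟨?_, fun m => ?_⟩
  · rw [BivariateMonomial.link, hr1, hr2]
    exact (h.isMon.mulMon _).add (h'.isMon.mulMon _)
  · rw [BivariateMonomial.link, hr1, hr2, mem_mons_add (h.isMon.mulMon _) (h'.isMon.mulMon _),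
      h.mem_mulMon, h'.mem_mulMon, hd1, hd2]
    simp only [xy_apply_zero, xy_apply_one, Nat.sub_zero, Nat.zero_le, true_and, add_zero]
    split_ifs with hlt
    · constructor
      · rintro (h1 | h1) <;> omega
      · exact Or.inr
    -- In rows from `e` on, the first summand reaches `φ (y - e) ≤ φ 0`, hence at least as far left
    -- as the second.
    · constructor
      · rintro (h1 | h1)
        · exact h1.2
        · exact (h.antitone (Nat.zero_le _)).trans ((Nat.le_add_left _ _).trans h1)
      · intro h1
        exact Or.inl ⟨by omega, h1⟩

/-- The rows below `q 1` are empty, so `mulMon q I` need not have a profile; the argument of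
`mem_mingens` is repeated in shifted coordinates. -/
theorem mingens_mulMon (h : HasProf I φ) (q : Mon) {m : Mon} :
    m ∈ mingens (mulMon q I) ↔
      q 1 ≤ m 1 ∧ m 0 = φ (m 1 - q 1) + q 0 ∧ Drop φ (m 1 - q 1) := by
  constructor
  · intro hm
    obtain ⟨h1, h2⟩ := (h.mem_mulMon q).1 hm.1
    refine ⟨h1, ?_, ?_⟩
    · refine le_antisymm ?_ h2
      have := hm.2 (y := xy (φ (m 1 - q 1) + q 0) (m 1))
        ((h.mem_mulMon q).2 (by simpa)) (by rw [mon_le_iff]; simpa)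
      simpa using (mon_le_iff.1 this).1
    · intro z hz
      by_contra! hc
      have := hm.2 (y := xy (m 0) (z + q 1)) ((h.mem_mulMon q).2 (by simp; omega))
        (by rw [mon_le_iff]; simp; omega)
      have := (mon_le_iff.1 this).2
      simp at this
      omega
  · rintro ⟨h1, h2, hd⟩
    refine ⟨(h.mem_mulMon q).2 ⟨h1, h2.ge⟩, fun n hn hnm => ?_⟩
    rw [mon_le_iff] at hnm ⊢
    obtain ⟨h3, h4⟩ := (h.mem_mulMon q).1 hn
    by_cases hlt : n 1 < m 1
    · have := hd (n 1 - q 1) (by omega); omega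
    · have : n 1 = m 1 := by omega
      rw [this] at h4
      omega

end HasProf

/-! ### Drops of antitone sequences -/

/-- By monotonicity only the preceding value has to be compared; row `0` is always a drop, whence
the clause `1 ≤ y`. -/
theorem not_drop_iff {φ : ℕ → ℕ} (hφ : Antitone φ) {y : ℕ} :
    ¬ Drop φ y ↔ 1 ≤ y ∧ φ (y - 1) = φ y := by
  constructor
  · intro h
    simp only [Drop, not_forall, not_lt] at h
    obtain ⟨z, hz, h⟩ := h
    refine ⟨by omega, le_antisymm ((hφ (by omega : z ≤ y - 1)).trans h) (hφ (by omega))⟩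
  · rintro ⟨h1, h2⟩ h
    have := h (y - 1) (by omega)
    omega

theorem drop_succ_iff {φ : ℕ → ℕ} (hφ : Antitone φ) {y : ℕ} :
    Drop φ (y + 1) ↔ φ (y + 1) < φ y := by
  rw [← not_iff_not, not_drop_iff hφ]
  have := hφ (Nat.le_succ y)
  simp only [Nat.succ_eq_add_one] at this
  simp
  omega

theorem eq_of_not_drop {φ : ℕ → ℕ} (hφ : Antitone φ) {y z : ℕ} (hyz : y ≤ z)
    (h : ∀ t, y < t → t ≤ z → ¬ Drop φ t) : φ z = φ y := by
  induction z, hyz using Nat.le_induction with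
  | base => rfl
  | succ z hyz ih =>
    rw [← ih fun t h1 h2 => h t h1 (by omega)]
    have := h (z + 1) (by omega) le_rfl
    rw [not_drop_iff hφ] at this
    simpa using this.2.symm

/-- `η` is the first drop of `φ` that is at least `Y`. -/
structure FirstDrop (φ : ℕ → ℕ) (Y η : ℕ) : Prop where
  le : Y ≤ η
  drop : Drop φ η
  min : ∀ y, Y ≤ y → Drop φ y → η ≤ y

theorem FirstDrop.unique {φ : ℕ → ℕ} {Y η η' : ℕ} (h : FirstDrop φ Y η) (h' : FirstDrop φ Y η') :
    η = η' :=
  le_antisymm (h.min _ h'.le h'.drop) (h'.min _ h.le h.drop)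

theorem FirstDrop.exists {φ : ℕ → ℕ} {Y : ℕ} (h : ∃ y, Y ≤ y ∧ Drop φ y) :
    ∃ η, FirstDrop φ Y η := by
  classical
  exact ⟨Nat.find h, (Nat.find_spec h).1, (Nat.find_spec h).2,
    fun y h1 h2 => Nat.find_min' h ⟨h1, h2⟩⟩

/-! ### Chains of monomials and sums of two-generator pieces -/

/-- The coordinates `(a i, b i)`, `1 ≤ i ≤ k + 1`, of a chain of monomials going from the `y`-axis
to the `x`-axis, with horizontal and vertical steps `u i` and `v i`. -/
structure Chain (a b u v : ℕ → ℕ) (k : ℕ) : Prop where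
  one_le : 1 ≤ k
  a_succ : ∀ i, 1 ≤ i → i ≤ k → a (i + 1) = a i + u i
  b_succ : ∀ i, 1 ≤ i → i ≤ k → b i = b (i + 1) + v i
  u_pos : ∀ i, 1 ≤ i → i ≤ k → 0 < u i
  v_pos : ∀ i, 1 ≤ i → i ≤ k → 0 < v i
  a_one : a 1 = 0
  b_last : b (k + 1) = 0

namespace Chain
variable {a b u v : ℕ → ℕ} {k : ℕ}

theorem a_mono (c : Chain a b u v k) {i l : ℕ} (hi : 1 ≤ i) (hil : i ≤ l) (hl : l ≤ k + 1) :
    a i ≤ a l := by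
  induction l, hil using Nat.le_induction with
  | base => rfl
  | succ l hil ih =>
    rw [c.a_succ l (by omega) (by omega)]
    exact (ih (by omega)).trans (Nat.le_add_right _ _)

theorem b_anti (c : Chain a b u v k) {i l : ℕ} (hi : 1 ≤ i) (hil : i ≤ l) (hl : l ≤ k + 1) :
    b l ≤ b i := by
  induction l, hil using Nat.le_induction with
  | base => rfl
  | succ l hil ih =>
    have := c.b_succ l (by omega) (by omega)
    have := ih (by omega)
    omega

end Chain

/-- `x^x y^y` lies in `(g_i, g_{i+1})^{n+1} J`, where `g_i = x^(a i) y^(b i)` and `J` has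
profile `j`. -/
def Rep (a b j : ℕ → ℕ) (n i x y : ℕ) : Prop :=
  ∃ p q t, p + q = n + 1 ∧ p * b i + q * b (i + 1) + t ≤ y ∧ p * a i + q * a (i + 1) + j t ≤ x

/-- `φ` is the profile of the sum of the ideals `(g_i, g_{i+1})^{n+1} J`. -/
structure Pieces (a b u v j : ℕ → ℕ) (k d n : ℕ) (φ : ℕ → ℕ) : Prop extends Chain a b u v k where
  anti : Antitone φ
  j_d : j d = 0
  d_le : ∀ i, 1 ≤ i → i ≤ k → d ≤ n * v i
  mem : ∀ x y, φ y ≤ x ↔ ∃ i, 1 ≤ i ∧ i ≤ k ∧ Rep a b j n i x y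

namespace Pieces
variable {a b u v j : ℕ → ℕ} {k d n : ℕ} {φ φ' : ℕ → ℕ}

/-- The witness is `g_{i+1}^(n+1) y^d`. This is where `d ≤ n v_i` enters: its `y`-degree is then at
most `n b_i + b_{i+1}`. -/
theorem rep_top (h : Pieces a b u v j k d n φ) {i y : ℕ} (hi : 1 ≤ i) (hik : i ≤ k)
    (hy : n * b i + b (i + 1) ≤ y) : Rep a b j n i ((n + 1) * a (i + 1)) y := by
  refine ⟨0, n + 1, d, by omega, ?_, ?_⟩
  · have h1 := h.d_le i hi hik
    have h2 := h.b_succ i hi hik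
    rw [h2] at hy
    linarith
  · rw [h.j_d]
    simp

theorem le_top (h : Pieces a b u v j k d n φ) {i y : ℕ} (hi : 1 ≤ i) (hik : i ≤ k)
    (hy : n * b i + b (i + 1) ≤ y) : φ y ≤ (n + 1) * a (i + 1) :=
  (h.mem _ _).2 ⟨i, hi, hik, h.rep_top hi hik hy⟩

theorem le_of_rep (h : Pieces a b u v j k d n φ) {i x y : ℕ} (hi : 1 ≤ i) (hik : i ≤ k)
    (hr : Rep a b j n i x y) : φ y ≤ x :=
  (h.mem _ _).2 ⟨i, hi, hik, hr⟩

/-- Multiplication by `g_{i+1}` identifies the middle parts of consecutive powers. -/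
theorem shift (h : Pieces a b u v j k d n φ) (h' : Pieces a b u v j k d (n + 1) φ')
    (hmul : ∀ l, 1 ≤ l → l ≤ k + 1 → ∀ y, φ' (y + b l) ≤ φ y + a l) {i y : ℕ} (hik : i ≤ k)
    (h1 : i < k → n * b (i + 1) + b (i + 2) ≤ y) (h2 : 1 ≤ i → y < (n + 1) * b i + v i) :
    φ' (y + b (i + 1)) = φ y + a (i + 1) := by
  refine le_antisymm (hmul _ (by omega) (by omega) _) ?_
  obtain ⟨l, hl1, hlk, p, q, t, hpq, hy, hx⟩ := (h'.mem _ _).1 (le_refl (φ' (y + b (i + 1))))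
  set x := φ' (y + b (i + 1))
  -- If the product has a factor `g_{i+1}`, cancel it. Otherwise either all its factors have index
  -- at most `i`, and its `y`-degree is at least `(n+2) b_i`, which is too large; or all have index
  -- at least `i + 2`, and its `x`-degree is at least `(n+2) a_{i+2}`, while `φ y ≤ (n+1) a_{i+2}`
  -- by `le_top`.
  have hcase : (l = i ∧ 1 ≤ q) ∨ (l = i + 1 ∧ 1 ≤ p) ∨ (l < i ∨ l = i ∧ q = 0) ∨
      (i + 1 < l ∨ l = i + 1 ∧ p = 0) := by omega
  rcases hcase with ⟨rfl, hq⟩ | ⟨rfl, hp⟩ | hlow | hhigh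
  · obtain ⟨q, rfl⟩ := Nat.exists_eq_add_of_le' hq
    have : φ y ≤ x - a (l + 1) :=
      h.le_of_rep hl1 hlk ⟨p, q, t, by omega, by linarith, by
        apply Nat.le_sub_of_add_le; linarith⟩
    have : a (l + 1) ≤ x := by nlinarith
    omega
  · obtain ⟨p, rfl⟩ := Nat.exists_eq_add_of_le' hp
    have : φ y ≤ x - a (i + 1) :=
      h.le_of_rep hl1 hlk ⟨p, q, t, by omega, by linarith, by
        apply Nat.le_sub_of_add_le; linarith⟩
    have : a (i + 1) ≤ x := by nlinarith
    omega
  · exfalso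
    have hi : 1 ≤ i := by omega
    have e1 : b i ≤ b l := h.b_anti hl1 (by omega) (by omega)
    have e2 : q * b i ≤ q * b (l + 1) := by
      rcases hlow with hl | ⟨_, rfl⟩
      · exact Nat.mul_le_mul_left _ (h.b_anti (by omega) (by omega) (by omega))
      · simp
    have e3 : p * b i ≤ p * b l := Nat.mul_le_mul_left _ e1
    have e4 : (p + q) * b i = p * b i + q * b i := by ring
    rw [hpq] at e4
    have e5 := h.b_succ i hi hik
    have := h2 hi
    linarith
  · have hi : i < k := by omega
    have e1 : a (i + 2) ≤ a (l + 1) := h.a_mono (by omega) (by omega) (by omega)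
    have e2 : p * a (i + 2) ≤ p * a l := by
      rcases hhigh with hl | ⟨_, rfl⟩
      · exact Nat.mul_le_mul_left _ (h.a_mono (by omega) (by omega) (by omega))
      · simp
    have e3 : q * a (i + 2) ≤ q * a (l + 1) := Nat.mul_le_mul_left _ e1
    have e4 : (p + q) * a (i + 2) = p * a (i + 2) + q * a (i + 2) := by ring
    rw [hpq] at e4
    have e5 := h.le_top (i := i + 1) (by omega) (by omega) (h1 hi)
    have e6 : a (i + 1) ≤ a (i + 2) := h.a_mono (by omega) (by omega) (by omega)
    have e7 : (n + 1 + 1) * a (i + 2) = (n + 1) * a (i + 2) + a (i + 2) := by ring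
    change φ y ≤ (n + 1) * a (i + 2) at e5
    omega

theorem low_le (h : Pieces a b u v j k d n φ) {i : ℕ} (hi : i < k) :
    n * b (i + 1) + b (i + 2) ≤ (n + 1) * b (i + 1) := by
  have : b (i + 2) ≤ b (i + 1) := h.b_anti (by omega) (by omega) (by omega)
  linarith

theorem low_add (h : Pieces a b u v j k d n φ) {i : ℕ} (hi : 1 ≤ i) (hik : i ≤ k) :
    n * b i + b (i + 1) + v i = (n + 1) * b i := by
  have e3 := h.b_succ i hi hik
  linarith

section consecutive

variable (h : Pieces a b u v j k d n φ) (h' : Pieces a b u v j k d (n + 1) φ')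
  (hmul : ∀ l, 1 ≤ l → l ≤ k + 1 → ∀ y, φ' (y + b l) ≤ φ y + a l)
include h h' hmul

/-- Row `y + b_i` of the next power is reached from row `y` by `g_i` and from row `y + v_i` by
`g_{i+1}`. Only the second multiplication needs to be exact here, so `y` may lie below the window.
-/
theorem period_le {i y : ℕ} (hi : 1 ≤ i) (hik : i ≤ k) (h1 : (n + 1) * b (i + 1) ≤ y + v i)
    (h2 : y < (n + 1) * b i) : φ (y + v i) + u i ≤ φ y := by
  have e1 := h.shift h' hmul (y := y + v i) hik (fun hi => (h.low_le hi).trans h1)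
    (fun _ => by omega)
  have e2 := hmul i hi (by omega) y
  have e3 := h.b_succ i hi hik
  have e4 := h.a_succ i hi hik
  rw [show y + v i + b (i + 1) = y + b i by omega] at e1
  omega

/-- In these rows both multiplications, by `g_i` and by `g_{i+1}`, are exact. -/
theorem period {i y : ℕ} (hi : 1 ≤ i) (hik : i ≤ k) (h1 : n * b i + b (i + 1) ≤ y)
    (h2 : y < (n + 1) * b i) : φ (y + v i) + u i = φ y := by
  have e3 := h.b_succ i hi hik
  have e4 := h.a_succ i hi hik
  have h1' : (n + 1) * b (i + 1) ≤ y := by rw [e3] at h1; linarith [Nat.zero_le (n * v i)]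
  have e1 := h.shift h' hmul (y := y + v i) hik (fun hi => (h.low_le hi).trans (by omega))
    (fun _ => by omega)
  obtain ⟨i, rfl⟩ := Nat.exists_eq_add_of_le' hi
  have e2 := h.shift h' hmul (i := i) (y := y) (by omega) (fun _ => h1) (fun hi => by
    have := Nat.mul_le_mul_left (n + 1) (h.b_anti hi (Nat.le_succ i) (by omega))
    simp only [Nat.succ_eq_add_one] at this
    omega)
  rw [show y + v (i + 1) + b (i + 1 + 1) = y + b (i + 1) by omega] at e1
  omega

/-- A drop of `φ` at `y + v i` comes from a drop at `y`. -/
theorem drop_of_drop_add {i y : ℕ} (hi : 1 ≤ i) (hik : i ≤ k) (h1 : n * b i + b (i + 1) ≤ y)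
    (h2 : y < (n + 1) * b i) (hd : Drop φ (y + v i)) : Drop φ y := by
  by_contra hc
  rw [not_drop_iff h.anti] at hc
  have hv := h.v_pos i hi hik
  have e1 := h.period h' hmul hi hik h1 h2
  have e3 := h.b_succ i hi hik
  have h1' : (n + 1) * b (i + 1) ≤ y := by rw [e3] at h1; linarith [Nat.zero_le (n * v i)]
  have e2 := h.period_le h' hmul (y := y - 1) hi hik (by omega) (by omega)
  have := hd (y - 1 + v i) (by omega)
  omega

/-- Without a drop in the window, `φ` would be constant on a full period starting one row below it,
but `period_le` forces a descent by `u_i > 0` there. -/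
theorem firstDrop_exists {i : ℕ} (hi : 1 ≤ i) (hik : i ≤ k) :
    ∃ η, FirstDrop φ (n * b i + b (i + 1)) η ∧ η < (n + 1) * b i := by
  have hv := h.v_pos i hi hik
  have hu := h.u_pos i hi hik
  have e0 := h.low_add hi hik
  by_contra! hc
  have hno : ∀ y, n * b i + b (i + 1) ≤ y → y < (n + 1) * b i → ¬ Drop φ y := by
    intro y h1 h2 h3
    obtain ⟨η, hη⟩ := FirstDrop.exists ⟨y, h1, h3⟩
    have := hη.min y h1 h3
    have := hc η hη
    omega
  set Y := n * b i + b (i + 1)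
  obtain ⟨hY, e1⟩ := (not_drop_iff h.anti).1 (hno Y le_rfl (by omega))
  have e2 := eq_of_not_drop h.anti (y := Y - 1) (z := Y - 1 + v i) (by omega)
    (fun t h1 h2 => hno t (by omega) (by omega))
  have e3 := h.b_succ i hi hik
  have e4 : (n + 1) * b (i + 1) ≤ Y := by
    simp only [Y]; rw [e3]; linarith [Nat.zero_le (n * v i)]
  have := h.period_le h' hmul (y := Y - 1) hi hik (by omega) (by omega)
  omega

theorem firstDrop_lt {i η : ℕ} (hi : 1 ≤ i) (hik : i ≤ k)
    (hη : FirstDrop φ (n * b i + b (i + 1)) η) : η < (n + 1) * b i := by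
  obtain ⟨η', h1, h2⟩ := h.firstDrop_exists h' hmul hi hik
  rwa [hη.unique h1]

/-- Moving such a drop down by `v_i` would give a drop of the window before `η`. -/
theorem not_drop_of_lt {i y η : ℕ} (hi : 1 ≤ i) (hik : i ≤ k)
    (hη : FirstDrop φ (n * b i + b (i + 1)) η) (h1 : (n + 1) * b i ≤ y) (h2 : y < η + v i) :
    ¬ Drop φ y := by
  intro hd
  have e0 := h.low_add hi hik
  have e1 := h.firstDrop_lt h' hmul hi hik hη
  obtain ⟨z, rfl⟩ := Nat.exists_eq_add_of_le' (show v i ≤ y by omega)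
  have := hη.min z (by omega) (h.drop_of_drop_add h' hmul hi hik (by omega) (by omega) hd)
  omega

/-- The drop `η` lies at or above row `(n+1) b_{i+1}`, and from there up to `η' + v_{i+1}` there are
none. -/
theorem firstDrop_add_le {i η η' : ℕ} (hi : 1 ≤ i) (hik : i + 1 ≤ k)
    (hη : FirstDrop φ (n * b i + b (i + 1)) η)
    (hη' : FirstDrop φ (n * b (i + 1) + b (i + 2)) η') : η' + v (i + 1) ≤ η := by
  by_contra! hc
  refine h.not_drop_of_lt h' hmul (by omega) hik hη' ?_ hc hη.drop
  have := hη.le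
  have := Nat.mul_le_mul_left n (h.b_anti hi (Nat.le_succ i) (by omega))
  simp only [Nat.succ_eq_add_one] at this
  linarith

/-- If `φ` has no drop at the upper end of a period, then the pure piece has none at its lower
end. -/
theorem rep_of_not_drop {i : ℕ} (hi : 1 ≤ i) (hik : i ≤ k)
    (hd : ¬ Drop φ ((n + 1) * b i)) :
    1 ≤ n * b i + b (i + 1) ∧
      Rep a b j n i (φ (n * b i + b (i + 1))) (n * b i + b (i + 1) - 1) := by
  have hv := h.v_pos i hi hik
  have hu := h.u_pos i hi hik
  have e0 := h.low_add hi hik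
  have e1 := h.period h' hmul hi hik le_rfl (by omega)
  have e2 := h.le_top hi hik le_rfl
  have eb := h.b_succ i hi hik
  have ea := h.a_succ i hi hik
  rw [← e0, not_drop_iff h.anti] at hd
  obtain ⟨_, hd⟩ := hd
  set Y := n * b i + b (i + 1)
  obtain ⟨l, hl1, hlk, p, q, t, hpq, hy, hx⟩ := (h.mem _ _).1 (le_refl (φ (Y + v i - 1)))
  -- If the leftmost monomial of row `Y + v i - 1` uses a factor `g_i`, replacing it by `g_{i+1}`
  -- moves it down by `v i` and right by `u i`, to the claimed place. Any other product lies too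
  -- high or, having `x`-degree at least `(n+1) a_{i+1} ≥ φ Y`, too far right.
  by_cases hl : l = i ∧ 1 ≤ p
  · obtain ⟨rfl, hp⟩ := hl
    obtain ⟨p, rfl⟩ := Nat.exists_eq_add_of_le' hp
    have e3 : p * b l + (q + 1) * b (l + 1) + t + 1 ≤ Y := by
      have : (p + 1) * b l = p * b l + b l := by ring
      have : (q + 1) * b (l + 1) = q * b (l + 1) + b (l + 1) := by ring
      omega
    refine ⟨by omega, p, q + 1, t, by omega, by omega, ?_⟩
    have : (p + 1) * a l = p * a l + a l := by ring
    have : (q + 1) * a (l + 1) = q * a (l + 1) + a (l + 1) := by ring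
    omega
  · exfalso
    by_cases hli : l < i
    · have f1 := Nat.mul_le_mul_left p (h.b_anti hl1 hli.le (by omega))
      have f2 := Nat.mul_le_mul_left q (h.b_anti (by omega) hli (by omega))
      have f3 : (p + q) * b i = p * b i + q * b i := by ring
      rw [hpq] at f3
      simp only [Nat.succ_eq_add_one] at f2
      omega
    · have f1 : p * a (i + 1) ≤ p * a l := by
        rcases Nat.eq_zero_or_pos p with rfl | hp
        · simp
        · exact Nat.mul_le_mul_left p (h.a_mono (by omega) (by omega) (by omega))
      have f2 := Nat.mul_le_mul_left q (h.a_mono (i := i + 1) (l := l + 1) (by omega) (by omega)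
        (by omega))
      have f3 : (p + q) * a (i + 1) = p * a (i + 1) + q * a (i + 1) := by ring
      rw [hpq] at f3
      omega

/-- Periodicity says nothing about the row just below the window, so the backward direction needs
`rep_of_not_drop`. -/
theorem drop_add_iff {i : ℕ} (hi : 1 ≤ i) (hik : i ≤ k) :
    Drop φ ((n + 1) * b i) ↔ Drop φ (n * b i + b (i + 1)) := by
  have hv := h.v_pos i hi hik
  have e0 := h.low_add hi hik
  constructor
  · intro hd
    rw [← e0] at hd
    exact h.drop_of_drop_add h' hmul hi hik le_rfl (by omega) hd
  · intro hd
    by_contra hc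
    obtain ⟨h1, h2⟩ := h.rep_of_not_drop h' hmul hi hik hc
    have := h.le_of_rep hi hik h2
    have := hd (n * b i + b (i + 1) - 1) (by omega)
    omega

/-- A drop compares two adjacent rows; the strict lower bound keeps both in the range of `shift`. -/
theorem drop_shift_aux {i y : ℕ} (hik : i ≤ k)
    (h1 : i < k → n * b (i + 1) + b (i + 2) < y) (h2 : 1 ≤ i → y < (n + 1) * b i + v i) :
    Drop φ' (y + b (i + 1)) ↔ Drop φ y := by
  have e1 := h.shift h' hmul hik (fun hi => (h1 hi).le) h2
  rcases y with _ | y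
  · obtain rfl : i = k := by
      by_contra hc
      have := h1 (by omega)
      omega
    rw [h.b_last]
    simp [Drop]
  · have e2 := h.shift h' hmul (y := y) hik (fun hi => Nat.le_of_lt_succ (h1 hi))
      (fun hi => by have := h2 hi; omega)
    rw [show y + 1 + b (i + 1) = y + b (i + 1) + 1 by omega] at *
    rw [drop_succ_iff h'.anti, drop_succ_iff h.anti]
    omega

/-- Multiplication by `g_{i+1}` identifies the drops in the middle parts of consecutive
powers. -/
theorem drop_shift {i y : ℕ} (hik : i ≤ k)
    (h1 : i < k → n * b (i + 1) + b (i + 2) ≤ y) (h2 : 1 ≤ i → y < (n + 1) * b i + v i) :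
    Drop φ' (y + b (i + 1)) ↔ Drop φ y := by
  -- At the lower end of the window, go up one period by `drop_add_iff` and multiply by `g_{i+2}`
  -- instead, which lands in the same row of the next power.
  by_cases hc : i < k ∧ y = n * b (i + 1) + b (i + 2)
  · obtain ⟨hi, rfl⟩ := hc
    have hv := h.v_pos (i + 1) (by omega) hi
    have hb := h.b_succ (i + 1) (by omega) hi
    have e0 := h.low_add (i := i + 1) (by omega) hi
    rw [← h.drop_add_iff h' hmul (i := i + 1) (by omega) hi,
      ← h.drop_shift_aux h' hmul (i := i + 1) hi]
    · simp only [add_assoc, Nat.reduceAdd] at *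
      rw [show (n + 1) * b (i + 1) + b (i + 2) = n * b (i + 1) + (b (i + 2) + b (i + 1)) by
        linarith]
    · intro hi'
      have f1 := h.low_le hi'
      have f2 : (n + 1) * b (i + 1 + 1) < (n + 1) * b (i + 1) :=
        Nat.mul_lt_mul_of_pos_left (by omega) (by omega)
      omega
    · intro _
      omega
  · exact h.drop_shift_aux h' hmul hik (fun hi => lt_of_le_of_ne (h1 hi) (by omega)) h2

/-- Multiplication by `g_i` carries the start of the window and the drops up to `η` to those of the
next power. This lets the analysis be repeated for the next power. -/
theorem firstDrop_succ {i η : ℕ} (hi : 1 ≤ i) (hik : i ≤ k)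
    (hη : FirstDrop φ (n * b i + b (i + 1)) η) :
    FirstDrop φ' ((n + 1) * b i + b (i + 1)) (η + b i) := by
  have e0 : (n + 1) * b i + b (i + 1) = n * b i + b (i + 1) + b i := by ring
  have e1 := h.firstDrop_lt h' hmul hi hik hη
  have hle := hη.le
  obtain ⟨i, rfl⟩ := Nat.exists_eq_add_of_le' hi
  have hb : 1 ≤ i → (n + 1) * b (i + 1) ≤ (n + 1) * b i := fun hi =>
    Nat.mul_le_mul_left (n + 1) (h.b_anti hi (Nat.le_succ i) (by omega))
  refine ⟨by omega, ?_, ?_⟩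
  · rw [h.drop_shift h' hmul (by omega) (fun _ => hle) (fun hi => ?_)]
    · exact hη.drop
    · have := hb hi
      omega
  · intro y hy hd
    by_contra! hc
    obtain ⟨z, rfl⟩ := Nat.exists_eq_add_of_le' (show b (i + 1) ≤ y by omega)
    rw [h.drop_shift h' hmul (by omega) (fun _ => by change n * b (i + 1) + b (i + 1 + 1) ≤ z; omega)
      (fun hi => ?_)] at hd
    · have := hη.min z (by omega) hd
      omega
    · have := hb hi
      omega

end consecutive

/-- Between two consecutive middle parts only two pieces contribute. -/
theorem le_iff_rep_or (h : Pieces a b u v j k d n φ) {i x y : ℕ} (hik : i ≤ k)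
    (h1 : i < k → n * b (i + 1) + b (i + 2) ≤ y) (h2 : 1 ≤ i → y < (n + 1) * b i) :
    φ y ≤ x ↔ (1 ≤ i ∧ Rep a b j n i x y) ∨ (i < k ∧ Rep a b j n (i + 1) x y) := by
  constructor
  · intro hx
    obtain ⟨l, hl1, hlk, p, q, t, hpq, hy, hx⟩ := (h.mem _ _).1 hx
    by_cases e1 : l = i
    · subst e1
      exact Or.inl ⟨hl1, p, q, t, hpq, hy, hx⟩
    by_cases e2 : l = i + 1
    · subst e2
      exact Or.inr ⟨by omega, p, q, t, hpq, hy, hx⟩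
    -- A piece with `l < i` has only factors of `y`-degree at least `b_i` and lies too high. A piece
    -- with `l > i + 1` is replaced by the monomial `g_{i+2}^(n+1) y^d` of piece `i + 1`, which is
    -- no further right.
    by_cases hli : l < i
    · exfalso
      have f1 := Nat.mul_le_mul_left p (h.b_anti hl1 hli.le (by omega))
      have f2 := Nat.mul_le_mul_left q (h.b_anti (by omega) hli (by omega))
      have f3 : (p + q) * b i = p * b i + q * b i := by ring
      rw [hpq] at f3
      simp only [Nat.succ_eq_add_one] at f2
      have := h2 (by omega)
      omega
    · refine Or.inr ⟨by omega, ?_⟩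
      have hi : i < k := by omega
      obtain ⟨p', q', t', h1', h2', h3'⟩ := h.rep_top (i := i + 1) (by omega) (by omega) (h1 hi)
      refine ⟨p', q', t', h1', h2', h3'.trans ?_⟩
      have f1 := Nat.mul_le_mul_left p (h.a_mono (i := i + 2) (l := l) (by omega) (by omega)
        (by omega))
      have f2 := Nat.mul_le_mul_left q (h.a_mono (i := i + 2) (l := l + 1) (by omega) (by omega)
        (by omega))
      have f3 : (p + q) * a (i + 2) = p * a (i + 2) + q * a (i + 2) := by ring
      rw [hpq] at f3
      simp only [add_assoc, Nat.reduceAdd] at *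
      omega
  · rintro (⟨hi, hr⟩ | ⟨hi, hr⟩)
    · exact h.le_of_rep hi hik hr
    · exact h.le_of_rep (by omega) hi hr

theorem not_rep (hpos : ∀ l, 1 ≤ l → l ≤ k → b (l + 1) ≤ b l) {i x y : ℕ} (hi : 1 ≤ i)
    (hik : i ≤ k) (hy : y < (n + 1) * b (i + 1)) : ¬ Rep a b j n i x y := by
  rintro ⟨p, q, t, hpq, hy', -⟩
  have f1 := Nat.mul_le_mul_left p (hpos i hi hik)
  have f3 : (p + q) * b (i + 1) = p * b (i + 1) + q * b (i + 1) := by ring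
  rw [hpq] at f3
  omega

/-- In the middle parts only one piece contributes. -/
theorem le_iff_rep (h : Pieces a b u v j k d n φ) {i x y : ℕ} (hi : 1 ≤ i) (hik : i ≤ k)
    (h1 : n * b i + b (i + 1) ≤ y) (h2 : y < (n + 1) * b i) :
    φ y ≤ x ↔ Rep a b j n i x y := by
  obtain ⟨i, rfl⟩ := Nat.exists_eq_add_of_le' hi
  rw [h.le_iff_rep_or (i := i) (by omega) (fun _ => h1) (fun hi => ?_)]
  · constructor
    · rintro (⟨hi, hr⟩ | ⟨_, hr⟩)
      · exfalso
        refine not_rep (k := k) (fun l h1 h2 => ?_) hi (by omega) h2 hr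
        exact h.b_anti h1 (Nat.le_succ l) (by omega)
      · exact hr
    · exact fun hr => Or.inr ⟨by omega, hr⟩
  · have := Nat.mul_le_mul_left (n + 1) (h.b_anti hi (Nat.le_succ i) (by omega))
    simp only [Nat.succ_eq_add_one] at this
    omega

end Pieces

/-! ### Weighted degrees and the boundary of the Newton polygon -/

theorem eq_of_multiset_sum_le {α : Type*} {s : Multiset α} {f : α → ℕ} {c : ℕ}
    (h : ∀ a ∈ s, c ≤ f a) (hs : (s.map f).sum ≤ s.card * c) {a : α} (ha : a ∈ s) : f a = c := by
  obtain ⟨t, rfl⟩ := Multiset.exists_cons_of_mem ha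
  have h1 := Multiset.card_nsmul_le_sum (s := t.map f) (a := c) (by
    intro x hx
    obtain ⟨y, hy, rfl⟩ := Multiset.mem_map.1 hx
    exact h y (Multiset.mem_cons_of_mem hy))
  have h2 := h a ha
  simp only [Multiset.map_cons, Multiset.sum_cons, Multiset.card_cons, Multiset.card_map,
    smul_eq_mul] at *
  have : (t.card + 1) * c = t.card * c + c := by ring
  omega

/-- The weighted degree `A deg_x + B deg_y`. -/
noncomputable def wdeg (A B : ℕ) : Mon →+ ℕ := A • Finsupp.applyAddHom 0 + B • Finsupp.applyAddHom 1

theorem wdeg_apply (A B : ℕ) (m : Mon) : wdeg A B m = A * m 0 + B * m 1 := by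
  simp [wdeg]

theorem wdeg_mono {A B : ℕ} {m n : Mon} (h : m ≤ n) : wdeg A B m ≤ wdeg A B n := by
  rw [mon_le_iff] at h
  rw [wdeg_apply, wdeg_apply]
  exact add_le_add (Nat.mul_le_mul_left _ h.1) (Nat.mul_le_mul_left _ h.2)

/-- A minimizer of a positive weighted degree, of least `x`-degree, is persistent. -/
theorem persistent_of_wdeg_min {I : Ideal (MvPolynomial (Fin 2) K)} {f : Mon} {A B : ℕ}
    (hB : 0 < B) (hA : 0 < A) (hf : f ∈ mons I) (h1 : ∀ m ∈ mons I, wdeg A B f ≤ wdeg A B m)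
    (h2 : ∀ m ∈ mons I, wdeg A B m = wdeg A B f → f 0 ≤ m 0) : f ∈ persistent I := by
  have hmin : f ∈ mingens I := by
    refine ⟨hf, fun m hm hmf => ?_⟩
    have e1 := h1 m hm
    rw [mon_le_iff] at *
    rw [wdeg_apply, wdeg_apply] at e1
    have := Nat.mul_le_mul_left A hmf.1
    have := Nat.mul_le_mul_left B hmf.2
    exact ⟨Nat.le_of_mul_le_mul_left (by omega) hA, Nat.le_of_mul_le_mul_left (by omega) hB⟩
  refine ⟨hmin, fun g hg h hh hc => ?_⟩
  obtain ⟨n, hn, hc⟩ := hc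
  obtain ⟨s, rfl, hs, hsum⟩ := (mem_mons_pow (genBy_isMonomialIdeal _)).1 hc
  have hsI : ∀ e ∈ s, e ∈ mons I := by
    intro e he
    obtain ⟨c, hc, hce⟩ := mem_mons_genBy.1 (hs e he)
    rcases hc with rfl | rfl
    · exact mons_mono hg.1 hce
    · exact mons_mono hh.1 hce
  -- The weights of the factors sum to at most `s.card` times the minimum, so each factor attains
  -- it. The same argument for the `x`-degree then leaves only `f` itself.
  have hw : ∀ e ∈ s, wdeg A B e = wdeg A B f := fun e he =>
    eq_of_multiset_sum_le (fun e he => h1 e (hsI e he)) (by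
      have := wdeg_mono (A := A) (B := B) hsum
      rwa [map_multiset_sum, map_nsmul, smul_eq_mul] at this) he
  have hx : ∀ e ∈ s, e 0 = f 0 := fun e he =>
    eq_of_multiset_sum_le (f := fun e : Mon => e 0) (fun e he => h2 e (hsI e he) (hw e he)) (by
      have := (mon_le_iff.1 hsum).1
      rw [Finsupp.smul_apply, smul_eq_mul] at this
      rwa [← Finsupp.applyAddHom_apply, map_multiset_sum] at this) he
  obtain ⟨e, he⟩ := Multiset.card_pos_iff_exists_mem.1 hn
  have hef : e = f := by
    refine mon_ext (hx e he) ?_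
    have e1 := hw e he
    rw [wdeg_apply, wdeg_apply, hx e he] at e1
    exact Nat.eq_of_mul_eq_mul_left hB (by omega)
  subst hef
  obtain ⟨c, hc, hce⟩ := mem_mons_genBy.1 (hs e he)
  rcases hc with rfl | rfl
  · exact hg.2 (le_antisymm hce (hmin.2 hg.1 hce))
  · exact hh.2 (le_antisymm hce (hmin.2 hh.1 hce))

theorem exists_persistent_wdeg_min {I : Ideal (MvPolynomial (Fin 2) K)} {A B : ℕ}
    (hB : 0 < B) (hA : 0 < A) (hI : (mons I).Nonempty) :
    ∃ f ∈ persistent I, ∀ m ∈ mons I, wdeg A B f ≤ wdeg A B m := by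
  obtain ⟨f₀, hf₀, hmin₀⟩ : ∃ f ∈ mons I, ∀ m ∈ mons I, wdeg A B f ≤ wdeg A B m := by
    obtain ⟨f, hf⟩ := exists_minimalFor_of_wellFoundedLT (fun m => m ∈ mons I) (wdeg A B) hI
    exact ⟨f, hf.1, fun m hm => by
      by_contra! hc
      exact absurd (hf.2 hm hc.le) (not_le.2 hc)⟩
  obtain ⟨f, hf⟩ := exists_minimalFor_of_wellFoundedLT
    (fun m => m ∈ mons I ∧ wdeg A B m = wdeg A B f₀) (fun m : Mon => m 0) ⟨f₀, hf₀, rfl⟩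
  have hmin : ∀ m ∈ mons I, wdeg A B f ≤ wdeg A B m := fun m hm => hf.1.2 ▸ hmin₀ m hm
  refine ⟨f, persistent_of_wdeg_min hB hA hf.1.1 hmin fun m hm hmf => ?_, hmin⟩
  by_contra! hc
  exact absurd (hf.2 ⟨hm, hmf.trans hf.1.2⟩ hc.le) (not_le.2 hc)

/-- A chain `g_1, …, g_{k+1}` of minimal generators of `I` that runs along the lower boundary of
the Newton polygon of `I`, from the pure power of `y` to the pure power of `x`. -/
structure GenChain (I : Ideal (MvPolynomial (Fin 2) K)) (g : ℕ → Mon) (k : ℕ) : Prop where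
  isMon : IsMonomialIdeal I
  one_le : 1 ≤ k
  mem : ∀ i, 1 ≤ i → i ≤ k + 1 → g i ∈ mingens I
  x_lt : ∀ i j, 1 ≤ i → i < j → j ≤ k + 1 → g i 0 < g j 0
  y_lt : ∀ i j, 1 ≤ i → i < j → j ≤ k + 1 → g j 1 < g i 1
  x_one : g 1 0 = 0
  y_last : g (k + 1) 1 = 0
  conv : ∀ i l j, 1 ≤ i → i < l → l < j → j ≤ k + 1 →
    (g l 0 - g i 0) * (g l 1 - g j 1) ≤ (g j 0 - g l 0) * (g i 1 - g l 1)
  above : ∀ i, 1 ≤ i → i ≤ k → ∀ m ∈ mons I,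
    wdeg (g i 1 - g (i + 1) 1) (g (i + 1) 0 - g i 0) (g i) ≤
      wdeg (g i 1 - g (i + 1) 1) (g (i + 1) 0 - g i 0) m

section anchored
variable {I : Ideal (MvPolynomial (Fin 2) K)}

/-- As `I : gcd(I) = I`, dividing by the gcd stays inside `I`; applied to a monomial of least degree
in one variable, this removes that variable. -/
theorem exists_pure_of_anchored (hI : Anchored I) (hne : (mons I).Nonempty) :
    (∃ c, xy c 0 ∈ mons I) ∧ ∃ d, xy 0 d ∈ mons I := by
  have hiff : ∀ m, m ∈ mons I ↔ m + gcdMon I ∈ mons I := fun m => by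
    conv_lhs => rw [← hI, red, mem_mons_colonMon]
  have hle : ∀ m ∈ mons I, gcdMon I ≤ m := fun m hm => by
    rw [mon_le_iff]
    exact ⟨by rw [gcdMon, xy_apply_zero]; exact Nat.sInf_le ⟨m, hm, rfl⟩,
      by rw [gcdMon, xy_apply_one]; exact Nat.sInf_le ⟨m, hm, rfl⟩⟩
  have key : ∀ c : Fin 2, ∀ m ∈ mons I, m c = gcdMon I c → ∃ m' ∈ mons I, m' c = 0 := by
    intro c m hm h
    refine ⟨m - gcdMon I, (hiff _).2 ?_, by simp [h]⟩
    rwa [tsub_add_cancel_of_le (hle m hm)]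
  constructor
  · obtain ⟨m, hm, h⟩ := Nat.sInf_mem (hne.image (fun m : Mon => m 1))
    obtain ⟨m', hm', h'⟩ := key 1 m hm (by simpa [gcdMon] using h)
    exact ⟨m' 0, by rw [← h']; simpa⟩
  · obtain ⟨m, hm, h⟩ := Nat.sInf_mem (hne.image (fun m : Mon => m 0))
    obtain ⟨m', hm', h'⟩ := key 0 m hm (by simpa [gcdMon] using h)
    exact ⟨m' 1, by rw [← h']; simpa⟩

theorem exists_hasProf_of_anchored (hmon : IsMonomialIdeal I) (hI : Anchored I)
    (hne : (mons I).Nonempty) : ∃ φ d, HasProf I φ ∧ φ d = 0 ∧ ∀ y < d, φ y ≠ 0 := by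
  obtain ⟨⟨c, hc⟩, d, hd⟩ := exists_pure_of_anchored hI hne
  have h := HasProf.of_mem hmon hc
  have hex : ∃ d, (fun y => sInf {x | xy x y ∈ mons I}) d = 0 := ⟨d, by
    exact Nat.le_zero.1 (h.mem_xy.1 hd)⟩
  classical
  exact ⟨_, Nat.find hex, h, Nat.find_spec hex, fun y hy => Nat.find_min hex hy⟩

theorem pure_y_persistent {φ : ℕ → ℕ} {d : ℕ} (h : HasProf I φ) (hd : φ d = 0)
    (hd' : ∀ y < d, φ y ≠ 0) : xy 0 d ∈ persistent I := by
  have key : ∀ m ∈ mons I, m 0 = 0 → d ≤ m 1 := fun m hm hm0 => by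
    by_contra! hc
    have := (h.mem m).1 hm
    have := hd' _ hc
    omega
  -- With weight `d + 1` on `x`, any monomial involving `x` outweighs `y^d`.
  refine persistent_of_wdeg_min (A := d + 1) (B := 1) (by omega) (by omega)
    (h.mem_xy.2 hd.le) (fun m hm => ?_) (fun m hm _ => by simp)
  simp only [wdeg_apply, xy_apply_zero, xy_apply_one]
  rcases Nat.eq_zero_or_pos (m 0) with h0 | h0
  · have := key m hm h0
    omega
  · have := Nat.mul_le_mul_left (d + 1) h0
    omega

theorem pure_x_persistent {φ : ℕ → ℕ} (h : HasProf I φ) : xy (φ 0) 0 ∈ persistent I := by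
  have key : ∀ m ∈ mons I, 0 < m 1 → φ 0 + 1 ≤ (φ 0 + 1) * m 1 := fun m hm h1 =>
    Nat.le_mul_of_pos_right _ h1
  have key' : ∀ m ∈ mons I, m 1 = 0 → φ 0 ≤ m 0 := fun m hm h1 => by
    rw [← h1]; exact (h.mem m).1 hm
  refine persistent_of_wdeg_min (A := 1) (B := φ 0 + 1) (by omega) (by omega)
    (h.mem_xy.2 le_rfl) (fun m hm => ?_) (fun m hm => ?_)
  all_goals
    simp only [wdeg_apply, xy_apply_zero, xy_apply_one]
    have := key m hm
    have := key' m hm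
    rcases Nat.eq_zero_or_pos (m 1) with h0 | h0
    · rw [h0]; omega
    · omega

theorem mons_nonempty_of_not_principal (hmon : IsMonomialIdeal I)
    (hI : ¬ Submodule.IsPrincipal I) : (mons I).Nonempty ∧ (0 : Mon) ∉ mons I := by
  constructor
  · rw [Set.nonempty_iff_ne_empty]
    intro hc
    apply hI
    have : I = ⊥ := by
      refine (Submodule.eq_bot_iff _).2 fun p hp => ?_
      rw [hmon.mem_iff, hc] at hp
      rw [← MvPolynomial.support_eq_empty]
      exact Finset.eq_empty_of_forall_notMem fun m hm => (hp m hm).elim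
    rw [this]
    infer_instance
  · intro hc
    apply hI
    have : I = ⊤ := (Ideal.eq_top_iff_one _).2 hc
    rw [this]
    infer_instance

/-- The pure powers are persistent, hence the ends of the chain. Weak persistence gives convexity,
since a member strictly above a chord of the chain has a non-minimal power. For an edge, the weight
normal to it is minimized by a persistent generator; this is a chain member, and by convexity none
lies below the edge. -/
theorem genChain_of_persistent (hmon : IsMonomialIdeal I) (hanch : Anchored I)
    (hnp : ¬ Submodule.IsPrincipal I) {P : Finset Mon} (hP₁ : persistent I ⊆ (P : Set Mon))
    (hP₂ : (P : Set Mon) ⊆ weaklyPersistent I) {k : ℕ} {g : ℕ → Mon}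
    (hg : (P : Set Mon) = g '' Set.Icc 1 (k + 1))
    (hgdesc : StrictAntiOn (fun i => g i 1) (Set.Icc 1 (k + 1))) : GenChain I g k := by
  obtain ⟨hne, h0⟩ := mons_nonempty_of_not_principal hmon hnp
  obtain ⟨φ, d, hφ, hd, hd'⟩ := exists_hasProf_of_anchored hmon hanch hne
  have hmem : ∀ i, 1 ≤ i → i ≤ k + 1 → g i ∈ weaklyPersistent I := fun i h1 h2 =>
    hP₂ (hg ▸ ⟨i, ⟨h1, h2⟩, rfl⟩)
  have hex : ∀ f ∈ persistent I, ∃ i, (1 ≤ i ∧ i ≤ k + 1) ∧ g i = f := fun f hf => by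
    have := hP₁ hf
    rw [hg] at this
    exact this
  have hy : ∀ i j, 1 ≤ i → i < j → j ≤ k + 1 → g j 1 < g i 1 := fun i j h1 h2 h3 =>
    hgdesc ⟨h1, by omega⟩ ⟨by omega, h3⟩ h2
  have hx : ∀ i j, 1 ≤ i → i < j → j ≤ k + 1 → g i 0 < g j 0 := fun i j h1 h2 h3 => by
    by_contra! hc
    have e1 := hy i j h1 h2 h3
    have e2 := (hmem i h1 (by omega)).1.2 (hmem j (by omega) h3).1.1
      (mon_le_iff.2 ⟨hc, e1.le⟩)
    have := (mon_le_iff.1 e2).2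
    omega
  have hx1 : g 1 0 = 0 := by
    obtain ⟨i, ⟨h1, h2⟩, hi⟩ := hex _ (pure_y_persistent hφ hd hd')
    have e1 : g i 0 = 0 := by rw [hi, xy_apply_zero]
    rcases h1.eq_or_lt with rfl | h1
    · exact e1
    · have := hx 1 i le_rfl h1 h2
      omega
  have hyk : g (k + 1) 1 = 0 := by
    obtain ⟨i, ⟨h1, h2⟩, hi⟩ := hex _ (pure_x_persistent hφ)
    have e1 : g i 1 = 0 := by rw [hi, xy_apply_one]
    rcases h2.eq_or_lt with rfl | h2
    · exact e1
    · have := hy i (k + 1) h1 h2 le_rfl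
      omega
  have hk : 1 ≤ k := by
    by_contra! hc
    obtain rfl : k = 0 := by omega
    apply h0
    have : g 1 = 0 := mon_ext (by simpa using hx1) (by simpa using hyk)
    rw [← this]
    exact (hmem 1 le_rfl (by omega)).1.1
  have hconv : ∀ i l j, 1 ≤ i → i < l → l < j → j ≤ k + 1 →
      (g l 0 - g i 0) * (g l 1 - g j 1) ≤ (g j 0 - g l 0) * (g i 1 - g l 1) := by
    intro i l j hi hil hlj hj
    have x1 := hx i l hi hil (by omega)
    have x2 := hx l j (by omega) hlj hj
    have y1 := hy i l hi hil (by omega)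
    have y2 := hy l j (by omega) hlj hj
    obtain ⟨p, hp⟩ := Nat.exists_eq_add_of_lt x1
    obtain ⟨q, hq⟩ := Nat.exists_eq_add_of_lt x2
    obtain ⟨p', hp'⟩ := Nat.exists_eq_add_of_lt y1
    obtain ⟨q', hq'⟩ := Nat.exists_eq_add_of_lt y2
    by_contra! hc
    have hw := (hmem l (by omega) (by omega)).2 ((q + 1) + (p + 1)) (by omega)
    -- The exponents are the horizontal distances to the opposite ends, so this product has the
    -- `x`-degree of the power of `g l`, and by `hc` a smaller `y`-degree.
    have he : (q + 1) • g i + (p + 1) • g j ∈ mons (I ^ ((q + 1) + (p + 1))) := by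
      rw [pow_add, mem_mons_mul (hmon.pow _) (hmon.pow _)]
      refine ⟨_, (mem_mons_pow hmon).2 ⟨Multiset.replicate (q + 1) (g i), by simp, ?_, le_rfl⟩,
        _, (mem_mons_pow hmon).2 ⟨Multiset.replicate (p + 1) (g j), by simp, ?_, le_rfl⟩, ?_⟩
      · intro a ha
        rw [Multiset.eq_of_mem_replicate ha]
        exact (hmem i hi (by omega)).1.1
      · intro a ha
        rw [Multiset.eq_of_mem_replicate ha]
        exact (hmem j (by omega) hj).1.1
      · rw [Multiset.sum_replicate, Multiset.sum_replicate]
    have r1 : g l 0 - g i 0 = p + 1 := by omega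
    have r2 : g j 0 - g l 0 = q + 1 := by omega
    have r3 : g i 1 - g l 1 = p' + 1 := by omega
    have r4 : g l 1 - g j 1 = q' + 1 := by omega
    rw [r1, r2, r3, r4] at hc
    have hle : (q + 1) • g i + (p + 1) • g j ≤ ((q + 1) + (p + 1)) • g l := by
      rw [mon_le_iff]
      simp only [Finsupp.add_apply, Finsupp.smul_apply, smul_eq_mul]
      rw [hp', hq', hq, hp]
      constructor <;> linarith
    have := (mon_le_iff.1 (hw.2 he hle)).2
    simp only [Finsupp.add_apply, Finsupp.smul_apply, smul_eq_mul] at this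
    rw [hp', hq'] at this
    linarith
  refine ⟨hmon, hk, fun i h1 h2 => (hmem i h1 h2).1, hx, hy, hx1, hyk, hconv, ?_⟩
  intro i hi hik m hm
  have x1 := hx i (i + 1) hi (by omega) (by omega)
  have y1 := hy i (i + 1) hi (by omega) (by omega)
  obtain ⟨f, hf, hmin⟩ := exists_persistent_wdeg_min (A := g i 1 - g (i + 1) 1)
    (B := g (i + 1) 0 - g i 0) (by omega) (by omega) hne
  refine le_trans ?_ (hmin m hm)
  obtain ⟨l, ⟨hl1, hl2⟩, rfl⟩ := hex f hf
  obtain ⟨p, hp⟩ := Nat.exists_eq_add_of_lt x1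
  obtain ⟨p', hp'⟩ := Nat.exists_eq_add_of_lt y1
  rw [wdeg_apply, wdeg_apply]
  have r1 : g (i + 1) 0 - g i 0 = p + 1 := by omega
  have r3 : g i 1 - g (i + 1) 1 = p' + 1 := by omega
  rw [r1, r3]
  rcases lt_trichotomy l i with hl | rfl | hl
  · have x2 := hx l i hl1 hl (by omega)
    have y2 := hy l i hl1 hl (by omega)
    obtain ⟨q, hq⟩ := Nat.exists_eq_add_of_lt x2
    obtain ⟨q', hq'⟩ := Nat.exists_eq_add_of_lt y2
    have := hconv l i (i + 1) hl1 hl (by omega) (by omega)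
    have r2 : g i 0 - g l 0 = q + 1 := by omega
    have r4 : g l 1 - g i 1 = q' + 1 := by omega
    rw [r1, r2, r3, r4] at this
    rw [hq', hq]
    linarith
  · rfl
  · rcases Nat.lt_or_ge (i + 1) l with hl' | hl'
    · have x2 := hx (i + 1) l (by omega) hl' (by omega)
      have y2 := hy (i + 1) l (by omega) hl' (by omega)
      obtain ⟨q, hq⟩ := Nat.exists_eq_add_of_lt x2
      obtain ⟨q', hq'⟩ := Nat.exists_eq_add_of_lt y2
      have := hconv i (i + 1) l hi (by omega) (by omega) (by omega)
      have r2 : g l 0 - g (i + 1) 0 = q + 1 := by omega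
      have r4 : g (i + 1) 1 - g l 1 = q' + 1 := by omega
      rw [r1, r2, r3, r4] at this
      rw [hq, hp, hp', hq']
      linarith
    · obtain rfl : l = i + 1 := by omega
      rw [hp, hp']
      linarith

end anchored

/-! ### Factorizations in powers of `I` -/

namespace HasProf
variable {I : Ideal (MvPolynomial (Fin 2) K)} {φ : ℕ → ℕ}

theorem finite_mingens (h : HasProf I φ) {d : ℕ} (hd : φ d = 0) : (mingens I).Finite := by
  refine ((Set.finite_Iic d).image (fun y => xy (φ y) y)).subset fun m hm => ?_
  obtain ⟨h1, h2⟩ := h.mem_mingens.1 hm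
  refine ⟨m 1, ?_, by simp [← h1]⟩
  rw [Set.mem_Iic]
  by_contra! hc
  have := h2 d hc
  omega

end HasProf

/-- A monomial of a power of `I` is divisible by a product of generators that cannot be replaced
by another product with smaller weight. -/
theorem exists_irreducible_factorization {I : Ideal (MvPolynomial (Fin 2) K)}
    (hI : IsMonomialIdeal I) {n : ℕ} {m : Mon} (hm : m ∈ mons (I ^ n)) (wt : Mon → ℕ) :
    ∃ s : Multiset Mon, s.card = n ∧ (∀ a ∈ s, a ∈ mingens I) ∧ s.sum ≤ m ∧
      ∀ t ≤ s, ∀ t' : Multiset Mon, t'.card = t.card → (∀ a ∈ t', a ∈ mingens I) →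
        t'.sum ≤ t.sum → (t.map wt).sum ≤ (t'.map wt).sum := by
  have hex : ∃ s : Multiset Mon, s.card = n ∧ (∀ a ∈ s, a ∈ mingens I) ∧ s.sum ≤ m := by
    obtain ⟨s, hs, hs', hsum⟩ := (mem_mons_pow hI).1 hm
    have : ∀ s : Multiset Mon, (∀ a ∈ s, a ∈ mons I) →
        ∃ s' : Multiset Mon, s'.card = s.card ∧ (∀ a ∈ s', a ∈ mingens I) ∧ s'.sum ≤ s.sum := by
      intro s
      induction s using Multiset.induction_on with
      | empty => exact fun _ => ⟨0, by simp⟩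
      | cons a s ih =>
        intro h
        obtain ⟨s', h1, h2, h3⟩ := ih fun b hb => h b (Multiset.mem_cons_of_mem hb)
        obtain ⟨f, hf, hfa⟩ := exists_minimal_le (h a (Multiset.mem_cons_self a s))
        refine ⟨f ::ₘ s', by simp [h1], ?_, by simpa using add_le_add hfa h3⟩
        intro b hb
        rcases Multiset.mem_cons.1 hb with rfl | hb
        exacts [hf, h2 b hb]
    obtain ⟨s', h1, h2, h3⟩ := this s hs'
    exact ⟨s', h1.trans hs, h2, h3.trans hsum⟩
  obtain ⟨s, ⟨h1, h2, h3⟩, hmin⟩ := exists_minimalFor_of_wellFoundedLT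
    (fun s : Multiset Mon => s.card = n ∧ (∀ a ∈ s, a ∈ mingens I) ∧ s.sum ≤ m)
    (fun s => (s.map wt).sum) hex
  refine ⟨s, h1, h2, h3, fun t hts t' hcard hmem hsum => ?_⟩
  obtain ⟨r, rfl⟩ := Multiset.le_iff_exists_add.1 hts
  by_contra! hc
  have hlt : ((t' + r).map wt).sum < ((t + r).map wt).sum := by
    simpa using hc
  refine absurd (hmin (j := t' + r) ⟨?_, ?_, ?_⟩ hlt.le) (not_le.2 hlt)
  · rw [← h1, Multiset.card_add, Multiset.card_add, hcard]
  · intro a ha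
    rcases Multiset.mem_add.1 ha with ha | ha
    · exact hmem a ha
    · exact h2 a (Multiset.mem_add.2 (Or.inr ha))
  · refine le_trans ?_ h3
    rw [Multiset.sum_add, Multiset.sum_add]
    exact add_le_add hsum le_rfl

theorem replicate_add_replicate_le {α : Type*} [DecidableEq α] {s : Multiset α} {f g : α}
    (hfg : f ≠ g) {p q : ℕ} (hp : p ≤ s.count f) (hq : q ≤ s.count g) :
    Multiset.replicate p f + Multiset.replicate q g ≤ s := by
  rw [Multiset.le_iff_count]
  intro a
  rw [Multiset.count_add, Multiset.count_replicate, Multiset.count_replicate]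
  by_cases h1 : f = a
  · subst h1
    simp [hfg.symm, hp]
  · by_cases h2 : g = a
    · subst h2
      simp [hfg, hq]
    · simp [h1, h2]

/-- Strict convexity of the square; it makes trading two outer chain members for an inner one lower
the weight. -/
theorem sq_interp_lt {A p q : ℕ} (hp : 0 < p) (hq : 0 < q) :
    (q + p) * (A + p) ^ 2 < q * A ^ 2 + p * (A + p + q) ^ 2 := by
  have : q * A ^ 2 + p * (A + p + q) ^ 2 = (q + p) * (A + p) ^ 2 + p * q * (p + q) := by ring
  have : 0 < p * q * (p + q) := by positivity
  omega

namespace GenChain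
variable {I : Ideal (MvPolynomial (Fin 2) K)} {g : ℕ → Mon} {k : ℕ}

theorem exists_between (h : GenChain I g k) {f : Mon} (hf : f ∈ mingens I)
    (hne : ∀ i, 1 ≤ i → i ≤ k + 1 → f ≠ g i) :
    ∃ i, 1 ≤ i ∧ i ≤ k ∧ g i 0 < f 0 ∧ f 0 < g (i + 1) 0 ∧ g (i + 1) 1 < f 1 ∧ f 1 < g i 1 := by
  have hanti : ∀ e ∈ mingens I, e ≠ f → (e 0 < f 0 ∧ f 1 < e 1) ∨ (f 0 < e 0 ∧ e 1 < f 1) := by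
    intro e he hef
    have h1 : ¬ e ≤ f := fun hc => hef (le_antisymm hc (hf.2 he.1 hc))
    have h2 : ¬ f ≤ e := fun hc => hef (le_antisymm (he.2 hf.1 hc) hc)
    rw [mon_le_iff] at h1 h2
    omega
  have hex : ∃ i, i ≤ k ∧ f 0 < g (i + 1) 0 := by
    refine ⟨k, le_rfl, ?_⟩
    have := hanti _ (h.mem (k + 1) (by omega) le_rfl) (hne _ (by omega) le_rfl).symm
    have := h.y_last
    omega
  classical
  obtain ⟨h1, h2⟩ := Nat.find_spec hex
  have h3 := fun i => Nat.find_min hex (m := i)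
  set i := Nat.find hex
  have hi : 1 ≤ i := by
    by_contra! hc
    obtain hc : i = 0 := by omega
    rw [hc] at h2
    have := h.x_one
    simp only [zero_add] at h2
    omega
  have e1 := hanti _ (h.mem i hi (by omega)) (hne _ hi (by omega)).symm
  have e2 := hanti _ (h.mem (i + 1) (by omega) (by omega)) (hne _ (by omega) (by omega)).symm
  have e3 := h3 (i - 1) (by omega)
  rw [show i - 1 + 1 = i by omega] at e3
  exact ⟨i, hi, h1, by omega, h2, by omega, by omega⟩

theorem ne (h : GenChain I g k) {i j : ℕ} (hi : 1 ≤ i) (hij : i < j) (hj : j ≤ k + 1) :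
    g i ≠ g j := fun hc => by
  have := h.x_lt i j hi hij hj
  rw [hc] at this
  exact lt_irrefl _ this

/-- A power of a generator outside of the chain is divisible by a product of neighbours in the
chain. -/
theorem replace_between (h : GenChain I g k) {f : Mon} (hf : f ∈ mingens I) {i : ℕ} (hi : 1 ≤ i)
    (hik : i ≤ k) (hx1 : g i 0 < f 0) (hx2 : f 0 < g (i + 1) 0) (hy1 : g (i + 1) 1 < f 1)
    (hy2 : f 1 < g i 1) : ∃ p q, p + q = min (g (i + 1) 0 - g i 0) (g i 1 - g (i + 1) 1) ∧
      p • g i + q • g (i + 1) ≤ (p + q) • f := by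
  have hab := h.above i hi hik f hf.1
  rw [wdeg_apply, wdeg_apply] at hab
  obtain ⟨p, hp⟩ := Nat.exists_eq_add_of_lt hx1
  obtain ⟨q, hq⟩ := Nat.exists_eq_add_of_lt hx2
  obtain ⟨p', hp'⟩ := Nat.exists_eq_add_of_lt hy2
  obtain ⟨q', hq'⟩ := Nat.exists_eq_add_of_lt hy1
  have r1 : g (i + 1) 0 - g i 0 = (q + 1) + (p + 1) := by omega
  have r3 : g i 1 - g (i + 1) 1 = (q' + 1) + (p' + 1) := by omega
  rw [r1, r3] at hab ⊢
  -- The exponents can be chosen to match `f` exactly in `x`-degree or exactly in `y`-degree, the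
  -- other degree being controlled by `hab`. The number of factors is the distance in the matched
  -- variable, so the smaller one is taken.
  rcases le_total ((q + 1) + (p + 1)) ((q' + 1) + (p' + 1)) with hle | hle
  · refine ⟨q + 1, p + 1, by omega, ?_⟩
    rw [mon_le_iff]
    simp only [Finsupp.add_apply, Finsupp.smul_apply, smul_eq_mul]
    rw [hp', hq', hp] at hab
    rw [hp', hq', hq, hp]
    constructor <;> linarith
  · refine ⟨q' + 1, p' + 1, by omega, ?_⟩
    rw [mon_le_iff]
    simp only [Finsupp.add_apply, Finsupp.smul_apply, smul_eq_mul]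
    rw [hp', hq', hp] at hab
    rw [hp', hq', hq, hp]
    constructor <;> linarith

/-- A product of two non-adjacent members of the chain is divisible by a power of a member in
between, of smaller weight. -/
theorem replace_outer (h : GenChain I g k) (c : Fin 2) {i l j : ℕ} (hi : 1 ≤ i) (hil : i < l)
    (hlj : l < j) (hj : j ≤ k + 1) : ∃ p q, p + 1 ≤ max (g i c) (g j c) ∧
      q + 1 ≤ max (g i c) (g j c) ∧ (p + q) • g l ≤ p • g i + q • g j ∧
      (p + q) * g l c ^ 2 < p * g i c ^ 2 + q * g j c ^ 2 := by
  have x1 := h.x_lt i l hi hil (by omega)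
  have x2 := h.x_lt l j (by omega) hlj hj
  have y1 := h.y_lt i l hi hil (by omega)
  have y2 := h.y_lt l j (by omega) hlj hj
  have hc := h.conv i l j hi hil hlj hj
  obtain ⟨p, hp⟩ := Nat.exists_eq_add_of_lt x1
  obtain ⟨q, hq⟩ := Nat.exists_eq_add_of_lt x2
  obtain ⟨p', hp'⟩ := Nat.exists_eq_add_of_lt y1
  obtain ⟨q', hq'⟩ := Nat.exists_eq_add_of_lt y2
  have r1 : g l 0 - g i 0 = p + 1 := by omega
  have r2 : g j 0 - g l 0 = q + 1 := by omega
  have r3 : g i 1 - g l 1 = p' + 1 := by omega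
  have r4 : g l 1 - g j 1 = q' + 1 := by omega
  rw [r1, r2, r3, r4] at hc
  -- The degree in variable `c` is matched exactly: the exponents are then differences of
  -- `c`-degrees, and `sq_interp_lt` applies to them.
  obtain rfl | rfl : c = 0 ∨ c = 1 := by omega
  · refine ⟨q + 1, p + 1, ?_, ?_, ?_, ?_⟩
    · exact le_max_of_le_right (by omega)
    · exact le_max_of_le_right (by omega)
    · rw [mon_le_iff]
      simp only [Finsupp.add_apply, Finsupp.smul_apply, smul_eq_mul]
      rw [hp', hq', hq, hp]
      constructor <;> linarith
    · have := sq_interp_lt (A := g i 0) (Nat.succ_pos p) (Nat.succ_pos q)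
      rw [hq, hp]
      exact this
  · refine ⟨q' + 1, p' + 1, ?_, ?_, ?_, ?_⟩
    · exact le_max_of_le_left (by omega)
    · exact le_max_of_le_left (by omega)
    · rw [mon_le_iff]
      simp only [Finsupp.add_apply, Finsupp.smul_apply, smul_eq_mul]
      rw [hp', hq', hq, hp]
      constructor <;> linarith
    · have := sq_interp_lt (A := g j 1) (Nat.succ_pos q') (Nat.succ_pos p')
      rw [hp', hq']
      simp only [Nat.succ_eq_add_one] at this
      rw [show q' + 1 + (p' + 1) = p' + 1 + (q' + 1) by omega]
      refine this.trans_eq ?_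
      rw [add_comm]
      rfl

open Classical in
/-- High powers of `I` are covered by the ideals `(g_i, g_{i+1})^M I^D`. -/
theorem exists_adjacent_factor (h : GenChain I g k) {P : Finset Mon}
    (hP : ∀ f, f ∈ P ↔ ∃ i, 1 ≤ i ∧ i ≤ k + 1 ∧ g i = f) (hfin : (mingens I).Finite) {δ e D : ℕ}
    (hδ : ∀ i, 1 ≤ i → i ≤ k → min (g (i + 1) 0 - g i 0) (g i 1 - g (i + 1) 1) ≤ δ + 1)
    (he : 1 < k → ∃ c : Fin 2, ∀ i, 1 ≤ i → i ≤ k + 1 → g i c ≤ e + 2)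
    (hD : (mu I - P.card) * δ + P.card * e ≤ D) {M : ℕ} {m : Mon} (hm : m ∈ mons (I ^ (M + D))) :
    ∃ i, 1 ≤ i ∧ i ≤ k ∧ ∃ p q, p + q = M ∧ ∃ w ∈ mons (I ^ D),
      p • g i + q • g (i + 1) + w ≤ m := by
  obtain ⟨c, hc⟩ : ∃ c : Fin 2, 1 < k → ∀ i, 1 ≤ i → i ≤ k + 1 → g i c ≤ e + 2 := by
    by_cases hk : 1 < k
    · obtain ⟨c, hc⟩ := he hk
      exact ⟨c, fun _ => hc⟩
    · exact ⟨0, fun hc => absurd hc hk⟩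
  have hgP : ∀ i, 1 ≤ i → i ≤ k + 1 → g i ∈ P := fun i h1 h2 => (hP _).2 ⟨i, h1, h2, rfl⟩
  -- A generator outside `P` weighs more than any member of `P`, so trading it for members pays off;
  -- among members, squared `c`-degrees favour inner ones.
  obtain ⟨s, hs, hsG, hsum, hirr⟩ := exists_irreducible_factorization h.isMon hm
    (fun f => if f ∈ P then f c ^ 2 else 1 + ∑ f' ∈ P, f' c ^ 2)
  have hwt : ∀ i, 1 ≤ i → i ≤ k + 1 →
      (if g i ∈ P then g i c ^ 2 else 1 + ∑ f' ∈ P, f' c ^ 2) = g i c ^ 2 :=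
    fun i h1 h2 => if_pos (hgP i h1 h2)
  have hwle : ∀ i, 1 ≤ i → i ≤ k + 1 → g i c ^ 2 ≤ ∑ f' ∈ P, f' c ^ 2 := fun i h1 h2 =>
    Finset.single_le_sum (f := fun f' : Mon => f' c ^ 2) (fun _ _ => Nat.zero_le _) (hgP i h1 h2)
  have hout : ∀ f ∈ mingens I, f ∉ P → s.count f ≤ δ := by
    intro f hf hfP
    by_contra! hcount
    obtain ⟨i, hi, hik, hx1, hx2, hy1, hy2⟩ := h.exists_between hf
      (fun i h1 h2 hc => hfP (hc ▸ hgP i h1 h2))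
    obtain ⟨p, q, hpq, hle⟩ := h.replace_between hf hi hik hx1 hx2 hy1 hy2
    have hpos : 0 < p + q := by rw [hpq]; omega
    have hd := hδ i hi hik
    have := hirr (Multiset.replicate (p + q) f)
      (Multiset.le_count_iff_replicate_le.1 (by omega))
      (Multiset.replicate p (g i) + Multiset.replicate q (g (i + 1))) (by simp) (by
        intro a ha
        rcases Multiset.mem_add.1 ha with ha | ha
        · rw [Multiset.eq_of_mem_replicate ha]
          exact h.mem i hi (by omega)
        · rw [Multiset.eq_of_mem_replicate ha]
          exact h.mem (i + 1) (by omega) (by omega))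
      (by simpa only [Multiset.sum_add, Multiset.sum_replicate] using hle)
    simp only [Multiset.map_add, Multiset.map_replicate, Multiset.sum_add,
      Multiset.sum_replicate, if_neg hfP, hwt i hi (by omega), hwt (i + 1) (by omega) (by omega),
      smul_eq_mul] at this
    have e1 := Nat.mul_le_mul_left p (hwle i hi (by omega))
    have e2 := Nat.mul_le_mul_left q (hwle (i + 1) (by omega) (by omega))
    have e3 : (p + q) * (1 + ∑ f' ∈ P, f' c ^ 2) =
      p + q + (p * ∑ f' ∈ P, f' c ^ 2 + q * ∑ f' ∈ P, f' c ^ 2) := by ring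
    omega
  -- Two non-adjacent members occurring more than `e` times each could be traded for powers of `g (i
  -- + 1)`.
  have hfar : ∀ i j, 1 ≤ i → i + 1 < j → j ≤ k + 1 →
      s.count (g i) ≤ e ∨ s.count (g j) ≤ e := by
    intro i j hi hij hj
    by_contra! hcount
    obtain ⟨p, q, hp, hq, hle, hlt⟩ := h.replace_outer c hi (Nat.lt_add_one i) hij hj
    have hmax : max (g i c) (g j c) ≤ e + 2 :=
      max_le (hc (by omega) i hi (by omega)) (hc (by omega) j (by omega) hj)
    have := hirr (Multiset.replicate p (g i) + Multiset.replicate q (g j))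
      (replicate_add_replicate_le (h.ne hi (by omega) hj) (by omega) (by omega))
      (Multiset.replicate (p + q) (g (i + 1))) (by simp) (by
        intro a ha
        rw [Multiset.eq_of_mem_replicate ha]
        exact h.mem (i + 1) (by omega) (by omega))
      (by simpa only [Multiset.sum_add, Multiset.sum_replicate] using hle)
    simp only [Multiset.map_add, Multiset.map_replicate, Multiset.sum_add,
      Multiset.sum_replicate, hwt i hi (by omega), hwt (i + 1) (by omega) (by omega),
      hwt j (by omega) hj, smul_eq_mul] at this
    omega
  -- Take the first of `g_1, …, g_k` with more than `e` occurrences; by `hfar` only its right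
  -- neighbour can also be frequent.
  obtain ⟨i, hi, hik, hrest⟩ : ∃ i, 1 ≤ i ∧ i ≤ k ∧
      ∀ l, 1 ≤ l → l ≤ k + 1 → l ≠ i → l ≠ i + 1 → s.count (g l) ≤ e := by
    by_cases hex : ∃ l, (1 ≤ l ∧ l ≤ k) ∧ e < s.count (g l)
    · obtain ⟨⟨h1, h2⟩, h3⟩ := Nat.find_spec hex
      have h4 := fun l => Nat.find_min hex (m := l)
      set i := Nat.find hex
      refine ⟨i, h1, h2, fun l hl1 hl2 hl3 hl4 => ?_⟩
      rcases Nat.lt_or_ge l i with hl | hl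
      · by_contra! hc
        exact h4 l hl ⟨⟨hl1, by omega⟩, hc⟩
      · have := hfar i l h1 (by omega) hl2
        omega
    · refine ⟨k, h.one_le, le_rfl, fun l hl1 hl2 hl3 hl4 => ?_⟩
      by_contra! hc
      exact hex ⟨l, ⟨hl1, by omega⟩, hc⟩
  have hsub : P ⊆ hfin.toFinset := fun f hf => by
    obtain ⟨l, h1, h2, rfl⟩ := (hP f).1 hf
    exact hfin.mem_toFinset.2 (h.mem l h1 h2)
  have hmu : mu I = hfin.toFinset.card := Set.ncard_eq_toFinset_card _ hfin
  have hne := h.ne hi (Nat.lt_add_one i) (by omega)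
  have htotal : M + D ≤ s.count (g i) + s.count (g (i + 1)) + D := by
    have e1 : ∑ f ∈ hfin.toFinset, s.count f = M + D := by
      rw [← hs]
      exact Multiset.sum_count_eq_card fun a ha => hfin.mem_toFinset.2 (hsG a ha)
    rw [← Finset.sum_sdiff hsub] at e1
    have e2 : ∑ f ∈ hfin.toFinset \ P, s.count f ≤ (mu I - P.card) * δ := by
      rw [hmu, ← Finset.card_sdiff_of_subset hsub, ← smul_eq_mul]
      refine Finset.sum_le_card_nsmul _ _ _ fun f hf => ?_
      rw [Finset.mem_sdiff, hfin.mem_toFinset] at hf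
      exact hout f hf.1 hf.2
    have hsub' : {g i, g (i + 1)} ⊆ P := by
      intro f hf
      rw [Finset.mem_insert, Finset.mem_singleton] at hf
      rcases hf with rfl | rfl
      exacts [hgP i hi (by omega), hgP (i + 1) (by omega) (by omega)]
    rw [← Finset.sum_sdiff hsub', Finset.sum_pair hne] at e1
    have e3 : ∑ f ∈ P \ {g i, g (i + 1)}, s.count f ≤ P.card * e := by
      refine le_trans (Finset.sum_le_card_nsmul _ _ e fun f hf => ?_) ?_
      · rw [Finset.mem_sdiff, Finset.mem_insert, Finset.mem_singleton] at hf
        obtain ⟨l, h1, h2, rfl⟩ := (hP f).1 hf.1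
        refine hrest l h1 h2 ?_ ?_
        · rintro rfl
          exact hf.2 (Or.inl rfl)
        · rintro rfl
          exact hf.2 (Or.inr rfl)
      · rw [smul_eq_mul]
        exact Nat.mul_le_mul_right _ (Finset.card_le_card Finset.sdiff_subset)
    omega
  -- The pair accounts for at least `M` factors; exactly `M` are split off and any surplus goes into
  -- `w`.
  refine ⟨i, hi, hik, min (s.count (g i)) M, M - min (s.count (g i)) M, by omega, ?_⟩
  obtain ⟨r, hr⟩ := Multiset.le_iff_exists_add.1 (replicate_add_replicate_le hne
    (min_le_left (s.count (g i)) M)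
    (show M - min (s.count (g i)) M ≤ s.count (g (i + 1)) by omega))
  have hrc : r.card = D := by
    have := congrArg Multiset.card hr
    rw [hs] at this
    simp only [Multiset.card_add, Multiset.card_replicate] at this
    omega
  refine ⟨r.sum, hrc ▸ sum_mem_mons_pow h.isMon fun a ha => ?_, ?_⟩
  · refine (hsG a ?_).1
    rw [hr]
    exact Multiset.mem_add.2 (Or.inr ha)
  · rw [hr] at hsum
    simpa only [Multiset.sum_add, Multiset.sum_replicate] using hsum

end GenChain

/-! ### Ideals generated by two monomials -/

theorem mem_mons_genBy_pair {e f m : Mon} : m ∈ mons (genBy K {e, f}) ↔ e ≤ m ∨ f ≤ m := by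
  simp [mem_mons_genBy]

theorem mem_mons_genBy_pair_pow {e f m : Mon} {n : ℕ} :
    m ∈ mons (genBy K {e, f} ^ n) ↔ ∃ p q, p + q = n ∧ q • e + p • f ≤ m := by
  induction n generalizing m with
  | zero =>
    rw [pow_zero]
    exact iff_of_true (mem_mons_one m) ⟨0, 0, by simp⟩
  | succ n ih =>
    rw [pow_succ, mem_mons_mul ((genBy_isMonomialIdeal _).pow n) (genBy_isMonomialIdeal _)]
    simp only [ih, mem_mons_genBy_pair]
    constructor
    · rintro ⟨a, ⟨p, q, hpq, ha⟩, b, hb, h⟩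
      rcases hb with hb | hb
      · refine ⟨p, q + 1, by omega, le_trans ?_ ((add_le_add ha hb).trans h)⟩
        rw [succ_nsmul]
        exact le_of_eq (by abel)
      · refine ⟨p + 1, q, by omega, le_trans ?_ ((add_le_add ha hb).trans h)⟩
        rw [succ_nsmul]
        exact le_of_eq (by abel)
    · rintro ⟨p, q, hpq, h⟩
      rcases Nat.eq_zero_or_pos p with rfl | hp
      · obtain ⟨q, rfl⟩ := Nat.exists_eq_add_of_le' (show 1 ≤ q by omega)
        refine ⟨_, ⟨0, q, by omega, le_rfl⟩, e, Or.inl le_rfl, le_trans (le_of_eq ?_) h⟩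
        rw [succ_nsmul]
        abel
      · obtain ⟨p, rfl⟩ := Nat.exists_eq_add_of_le' hp
        refine ⟨_, ⟨p, q, by omega, le_rfl⟩, f, Or.inr le_rfl, le_trans (le_of_eq ?_) h⟩
        rw [succ_nsmul]
        abel

theorem hasProf_colonMon_genBy {E : Set Mon} {m : Mon} {ψ : ℕ → ℕ}
    (h : ∀ f : Mon, (∃ e ∈ E, e ≤ f + m) ↔ ψ (f 1) ≤ f 0) :
    HasProf (colonMon (genBy K E) m) ψ :=
  ⟨(genBy_isMonomialIdeal E).colonMon m, fun f => by
    rw [mem_mons_colonMon, mem_mons_genBy, h]⟩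

section pdist
variable {g h : Mon}

theorem gcdMon_pair (hx : g 0 < h 0) (hy : h 1 < g 1) :
    gcdMon (genBy K {g, h}) = xy (g 0) (h 1) := by
  rw [gcdMon]
  congr 1
  · refine IsLeast.csInf_eq ⟨⟨g, mem_mons_genBy_pair.2 (Or.inl le_rfl), rfl⟩, ?_⟩
    rintro _ ⟨m, hm, rfl⟩
    rcases mem_mons_genBy_pair.1 hm with hm | hm
    · exact (mon_le_iff.1 hm).1
    · exact hx.le.trans (mon_le_iff.1 hm).1
  · refine IsLeast.csInf_eq ⟨⟨h, mem_mons_genBy_pair.2 (Or.inr le_rfl), rfl⟩, ?_⟩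
    rintro _ ⟨m, hm, rfl⟩
    rcases mem_mons_genBy_pair.1 hm with hm | hm
    · exact hy.le.trans (mon_le_iff.1 hm).2
    · exact (mon_le_iff.1 hm).2

theorem hasProf_red_pair (hx : g 0 < h 0) (hy : h 1 < g 1) :
    HasProf (red (genBy K {g, h})) (fun y => if y < g 1 - h 1 then h 0 - g 0 else 0) := by
  rw [red, gcdMon_pair hx hy]
  refine hasProf_colonMon_genBy fun f => ?_
  simp only [Set.mem_insert_iff, Set.mem_singleton_iff, exists_eq_or_imp, exists_eq_left,
    mon_le_iff, Finsupp.add_apply, xy_apply_zero, xy_apply_one]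
  split_ifs <;> omega

theorem idist_pair (c : Fin 2) (hx : g 0 < h 0) (hy : h 1 < g 1) :
    pdist K c g h = idist c (red (genBy K {g, h})) := by
  rw [pdist, idist, idist, (hasProf_red_pair hx hy).red_eq (d := g 1 - h 1) (by simp)]

theorem pdist_zero (hx : g 0 < h 0) (hy : h 1 < g 1) : pdist K 0 g h = h 0 - g 0 := by
  rw [idist_pair 0 hx hy, (hasProf_red_pair hx hy).idist_zero (d := g 1 - h 1) (by simp),
    if_pos (by omega)]

theorem pdist_one (hx : g 0 < h 0) (hy : h 1 < g 1) : pdist K 1 g h = g 1 - h 1 := by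
  rw [idist_pair 1 hx hy, (hasProf_red_pair hx hy).idist_one (d := g 1 - h 1) (by simp)]
  intro y hy'
  rw [if_pos hy']
  omega

end pdist

/-! ### Segments -/

/-- The last drop up to row `y` carries the generator responsible for the value at `y`; starting
from a drop `β` keeps it above `β`. -/
theorem exists_drop_le {τ : ℕ → ℕ} (hτ : Antitone τ) {β y : ℕ} (hβ : Drop τ β) (hy : β ≤ y) :
    ∃ z, β ≤ z ∧ z ≤ y ∧ Drop τ z ∧ τ z = τ y := by
  induction y, hy using Nat.le_induction with
  | base => exact ⟨β, le_rfl, le_rfl, hβ, rfl⟩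
  | succ y hy ih =>
    by_cases hd : Drop τ (y + 1)
    · exact ⟨y + 1, by omega, le_rfl, hd, rfl⟩
    · obtain ⟨z, h1, h2, h3, h4⟩ := ih
      refine ⟨z, h1, by omega, h3, h4.trans ?_⟩
      simpa using ((not_drop_iff hτ).1 hd).2

section segments
variable {u v n : ℕ} {J : Ideal (MvPolynomial (Fin 2) K)} {j τ : ℕ → ℕ}

theorem mem_mons_stair (hJ : HasProf J j) {x y : ℕ} :
    xy x y ∈ mons (stair u v J n) ↔
      ∃ p q t, p + q = n + 1 ∧ p * v + t ≤ y ∧ q * u + j t ≤ x := by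
  rw [stair, mem_mons_mul ((genBy_isMonomialIdeal _).pow _) hJ.isMon]
  simp only [mem_mons_genBy_pair_pow]
  constructor
  · rintro ⟨a, ⟨p, q, hpq, ha⟩, w, hw, h⟩
    have h := (add_le_add ha le_rfl).trans h
    rw [hJ.mem] at hw
    simp only [mon_le_iff, Finsupp.add_apply, Finsupp.smul_apply, smul_eq_mul, xy_apply_zero,
      xy_apply_one, mul_zero, add_zero, zero_add] at h
    exact ⟨p, q, w 1, hpq, h.2, by omega⟩
  · rintro ⟨p, q, t, hpq, h1, h2⟩
    refine ⟨_, ⟨p, q, hpq, le_rfl⟩, xy (j t) t, hJ.mem_xy.2 le_rfl, ?_⟩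
    simp only [mon_le_iff, Finsupp.add_apply, Finsupp.smul_apply, smul_eq_mul, xy_apply_zero,
      xy_apply_one, mul_zero, add_zero, zero_add]
    exact ⟨h2, h1⟩

theorem exists_hasProf_stair (hJ : HasProf J j) :
    ∃ τ, HasProf (stair u v J n) τ := by
  refine ⟨_, HasProf.of_mem (((genBy_isMonomialIdeal _).pow _).mul hJ.isMon)
    (a := (n + 1) * u + j 0) ?_⟩
  exact (mem_mons_stair hJ).2 ⟨0, n + 1, 0, by omega, by omega, le_rfl⟩

theorem stair_prof_le_iff (hJ : HasProf J j) (hτ : HasProf (stair u v J n) τ) {x y : ℕ} :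
    τ y ≤ x ↔ ∃ p q t, p + q = n + 1 ∧ p * v + t ≤ y ∧ q * u + j t ≤ x := by
  rw [← mem_mons_stair hJ, hτ.mem_xy]

variable {β : ℕ} (hτ : HasProf (stair u v J n) τ) (hβ : FirstDrop τ (n * v) β)
include hτ hβ

theorem segBeta_eq : segBeta u v J n = β := by
  refine IsLeast.csInf_eq ⟨⟨xy (τ β) β, ⟨hτ.mem_mingens.2 ?_, ?_⟩, by simp⟩, ?_⟩
  · simpa using hβ.drop
  · simpa using hβ.le
  · rintro _ ⟨f, ⟨hf, hf'⟩, rfl⟩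
    exact hβ.min _ hf' (hτ.mem_mingens.1 hf).2

theorem segAlpha_eq : segAlpha u v J n = τ β := by
  rw [segAlpha, segBeta_eq hτ hβ]
  refine IsLeast.csInf_eq ⟨⟨xy (τ β) β, ⟨⟨hτ.mem_mingens.2 ?_, ?_⟩, by simp⟩, by simp⟩, ?_⟩
  · simpa using hβ.drop
  · simpa using hβ.le
  · rintro _ ⟨f, ⟨⟨hf, hf'⟩, hf''⟩, rfl⟩
    have := (hτ.mem_mingens.1 hf).1
    rw [hf''] at this
    exact this.ge

theorem hasProf_segA : HasProf (segA u v J n) (fun y => τ (y + β)) := by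
  rw [segA, segBeta_eq hτ hβ]
  refine hasProf_colonMon_genBy fun f => ?_
  constructor
  · rintro ⟨e, ⟨he, -⟩, hef⟩
    have h1 := (hτ.mem_mingens.1 he).1
    simp only [mon_le_iff, Finsupp.add_apply, xy_apply_zero, xy_apply_one, add_zero] at hef
    have := hτ.antitone hef.2
    omega
  · intro h
    obtain ⟨z, h1, h2, h3, h4⟩ := exists_drop_le hτ.antitone hβ.drop
      (show β ≤ f 1 + β by omega)
    refine ⟨xy (τ z) z, ⟨hτ.mem_mingens.2 (by simpa), by simpa using hβ.le.trans h1⟩, ?_⟩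
    simp only [mon_le_iff, Finsupp.add_apply, xy_apply_zero, xy_apply_one, add_zero]
    omega

/-- From row `β` on the truncated difference vanishes, in accordance with the added generator `x^α
y^β`. -/
theorem hasProf_segB : HasProf (segB u v J n) (fun y => τ y - τ β) := by
  rw [segB, segBeta_eq hτ hβ, segAlpha_eq hτ hβ]
  refine hasProf_colonMon_genBy fun f => ?_
  constructor
  · rintro ⟨e, ⟨he, -⟩ | rfl, hef⟩
    · have h1 := (hτ.mem_mingens.1 he).1
      simp only [mon_le_iff, Finsupp.add_apply, xy_apply_zero, xy_apply_one, add_zero] at hef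
      have := hτ.antitone hef.2
      omega
    · simp only [mon_le_iff, Finsupp.add_apply, xy_apply_zero, xy_apply_one, add_zero] at hef
      have := hτ.antitone hef.2
      omega
  · intro h
    by_cases hf : β ≤ f 1
    · refine ⟨_, Or.inr rfl, ?_⟩
      simp only [mon_le_iff, Finsupp.add_apply, xy_apply_zero, xy_apply_one, add_zero]
      omega
    · obtain ⟨z, h1, h2, h3, h4⟩ := exists_drop_le hτ.antitone (β := 0) (y := f 1)
        (fun z hz => absurd hz (Nat.not_lt_zero z)) (by omega)
      refine ⟨xy (τ z) z, Or.inl ⟨hτ.mem_mingens.2 (by simpa), ?_⟩, ?_⟩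
      · rw [xy_apply_one]
        by_contra! hc
        have := hβ.min z hc h3
        omega
      · simp only [mon_le_iff, Finsupp.add_apply, xy_apply_zero, xy_apply_one, add_zero]
        omega

/-- The generators in `M` end below row `(n + 1) * v` and the added one sits in row `β + v`. In
between the ideal keeps its last value, whatever `τ` does there; `ρ` records this and is later a
translate of the profile of `I^s`. -/
theorem hasProf_segH {ρ : ℕ → ℕ} (hρ : Antitone ρ) (hβ' : β < (n + 1) * v)
    (h1 : ∀ y, β ≤ y → y < (n + 1) * v → ρ y = τ y)
    (h2 : ∀ y, (n + 1) * v ≤ y → y < β + v → ρ y = τ ((n + 1) * v - 1))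
    (h3 : ρ (β + v) = τ β - u) :
    HasProf (segH u v J n) (fun y => ρ (y + β) - (τ β - u)) := by
  rw [segH, segBeta_eq hτ hβ, segAlpha_eq hτ hβ]
  refine hasProf_colonMon_genBy fun f => ?_
  constructor
  · rintro ⟨e, ⟨he, hle, hlt⟩ | rfl, hef⟩
    · have e1 := hτ.mem_mingens.1 he
      simp only [mon_le_iff, Finsupp.add_apply, xy_apply_zero, xy_apply_one] at hef
      have e2 := hρ hef.2
      have e3 := h1 (e 1) (hβ.min _ hle e1.2) hlt
      omega
    · simp only [mon_le_iff, Finsupp.add_apply, xy_apply_zero, xy_apply_one] at hef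
      have e2 := hρ hef.2
      omega
  · intro h
    by_cases hf : v ≤ f 1
    · refine ⟨_, Or.inr rfl, ?_⟩
      simp only [mon_le_iff, Finsupp.add_apply, xy_apply_zero, xy_apply_one]
      omega
    · obtain ⟨y, hy1, hy2, hy3, hy4⟩ : ∃ y, β ≤ y ∧ y < (n + 1) * v ∧ y ≤ f 1 + β ∧
          ρ (f 1 + β) = τ y := by
        by_cases hlt : f 1 + β < (n + 1) * v
        · exact ⟨f 1 + β, by omega, hlt, le_rfl, h1 _ (by omega) hlt⟩
        · exact ⟨(n + 1) * v - 1, by omega, by omega, by omega, h2 _ (by omega) (by omega)⟩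
      obtain ⟨z, e1, e2, e3, e4⟩ := exists_drop_le hτ.antitone hβ.drop hy1
      refine ⟨xy (τ z) z, Or.inl ⟨hτ.mem_mingens.2 (by simpa), ?_, ?_⟩, ?_⟩
      · simpa using hβ.le.trans e1
      · rw [xy_apply_one]
        omega
      · simp only [mon_le_iff, Finsupp.add_apply, xy_apply_zero, xy_apply_one]
        omega

end segments

/-! ### Segments as slices of the profile of a power -/

namespace Pieces
variable {a b u v j : ℕ → ℕ} {k d n : ℕ} {φ φ' : ℕ → ℕ} {J : Ideal (MvPolynomial (Fin 2) K)}
  {τ : ℕ → ℕ} {i : ℕ}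

section single
variable (h : Pieces a b u v j k d n φ) (hi : 1 ≤ i) (hik : i ≤ k) (hJ : HasProf J j)
  (hτ : HasProf (stair (u i) (v i) J n) τ)
include h hi hik

theorem rep_ge {x y : ℕ} (hr : Rep a b j n i x y) :
    (n + 1) * a i ≤ x ∧ (n + 1) * b (i + 1) ≤ y := by
  obtain ⟨p, q, t, hpq, h1, h2⟩ := hr
  have e1 := h.b_succ i hi hik
  have e2 := h.a_succ i hi hik
  have e3 := Nat.mul_le_mul_left p (show b (i + 1) ≤ b i by omega)
  have e4 := Nat.mul_le_mul_left q (show a i ≤ a (i + 1) by omega)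
  have e5 : (p + q) * a i = p * a i + q * a i := by ring
  have e6 : (p + q) * b (i + 1) = p * b (i + 1) + q * b (i + 1) := by ring
  rw [hpq] at e5 e6
  omega

include hJ hτ

/-- Dividing `n + 1` factors by `gcd(g_i, g_{i+1}) = x^(a i) y^(b (i+1))` turns piece `i` into the
staircase of `(x^(u i), y^(v i))`. -/
theorem rep_add_iff {x y : ℕ} :
    Rep a b j n i (x + (n + 1) * a i) (y + (n + 1) * b (i + 1)) ↔ τ y ≤ x := by
  rw [stair_prof_le_iff hJ hτ, Rep]
  refine exists_congr fun p => exists_congr fun q => exists_congr fun t =>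
    and_congr_right fun hpq => ?_
  rw [h.b_succ i hi hik, h.a_succ i hi hik]
  have e5 : (p + q) * a i + q * u i = p * a i + q * (a i + u i) := by ring
  have e6 : (p + q) * b (i + 1) + p * v i = p * (b (i + 1) + v i) + q * b (i + 1) := by ring
  rw [hpq] at e5 e6
  refine and_congr ?_ ?_ <;> omega

theorem le_stair (y : ℕ) : φ (y + (n + 1) * b (i + 1)) ≤ τ y + (n + 1) * a i :=
  h.le_of_rep hi hik ((h.rep_add_iff hi hik hJ hτ).2 le_rfl)

theorem eq_stair {y : ℕ} (hr : ∀ x, φ (y + (n + 1) * b (i + 1)) ≤ x →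
    Rep a b j n i x (y + (n + 1) * b (i + 1))) :
    φ (y + (n + 1) * b (i + 1)) = τ y + (n + 1) * a i := by
  refine le_antisymm (h.le_stair hi hik hJ hτ y) ?_
  have := hr _ le_rfl
  obtain ⟨c, hc⟩ := Nat.exists_eq_add_of_le' (h.rep_ge hi hik this).1
  rw [hc, h.rep_add_iff hi hik hJ hτ] at this
  omega

theorem eq_stair_window {y : ℕ} (h1 : n * v i ≤ y) (h2 : y < (n + 1) * v i) :
    φ (y + (n + 1) * b (i + 1)) = τ y + (n + 1) * a i := by
  have e1 := h.b_succ i hi hik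
  refine h.eq_stair hi hik hJ hτ fun x => (h.le_iff_rep hi hik ?_ ?_).1
  · rw [e1]
    linarith
  · rw [e1]
    linarith

end single

theorem stair_top (h : Pieces a b u v j k d n φ) (hJ : HasProf J j)
    (hτ : HasProf (stair (u i) (v i) J n) τ) :
    ∃ y, τ y = 0 :=
  ⟨(n + 1) * v i + d, Nat.le_zero.1 ((stair_prof_le_iff hJ hτ).2
    ⟨n + 1, 0, d, by omega, le_rfl, by simp [h.j_d]⟩)⟩

section consecutive

variable (h : Pieces a b u v j k d n φ) (h' : Pieces a b u v j k d (n + 1) φ')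
  (hmul : ∀ l, 1 ≤ l → l ≤ k + 1 → ∀ y, φ' (y + b l) ≤ φ y + a l) (hJ : HasProf J j)
include h h' hmul hJ

/-- The first drop of a power is the translate of the first drop of the corresponding piece. -/
theorem exists_firstDrop_stair (hi : 1 ≤ i) (hik : i ≤ k)
    (hτ : HasProf (stair (u i) (v i) J n) τ) {η : ℕ}
    (hη : FirstDrop φ (n * b i + b (i + 1)) η) :
    ∃ β, η = β + (n + 1) * b (i + 1) ∧ FirstDrop τ (n * v i) β ∧ β < (n + 1) * v i ∧
      φ η = τ β + (n + 1) * a i ∧ u i ≤ τ β ∧ τ β ≤ (n + 1) * u i := by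
  have eb := h.b_succ i hi hik
  have ea := h.a_succ i hi hik
  have hv := h.v_pos i hi hik
  have hlt := h.firstDrop_lt h' hmul hi hik hη
  have hle := hη.le
  have eY : n * b i + b (i + 1) = n * v i + (n + 1) * b (i + 1) := by rw [eb]; ring
  have eZ : (n + 1) * b i = (n + 1) * v i + (n + 1) * b (i + 1) := by rw [eb]; ring
  have eW : (n + 1) * v i = n * v i + v i := by ring
  obtain ⟨β, rfl⟩ := Nat.exists_eq_add_of_le' (show (n + 1) * b (i + 1) ≤ η by omega)
  have hβ1 : n * v i ≤ β := by omega
  have hβ2 : β < (n + 1) * v i := by omega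
  have hval := h.eq_stair_window hi hik hJ hτ hβ1 hβ2
  refine ⟨β, rfl, ⟨hβ1, fun z hz => ?_, fun y hy hd => ?_⟩, hβ2, hval, ?_, ?_⟩
  · have e1 := h.le_stair hi hik hJ hτ z
    have e2 := hη.drop (z + (n + 1) * b (i + 1)) (by omega)
    omega
  · by_contra! hc
    have hnd : ¬ Drop φ (y + (n + 1) * b (i + 1)) := fun hd' => by
      have := hη.min _ (by omega) hd'
      omega
    have hvy := h.eq_stair_window hi hik hJ hτ hy (by omega)
    -- At the first row of the window the row below is outside the range of `eq_stair_window`, and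
    -- `rep_of_not_drop` supplies the missing comparison.
    rcases hy.eq_or_lt with rfl | hy
    · rw [← eY, ← h.drop_add_iff h' hmul hi hik] at hnd
      obtain ⟨h1, h2⟩ := h.rep_of_not_drop h' hmul hi hik hnd
      have h3 := (h.rep_ge hi hik h2).2
      rw [eY, hvy, show n * v i + (n + 1) * b (i + 1) - 1 = n * v i - 1 + (n + 1) * b (i + 1) by
        omega, h.rep_add_iff hi hik hJ hτ] at h2
      have := hd (n * v i - 1) (by omega)
      omega
    · have e1 := h.eq_stair_window hi hik hJ hτ (y := y - 1) (by omega) (by omega)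
      have e2 := ((not_drop_iff h.anti).1 hnd).2
      rw [show y + (n + 1) * b (i + 1) - 1 = y - 1 + (n + 1) * b (i + 1) by omega] at e2
      have := hd (y - 1) (by omega)
      omega
  -- As `β < (n + 1) * v i`, the factors cannot all be `y^(v i)`, so `x^(u i)` occurs.
  · obtain ⟨p, q, t, hpq, e1, e2⟩ := (stair_prof_le_iff hJ hτ).1 (le_refl (τ β))
    have hq : 1 ≤ q := by
      by_contra! hc
      obtain rfl : q = 0 := by omega
      obtain rfl : p = n + 1 := by omega
      omega
    have := Nat.mul_le_mul_right (u i) hq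
    omega
  · refine (stair_prof_le_iff hJ hτ).2 ⟨0, n + 1, d, by omega, ?_, ?_⟩
    · have := h.d_le i hi hik
      omega
    · rw [h.j_d]
      omega

-- In particular `u i ≤ φ η`, which is the divisibility of the link point by `x^(u i)`.
omit hJ in
theorem u_le_firstDrop (hi : 1 ≤ i) (hik : i ≤ k) {η : ℕ}
    (hη : FirstDrop φ (n * b i + b (i + 1)) η) : φ (η + v i) + u i = φ η :=
  h.period h' hmul hi hik hη.le (h.firstDrop_lt h' hmul hi hik hη)

/-- Between the end of the window and `η + v i` the profile `φ` has no drops (`not_drop_of_lt`),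
just as `H` has no generators there; so `H` is the slice of `φ` from `η` to `η + v i`. -/
theorem hasProf_segH (hi : 1 ≤ i) (hik : i ≤ k) {η : ℕ}
    (hη : FirstDrop φ (n * b i + b (i + 1)) η) :
    HasProf (segH (u i) (v i) J n) (fun y => φ (y + η) - (φ η - u i)) := by
  obtain ⟨τ, hτ⟩ := exists_hasProf_stair (u := u i) (v := v i) (n := n) hJ
  obtain ⟨β, hβη, hβ, hlt, hval, hu, -⟩ := h.exists_firstDrop_stair h' hmul hJ hi hik hτ hη
  have hper := h.u_le_firstDrop h' hmul hi hik hη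
  have eb := h.b_succ i hi hik
  have eZ : (n + 1) * b i = (n + 1) * v i + (n + 1) * b (i + 1) := by rw [eb]; ring
  have eW : (n + 1) * v i = n * v i + v i := by ring
  have hle := hβ.le
  have hv := h.v_pos i hi hik
  refine (BivariateMonomial.hasProf_segH hτ hβ
    (ρ := fun y => φ (y + (n + 1) * b (i + 1)) - (n + 1) * a i) ?_ hlt ?_ ?_ ?_).congr ?_
  · intro y z hyz
    exact Nat.sub_le_sub_right (h.anti (by omega)) _
  · intro y h1 h2
    have := h.eq_stair_window hi hik hJ hτ (hβ.le.trans h1) h2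
    simp only [this]
    omega
  · intro y h1 h2
    have e1 := h.eq_stair_window hi hik hJ hτ (y := (n + 1) * v i - 1) (by omega) (by omega)
    have e2 := eq_of_not_drop h.anti (y := (n + 1) * v i - 1 + (n + 1) * b (i + 1))
      (z := y + (n + 1) * b (i + 1)) (by omega)
      (fun t ht1 ht2 => h.not_drop_of_lt h' hmul hi hik hη (by omega) (by omega))
    simp only [e2, e1]
    omega
  · rw [show β + v i + (n + 1) * b (i + 1) = η + v i by omega]
    omega
  · intro y
    rw [show y + β + (n + 1) * b (i + 1) = y + η by omega]
    omega

/-- From `η` on only the first piece contributes. -/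
theorem hasProf_segA_first {η : ℕ} (hη : FirstDrop φ (n * b 1 + b 2) η) :
    HasProf (segA (u 1) (v 1) J n) (fun y => φ (y + η)) := by
  obtain ⟨τ, hτ⟩ := exists_hasProf_stair (u := u 1) (v := v 1) (n := n) hJ
  have hk := h.one_le
  obtain ⟨β, hβη, hβ, -, -⟩ := h.exists_firstDrop_stair h' hmul hJ le_rfl hk hτ hη
  refine (BivariateMonomial.hasProf_segA hτ hβ).congr fun y => ?_
  have e1 := h.eq_stair le_rfl hk hJ hτ (y := y + β) (fun x hx => by
    have hle := hη.le
    rw [h.le_iff_rep_or (i := 0) (by omega) (fun _ => by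
      change n * b 1 + b 2 ≤ y + β + (n + 1) * b 2
      change η = β + (n + 1) * b 2 at hβη
      omega) (fun hc => absurd hc (by omega))] at hx
    rcases hx with hx | hx
    · exact absurd hx.1 (by omega)
    · exact hx.2)
  rw [h.a_one, mul_zero, add_zero] at e1
  rw [← e1, hβη, add_assoc]

/-- Below row `(n + 1) * b k` only the last piece contributes, and above it both truncated
differences vanish. -/
theorem hasProf_segB_last {η : ℕ} (hη : FirstDrop φ (n * b k + b (k + 1)) η) :
    HasProf (segB (u k) (v k) J n) (fun y => φ y - φ η) := by
  obtain ⟨τ, hτ⟩ := exists_hasProf_stair (u := u k) (v := v k) (n := n) hJ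
  have hk := h.one_le
  obtain ⟨β, hβη, hβ, hlt, hval, -⟩ := h.exists_firstDrop_stair h' hmul hJ hk le_rfl hτ hη
  refine (BivariateMonomial.hasProf_segB hτ hβ).congr fun y => ?_
  have hb := h.b_last
  have eb := h.b_succ k hk le_rfl
  by_cases hy : y < (n + 1) * b k
  · have e1 := h.eq_stair hk le_rfl hJ hτ (y := y) (fun x hx => by
      rw [hb, mul_zero, add_zero] at hx ⊢
      rw [h.le_iff_rep_or (i := k) le_rfl (fun hc => absurd hc (lt_irrefl k)) (fun _ => hy)] at hx
      rcases hx with hx | hx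
      · exact hx.2
      · exact absurd hx.1 (lt_irrefl k))
    rw [hb, mul_zero, add_zero] at e1
    omega
  · have e1 : β ≤ y := by
      have : b k = v k := by omega
      rw [this] at hy
      omega
    have e2 := hτ.antitone e1
    have e3 := h.anti (show η ≤ y by rw [hβη, hb]; omega)
    omega

/-- The two summands are the contributions of pieces `i` and `i + 1`. The exponents are the offsets
of their corners from the cut points: `(n+1) b_{i+1} - η' = (n+1) v_{i+1} - β'` and `(n+1) a_{i+1} -
φ η = (n+1) u_i - τ β`. -/
theorem hasProf_glue (hi : 1 ≤ i) (hik : i < k) {η η' : ℕ}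
    (hη : FirstDrop φ (n * b i + b (i + 1)) η)
    (hη' : FirstDrop φ (n * b (i + 1) + b (i + 2)) η') :
    HasProf (mulMon (xy 0 ((n + 1) * v (i + 1) - idist 1 (segB (u (i + 1)) (v (i + 1)) J n)))
        (segB (u i) (v i) J n) +
      mulMon (xy ((n + 1) * u i - idist 0 (segA (u i) (v i) J n)) 0)
        (segA (u (i + 1)) (v (i + 1)) J n)) (fun y => φ (y + η') - φ η) := by
  obtain ⟨τ, hτ⟩ := exists_hasProf_stair (u := u i) (v := v i) (n := n) hJ
  obtain ⟨τ', hτ'⟩ := exists_hasProf_stair (u := u (i + 1)) (v := v (i + 1)) (n := n) hJ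
  obtain ⟨β, hβη, hβ, hlt, hval, hu, hu'⟩ :=
    h.exists_firstDrop_stair h' hmul hJ hi hik.le hτ hη
  obtain ⟨β', hβη', hβ', hlt', hval', -⟩ :=
    h.exists_firstDrop_stair h' hmul hJ (i := i + 1) (by omega) hik hτ' hη'
  have hA := BivariateMonomial.hasProf_segA hτ hβ
  have hA' := BivariateMonomial.hasProf_segA hτ' hβ'
  have hB := BivariateMonomial.hasProf_segB hτ hβ
  have hB' := BivariateMonomial.hasProf_segB hτ' hβ'
  have hdA : idist 0 (segA (u i) (v i) J n) = τ β := by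
    obtain ⟨y, hy⟩ := h.stair_top hJ hτ
    rw [hA.idist_zero (d := y) (Nat.le_zero.1 (hy ▸ hτ.antitone (Nat.le_add_right _ _))), zero_add]
  have hdB : idist 1 (segB (u (i + 1)) (v (i + 1)) J n) = β' :=
    hB'.idist_one (Nat.sub_self _) fun y hy => by
      have := hβ'.drop y hy
      omega
  have ea := h.a_succ i hi hik.le
  have eb := h.b_succ i hi hik.le
  have eb' := h.b_succ (i + 1) (by omega) hik
  have e1 : (n + 1) * a (i + 1) = (n + 1) * a i + (n + 1) * u i := by rw [ea]; ring
  have e2 : (n + 1) * b i = (n + 1) * b (i + 1) + (n + 1) * v i := by rw [eb]; ring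
  have e3 : (n + 1) * b (i + 1) = (n + 1) * b (i + 2) + (n + 1) * v (i + 1) := by rw [eb']; ring
  rw [hdA, hdB]
  refine ⟨(hB.isMon.mulMon _).add (hA'.isMon.mulMon _), fun m => ?_⟩
  rw [mem_mons_add (hB.isMon.mulMon _) (hA'.isMon.mulMon _), hB.mem_mulMon, hA'.mem_mulMon]
  simp only [xy_apply_zero, xy_apply_one, Nat.sub_zero, Nat.zero_le, true_and, add_zero]
  have hiff : φ (m 1 + η') - φ η ≤ m 0 ↔ φ (m 1 + η') ≤ m 0 + (τ β + (n + 1) * a i) := by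
    rw [hval, Nat.sub_le_iff_le_add]
  rw [hiff]
  change η' = β' + (n + 1) * b (i + 2) at hβη'
  by_cases hm : m 1 + η' < (n + 1) * b i
  · rw [h.le_iff_rep_or hik.le (fun _ => by have := hη'.le; omega) (fun _ => hm)]
    simp only [hi, hik, true_and]
    refine or_congr ?_ ?_
    · constructor
      · rintro ⟨h1, h2⟩
        rw [show m 0 + (τ β + (n + 1) * a i) = (m 0 + τ β) + (n + 1) * a i by omega,
          show m 1 + η' = m 1 - ((n + 1) * v (i + 1) - β') + (n + 1) * b (i + 1) by omega,
          h.rep_add_iff hi hik.le hJ hτ]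
        omega
      · intro hr
        have h1 := (h.rep_ge hi hik.le hr).2
        have h2 : (n + 1) * v (i + 1) - β' ≤ m 1 := by omega
        rw [show m 0 + (τ β + (n + 1) * a i) = (m 0 + τ β) + (n + 1) * a i by omega,
          show m 1 + η' = m 1 - ((n + 1) * v (i + 1) - β') + (n + 1) * b (i + 1) by omega,
          h.rep_add_iff hi hik.le hJ hτ] at hr
        exact ⟨h2, by omega⟩
    · have key : ∀ x, Rep a b j n (i + 1) (x + (n + 1) * a (i + 1)) (m 1 + η') ↔
          τ' (m 1 + β') ≤ x := fun x => by
        rw [show m 1 + η' = m 1 + β' + (n + 1) * b (i + 1 + 1) by rw [hβη', add_assoc],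
          h.rep_add_iff (by omega) hik hJ hτ']
      constructor
      · intro hx
        rw [show m 0 + (τ β + (n + 1) * a i) =
          (m 0 - ((n + 1) * u i - τ β)) + (n + 1) * a (i + 1) by omega, key]
        omega
      · intro hr
        have h1 := (h.rep_ge (i := i + 1) (by omega) hik hr).1
        rw [show m 0 + (τ β + (n + 1) * a i) =
          (m 0 - ((n + 1) * u i - τ β)) + (n + 1) * a (i + 1) by omega, key] at hr
        omega
  -- Above that row both sides hold for every `x`-degree: `φ` is at most `φ η` and the `B`-summand
  -- has reached the `y`-axis.
  · have h1 := h.anti (show η ≤ m 1 + η' by omega)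
    refine iff_of_true (Or.inl ⟨by omega, ?_⟩) (by omega)
    have := hτ.antitone (show β ≤ m 1 - ((n + 1) * v (i + 1) - β') by omega)
    omega

end consecutive

end Pieces

/-! ### Sections of a staircase and iterated links -/

section slices
variable {S X : Ideal (MvPolynomial (Fin 2) K)} {φ : ℕ → ℕ} {lo hi : ℕ}

/-- Truncation flattens everything above `hi`; rows below `lo` cannot spoil a drop because `lo` is
itself one. -/
theorem drop_slice_iff (hφ : Antitone φ) (hlo : Drop φ lo) (hle : lo ≤ hi) {y : ℕ} :
    Drop (fun y => φ (y + lo) - φ hi) y ↔ Drop φ (y + lo) ∧ y + lo ≤ hi := by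
  constructor
  · intro hd
    have hle' : y + lo ≤ hi := by
      by_contra! hc
      have := hd (hi - lo) (by omega)
      simp only [Nat.sub_add_cancel hle] at this
      omega
    refine ⟨fun z hz => ?_, hle'⟩
    rcases Nat.lt_or_ge z lo with hz' | hz'
    · exact (hφ (Nat.le_add_left lo y)).trans_lt (hlo z hz')
    · have := hd (z - lo) (by omega)
      simp only [Nat.sub_add_cancel hz'] at this
      omega
  · rintro ⟨hd, hle'⟩ z hz
    have := hd (z + lo) (by omega)
    have := hφ hle'
    simp only
    omega

theorem mem_mingens_slice (hS : HasProf S φ) (hX : HasProf X (fun y => φ (y + lo) - φ hi))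
    (hlo : Drop φ lo) (hle : lo ≤ hi) {m : Mon} :
    m ∈ mingens (mulMon (xy (φ hi) lo) X) ↔ m ∈ mingens S ∧ lo ≤ m 1 ∧ m 1 ≤ hi := by
  rw [hX.mingens_mulMon, hS.mem_mingens, xy_apply_zero, xy_apply_one,
    drop_slice_iff hS.antitone hlo hle]
  by_cases h1 : lo ≤ m 1
  · rw [Nat.sub_add_cancel h1]
    constructor
    · rintro ⟨-, h2, h3, h4⟩
      have := hS.antitone h4
      exact ⟨⟨by omega, h3⟩, h1, h4⟩
    · rintro ⟨⟨h2, h3⟩, -, h4⟩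
      have := hS.antitone h4
      exact ⟨h1, by omega, h3, h4⟩
  · exact iff_of_false (fun h => h1 h.1) (fun h => h1 h.2.1)

/-- As `hi` is a drop, the generator of maximal `y`-degree in the slice lies in row `hi`, and it is
the one left out. -/
theorem mem_mingensStar_slice (hS : HasProf S φ) (hX : HasProf X (fun y => φ (y + lo) - φ hi))
    (hlo : Drop φ lo) (hhi : Drop φ hi) (hle : lo ≤ hi) {m : Mon} :
    m ∈ mingensStar (mulMon (xy (φ hi) lo) X) ↔ m ∈ mingens S ∧ lo ≤ m 1 ∧ m 1 < hi := by
  simp only [mingensStar, Set.mem_ofPred_eq, mem_mingens_slice hS hX hlo hle]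
  constructor
  · rintro ⟨⟨h1, h2, -⟩, m', ⟨-, -, h3⟩, h4⟩
    exact ⟨h1, h2, by omega⟩
  · rintro ⟨h1, h2, h3⟩
    exact ⟨⟨h1, h2, h3.le⟩, xy (φ hi) hi,
      ⟨hS.mem_mingens.2 (by simpa), by simpa, by simp⟩, by simpa⟩

theorem idist_zero_slice (hX : HasProf X (fun y => φ (y + lo) - φ hi)) (hle : lo ≤ hi) :
    idist 0 X = φ lo - φ hi := by
  rw [hX.idist_zero (d := hi - lo) (by rw [Nat.sub_add_cancel hle, Nat.sub_self]), zero_add]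

theorem slice_ne_zero (hhi : Drop φ hi) : ∀ y < hi - lo, φ (y + lo) - φ hi ≠ 0 := fun y hy => by
  have := hhi (y + lo) (by omega)
  omega

theorem idist_one_slice (hX : HasProf X (fun y => φ (y + lo) - φ hi)) (hle : lo ≤ hi)
    (hhi : Drop φ hi) : idist 1 X = hi - lo :=
  hX.idist_one (by rw [Nat.sub_add_cancel hle, Nat.sub_self]) (slice_ne_zero hhi)

end slices

section iterLink
variable {S : Ideal (MvPolynomial (Fin 2) K)} {φ η : ℕ → ℕ} {k : ℕ}
  {C : ℕ → Ideal (MvPolynomial (Fin 2) K)} (hS : HasProf S φ)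
  (hη : ∀ i, i ≤ k → η (i + 1) ≤ η i) (hd : ∀ i, i ≤ k + 1 → Drop φ (η i))
  (hC : ∀ i, i ≤ k → HasProf (C i) (fun y => φ (y + η (i + 1)) - φ (η i)))
include hS hη hd hC

omit hS hd hC in
theorem antitone_of_step {i l : ℕ} (hil : i ≤ l) (hl : l ≤ k + 1) : η l ≤ η i := by
  induction l, hil using Nat.le_induction with
  | base => rfl
  | succ l hil ih => exact (hη l (by omega)).trans (ih (by omega))

/-- Linking two slices that share a cut point gives the slice between their outer ends. -/
theorem hasProf_iterLink {p t : ℕ} (hpt : p + t ≤ k) :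
    HasProf (iterLink C p t) (fun y => φ (y + η (p + t + 1)) - φ (η p)) := by
  induction t with
  | zero => exact hC p hpt
  | succ t ih =>
    have ih := ih (by omega)
    have h1 := antitone_of_step hη (show p ≤ p + t + 1 by omega) (by omega)
    have h2 := hη (p + t + 1) (by omega)
    refine (ih.link (hC (p + t + 1) hpt) (d := η p - η (p + t + 1))
      (e := η (p + t + 1) - η (p + t + 1 + 1)) ?_ ?_ ?_).congr ?_
    · rw [Nat.sub_add_cancel h1, Nat.sub_self]
    · rw [Nat.sub_add_cancel h2, Nat.sub_self]
    · exact slice_ne_zero (hd _ (by omega))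
    · intro y
      have h3 := hS.antitone h1
      simp only [← add_assoc, zero_add]
      split_ifs with hy
      · have := hS.antitone (show y + η (p + t + 1 + 1) ≤ η (p + t + 1) by omega)
        omega
      · rw [show y - (η (p + t + 1) - η (p + t + 1 + 1)) + η (p + t + 1) =
          y + η (p + t + 1 + 1) by omega]

theorem linkPoint_eq (hk : 1 ≤ k) (h0 : φ (η 0) = 0) (hlast : η (k + 1) = 0) {i : ℕ}
    (hi : i ≤ k + 1) : linkPoint C k i = xy (φ (η i)) (η i) := by
  have hle : ∀ i l, i ≤ l → l ≤ k + 1 → η l ≤ η i := fun i l h1 h2 => antitone_of_step hη h1 h2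
  have hP := fun p t (hpt : p + t ≤ k) => hasProf_iterLink hS hη hd hC hpt
  have hX := fun p t (hpt : p + t ≤ k) =>
    idist_zero_slice (hP p t hpt) (hle p (p + t + 1) (by omega) (by omega))
  have hY := fun p t (hpt : p + t ≤ k) =>
    idist_one_slice (hP p t hpt) (hle p (p + t + 1) (by omega) (by omega)) (hd p (by omega))
  rw [linkPoint]
  split_ifs with h1 h2
  · rw [hY 0 k (by omega), h1, h0, zero_add, hlast, Nat.sub_zero]
  · rw [hX 0 (i - 1) (by omega), hY i (k - i) (by omega), h0, zero_add,
      show i - 1 + 1 = i by omega, show i + (k - i) + 1 = k + 1 by omega, hlast, Nat.sub_zero,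
      Nat.sub_zero]
  · obtain rfl : i = k + 1 := by omega
    rw [hX 0 k (by omega), h0, zero_add, hlast, Nat.sub_zero]

theorem eq_iterLink (h0 : φ (η 0) = 0) (hlast : η (k + 1) = 0) : S = iterLink C 0 k := by
  refine hS.eq ((hasProf_iterLink hS hη hd hC (p := 0) (t := k) (by omega)).congr fun y => ?_)
  rw [h0, zero_add, hlast, Nat.sub_zero, add_zero]

end iterLink

namespace Pieces
variable {a b u v j : ℕ → ℕ} {k d n : ℕ} {φ φ' : ℕ → ℕ}

/-- Periodicity transports the comparison of two adjacent rows; at the first row of the window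
`drop_add_iff` takes over. The result puts the upper end of the slice `H` at a drop. -/
theorem drop_firstDrop_add (h : Pieces a b u v j k d n φ)
    (h' : Pieces a b u v j k d (n + 1) φ')
    (hmul : ∀ l, 1 ≤ l → l ≤ k + 1 → ∀ y, φ' (y + b l) ≤ φ y + a l) {i η : ℕ} (hi : 1 ≤ i)
    (hik : i ≤ k) (hη : FirstDrop φ (n * b i + b (i + 1)) η) : Drop φ (η + v i) := by
  have e0 := h.low_add hi hik
  rcases hη.le.eq_or_lt with rfl | hlt
  · rw [e0, h.drop_add_iff h' hmul hi hik]
    exact hη.drop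
  · have e1 := h.firstDrop_lt h' hmul hi hik hη
    obtain ⟨η, rfl⟩ := Nat.exists_eq_add_of_le' (show 1 ≤ η by omega)
    rw [show η + 1 + v i = η + v i + 1 by omega, drop_succ_iff h.anti]
    have e2 := h.period h' hmul hi hik (y := η) (by omega) (by omega)
    have e3 := h.period h' hmul hi hik (y := η + 1) (by omega) (by omega)
    have e4 := hη.drop η (by omega)
    rw [show η + 1 + v i = η + v i + 1 by omega] at e3
    omega

end Pieces

/-! ### Multiplication by the members of the chain -/

/-- The minimal generators `G'` of the next power arise from the minimal generators `G` of a power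
by multiplication with `g_{i+1}` in the `i`-th section. -/
structure ShiftStep (g : ℕ → Mon) (v : ℕ → ℕ) (k : ℕ) (η : ℕ → ℕ) (G G' : Set Mon) : Prop where
  mem_iff : ∀ i ≤ k, ∀ f : Mon, η (i + 1) ≤ f 1 → (1 ≤ i → f 1 < η i + v i) →
    (f ∈ G ↔ g (i + 1) + f ∈ G')
  le : ∀ i ≤ k, ∀ m ∈ G', η (i + 1) + g (i + 1) 1 ≤ m 1 → (1 ≤ i → m 1 < η i + g i 1) →
    g (i + 1) ≤ m

/-- Since `η i` lies in its window, the section from `η (i + 1)` to `η i + v i` is in the range of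
`shift` and `drop_shift`. -/
theorem Pieces.shiftStep {g : ℕ → Mon} {u v j : ℕ → ℕ} {k d n : ℕ} {φ φ' : ℕ → ℕ}
    (h : Pieces (fun i => g i 0) (fun i => g i 1) u v j k d n φ)
    (h' : Pieces (fun i => g i 0) (fun i => g i 1) u v j k d (n + 1) φ')
    (hmul : ∀ l, 1 ≤ l → l ≤ k + 1 → ∀ y, φ' (y + g l 1) ≤ φ y + g l 0)
    {S S' : Ideal (MvPolynomial (Fin 2) K)} (hS : HasProf S φ) (hS' : HasProf S' φ') {η : ℕ → ℕ}
    (hη : ∀ i, 1 ≤ i → i ≤ k → FirstDrop φ (n * g i 1 + g (i + 1) 1) (η i)) :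
    ShiftStep g v k η (mingens S) (mingens S') := by
  have hlo : ∀ i, i ≤ k → ∀ y, η (i + 1) ≤ y → i < k → n * g (i + 1) 1 + g (i + 2) 1 ≤ y :=
    fun i hik y hy hi => (hη (i + 1) (by omega) hi).le.trans hy
  have hhi : ∀ i, i ≤ k → 1 ≤ i → η i < (n + 1) * g i 1 := fun i hik hi =>
    h.firstDrop_lt h' hmul hi hik (hη i hi hik)
  constructor
  · intro i hik f h1 h2
    have e1 := h.shift h' hmul hik (hlo i hik _ h1) (fun hi => by
      have := hhi i hik hi
      have := h2 hi
      change f 1 < (n + 1) * g i 1 + v i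
      omega)
    have e2 := h.drop_shift h' hmul hik (hlo i hik _ h1) (fun hi => by
      have := hhi i hik hi
      have := h2 hi
      change f 1 < (n + 1) * g i 1 + v i
      omega)
    rw [hS.mem_mingens, hS'.mem_mingens, Finsupp.add_apply, Finsupp.add_apply,
      add_comm (g (i + 1) 1), e1, e2, add_comm (g (i + 1) 0)]
    simp
  · intro i hik m hm h1 h2
    obtain ⟨y, hy⟩ := Nat.exists_eq_add_of_le' (show g (i + 1) 1 ≤ m 1 by omega)
    have e1 := h.shift h' hmul hik (y := y) (hlo i hik _ (by omega)) (fun hi => by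
      have := hhi i hik hi
      have := h2 hi
      have := h.b_succ i hi hik
      omega)
    have e2 := (hS'.mem_mingens.1 hm).1
    rw [hy, e1] at e2
    rw [mon_le_iff]
    omega

theorem disjoint_of_deg {A B : Set Mon} (e : ℕ) (hA : ∀ m ∈ A, e ≤ m 1) (hB : ∀ m ∈ B, m 1 < e) :
    Disjoint A B :=
  Set.disjoint_left.2 fun m h1 h2 => absurd (hB m h2) (not_lt.2 (hA m h1))

theorem pairwiseDisjoint_of_deg {A : ℕ → Set Mon} {k : ℕ} {e : ℕ → ℕ}
    (he : ∀ i l, 1 ≤ i → i ≤ l → l ≤ k + 1 → e l ≤ e i)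
    (hA : ∀ i, 1 ≤ i → i ≤ k → ∀ m ∈ A i, e (i + 1) ≤ m 1 ∧ m 1 < e i) :
    (Set.Icc 1 k).PairwiseDisjoint A := by
  intro i hi l hl hil
  rcases lt_or_gt_of_ne hil with h | h
  · exact disjoint_of_deg (e (i + 1)) (fun m hm => (hA i hi.1 hi.2 m hm).1) (fun m hm =>
      (hA l hl.1 hl.2 m hm).2.trans_le (he (i + 1) l (by omega) h (by have := hl.2; omega)))
  · exact (disjoint_of_deg (e (l + 1)) (fun m hm => (hA l hl.1 hl.2 m hm).1) (fun m hm =>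
      (hA i hi.1 hi.2 m hm).2.trans_le
        (he (l + 1) i (by omega) h (by have := hi.2; omega)))).symm

theorem mem_vadd_mon {g m : Mon} {A : Set Mon} : m ∈ g +ᵥ A ↔ ∃ f ∈ A, g + f = m := Iff.rfl

/-- Thresholds `η 1 ≥ … ≥ η (k + 1) = 0` that are compatible with the chain `g`. -/
structure Thresholds (g : ℕ → Mon) (v : ℕ → ℕ) (k : ℕ) (η : ℕ → ℕ) : Prop where
  one_le : 1 ≤ k
  y_succ : ∀ i, 1 ≤ i → i ≤ k → g i 1 = g (i + 1) 1 + v i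
  y_last : g (k + 1) 1 = 0
  last : η (k + 1) = 0
  add_le : ∀ i, 1 ≤ i → i < k → η (i + 1) + v (i + 1) ≤ η i

namespace Thresholds
variable {g : ℕ → Mon} {v : ℕ → ℕ} {k : ℕ} {η : ℕ → ℕ} (h : Thresholds g v k η)
include h

theorem step {i : ℕ} (h1 : 1 ≤ i) (h2 : i ≤ k) : η (i + 1) ≤ η i := by
  rcases h2.eq_or_lt with rfl | h2
  · rw [h.last]; exact Nat.zero_le _
  · have := h.add_le i h1 h2
    omega

theorem le_of_le {c i l : ℕ} (h1 : 1 ≤ i) (hil : i ≤ l) (hl : l ≤ k + 1) :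
    η l + c * g l 1 ≤ η i + c * g i 1 := by
  induction l, hil using Nat.le_induction with
  | base => rfl
  | succ l hil ih =>
    have e1 := h.step (i := l) (by omega) (by omega)
    have e2 := h.y_succ l (by omega) (by omega)
    have e3 := Nat.mul_le_mul_left c (show g (l + 1) 1 ≤ g l 1 by omega)
    have := ih (by omega)
    omega

theorem succ : Thresholds g v k (fun i => η i + g i 1) where
  one_le := h.one_le
  y_succ := h.y_succ
  y_last := h.y_last
  last := by rw [h.last, h.y_last]
  add_le i h1 h2 := by
    have := h.add_le i h1 h2
    have := h.y_succ i h1 h2.le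
    omega

theorem exists_section (y : ℕ) :
    ∃ i ≤ k, η (i + 1) ≤ y ∧ (1 ≤ i → y < η i) := by
  have hex : ∃ i, η (i + 1) ≤ y := ⟨k, by rw [h.last]; exact Nat.zero_le _⟩
  classical
  refine ⟨Nat.find hex, Nat.find_min' hex (by rw [h.last]; exact Nat.zero_le _),
    Nat.find_spec hex, fun hi => ?_⟩
  have := Nat.find_min hex (m := Nat.find hex - 1) (by omega)
  rw [Nat.sub_add_cancel hi] at this
  omega

variable {G G' G'' : Set Mon}

/-- The minimal generators of the next power. -/
theorem mem_next (s : ShiftStep g v k η G G') {m : Mon} :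
    m ∈ G' ↔ ∃ i ≤ k, ∃ f ∈ G, (η (i + 1) ≤ f 1 ∧ (1 ≤ i → f 1 < η i + v i)) ∧
      g (i + 1) + f = m := by
  constructor
  · intro hm
    obtain ⟨i, hik, h1, h2⟩ := h.succ.exists_section (m 1)
    have hle := s.le i hik m hm h1 h2
    have hm1 := (mon_le_iff.1 hle).2
    have hs : g (i + 1) + (m - g (i + 1)) = m := add_tsub_cancel_of_le hle
    have hf : (m - g (i + 1)) 1 = m 1 - g (i + 1) 1 := by simp
    have e1 : η (i + 1) ≤ (m - g (i + 1)) 1 := by rw [hf]; omega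
    have e2 : 1 ≤ i → (m - g (i + 1)) 1 < η i + v i := fun hi => by
      have := h.y_succ i hi hik
      have := h2 hi
      rw [hf]; omega
    exact ⟨i, hik, m - g (i + 1), (s.mem_iff i hik _ e1 e2).2 (by rwa [hs]), ⟨e1, e2⟩, hs⟩
  · rintro ⟨i, hik, f, hf, ⟨h1, h2⟩, rfl⟩
    exact (s.mem_iff i hik f h1 h2).1 hf

/-- The minimal generators of the power after the next one. -/
theorem mem_next_next (s : ShiftStep g v k η G G')
    (s' : ShiftStep g v k (fun i => η i + g i 1) G' G'') {m : Mon} :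
    m ∈ G'' ↔
      (∃ i ≤ k, ∃ f ∈ G, (η (i + 1) ≤ f 1 ∧ (1 ≤ i → f 1 < η i + v i)) ∧
        2 • g (i + 1) + f = m) ∨
      ∃ i, 1 ≤ i ∧ i ≤ k ∧ ∃ f ∈ G, (η i ≤ f 1 ∧ f 1 < η i + v i) ∧
        g i + g (i + 1) + f = m := by
  rw [h.succ.mem_next s']
  constructor
  · rintro ⟨i, hik, f, hf, ⟨h1, h2⟩, rfl⟩
    -- Below `η i + g i 1` the generator `f` of `G'` has a factor `g (i + 1)` again; in the band of
    -- height `v i` above, it has the factor `g i` instead.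
    by_cases hlt : 1 ≤ i → f 1 < η i + g i 1
    · left
      have hle := s.le i hik f hf h1 hlt
      have hm1 := (mon_le_iff.1 hle).2
      obtain ⟨f', rfl⟩ := exists_add_of_le hle
      simp only [Finsupp.add_apply] at h1 hlt
      have e1 : η (i + 1) ≤ f' 1 := by omega
      have e2 : 1 ≤ i → f' 1 < η i + v i := fun hi => by
        have := h.y_succ i hi hik
        have := hlt hi
        omega
      exact ⟨i, hik, f', (s.mem_iff i hik f' e1 e2).2 hf, ⟨e1, e2⟩, by abel⟩
    · right
      rw [Classical.not_imp] at hlt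
      obtain ⟨hi, hlt⟩ := hlt
      have h2 := h2 hi
      obtain ⟨i, rfl⟩ := Nat.exists_eq_add_of_le' hi
      have hadd : 1 ≤ i → η (i + 1) + v (i + 1) ≤ η i := fun hi => h.add_le i hi (by omega)
      have hle := s.le i (by omega) f hf (by omega) (fun hi => by
        have := hadd hi
        have := h.y_succ i hi (by omega)
        omega)
      obtain ⟨f', rfl⟩ := exists_add_of_le hle
      simp only [Finsupp.add_apply] at h2 hlt
      have e1 : η (i + 1) ≤ f' 1 := by omega
      have e2 : 1 ≤ i → f' 1 < η i + v i := fun hi => by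
        have := hadd hi
        omega
      exact ⟨i + 1, by omega, hik, f', (s.mem_iff i (by omega) f' e1 e2).2 hf,
        ⟨e1, by omega⟩, by abel⟩
  · rintro (⟨i, hik, f, hf, ⟨h1, h2⟩, rfl⟩ | ⟨i, hi, hik, f, hf, ⟨h1, h2⟩, rfl⟩)
    · refine ⟨i, hik, g (i + 1) + f, (s.mem_iff i hik f h1 h2).1 hf, ⟨?_, fun hi => ?_⟩, by abel⟩
      · rw [Finsupp.add_apply]
        omega
      · have := h2 hi
        have := h.y_succ i hi hik
        rw [Finsupp.add_apply]
        omega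
    · obtain ⟨i, rfl⟩ := Nat.exists_eq_add_of_le' hi
      refine ⟨i + 1, hik, g (i + 1) + f, (s.mem_iff i (by omega) f h1 fun hi => ?_).1 hf,
        ⟨?_, fun _ => ?_⟩, by abel⟩
      · have := h.add_le i hi (by omega)
        omega
      · have := h.step hi hik
        have := h.y_succ (i + 1) hi hik
        rw [Finsupp.add_apply]
        omega
      · rw [Finsupp.add_apply]
        omega

/-- Consecutive sections overlap in the bands `η i ≤ y < η i + v i`, where two multipliers occur;
`add_le` keeps different bands disjoint. -/
theorem mem_multipliers {hpt : ℕ → Mon} (hh : ∀ i, 1 ≤ i → i ≤ k → hpt i 1 = η i)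
    (hv : ∀ i, 1 ≤ i → i ≤ k → pdist K 1 (g i) (g (i + 1)) = v i) {f m : Mon} :
    m ∈ multipliers K g hpt k f ↔
      ∃ i ≤ k, (η (i + 1) ≤ f 1 ∧ (1 ≤ i → f 1 < η i + v i)) ∧ g (i + 1) = m := by
  have hk := h.one_le
  constructor
  · rintro (⟨i, h1, h2, h3, h4, rfl⟩ | ⟨i, h1, h2, h3, h4, h5⟩ | ⟨h1, rfl⟩)
    · rw [hh i h1 h2, hv i h1 h2] at h3
      refine ⟨i - 1, by omega, ⟨?_, fun hi => ?_⟩, ?_⟩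
      · rw [Nat.sub_add_cancel h1]; omega
      · rcases h4 with rfl | h4
        · omega
        · rw [hh _ hi (by omega)] at h4
          omega
      · rw [Nat.sub_add_cancel h1]
    · rw [hh i h1 h2] at h3 h4
      rw [hv i h1 h2] at h4
      rcases h5 with rfl | rfl
      · refine ⟨i - 1, by omega, ⟨?_, fun hi => ?_⟩, ?_⟩
        · rwa [Nat.sub_add_cancel h1]
        · have := h.add_le (i - 1) hi (by omega)
          rw [Nat.sub_add_cancel h1] at this
          omega
        · rw [Nat.sub_add_cancel h1]
      · exact ⟨i, h2, ⟨(h.step h1 h2).trans h3, fun _ => h4⟩, rfl⟩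
    · rw [hh k hk le_rfl] at h1
      refine ⟨k, le_rfl, ⟨?_, fun _ => by omega⟩, rfl⟩
      rw [h.last]
      exact Nat.zero_le _
  · rintro ⟨i, hik, ⟨h1, h2⟩, rfl⟩
    by_cases hc : 1 ≤ i ∧ η i ≤ f 1
    · right; left
      refine ⟨i, hc.1, hik, ?_, ?_, Or.inr rfl⟩
      · rw [hh i hc.1 hik]; exact hc.2
      · rw [hh i hc.1 hik, hv i hc.1 hik]; exact h2 hc.1
    · rcases hik.eq_or_lt with rfl | hik
      · right; right
        rw [hh i hk le_rfl]
        exact ⟨by omega, rfl⟩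
      · by_cases hlt : f 1 < η (i + 1) + v (i + 1)
        · right; left
          refine ⟨i + 1, by omega, hik, ?_, ?_, Or.inl rfl⟩
          · rwa [hh (i + 1) (by omega) hik]
          · rwa [hh (i + 1) (by omega) hik, hv (i + 1) (by omega) hik]
        · left
          refine ⟨i + 1, by omega, hik, ?_, ?_, rfl⟩
          · rw [hh (i + 1) (by omega) hik, hv (i + 1) (by omega) hik]
            omega
          · rcases Nat.eq_zero_or_pos i with rfl | hi
            · exact Or.inl rfl
            · right
              rw [Nat.add_sub_cancel, hh i hi hik.le]
              omega

theorem section_unique {c i l : ℕ} (hi : i ≤ k) (hl : l ≤ k) {y : ℕ}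
    (hi1 : η (i + 1) + c * g (i + 1) 1 ≤ y) (hi2 : 1 ≤ i → y < η i + c * g i 1)
    (hl1 : η (l + 1) + c * g (l + 1) 1 ≤ y) (hl2 : 1 ≤ l → y < η l + c * g l 1) : i = l := by
  rcases lt_trichotomy i l with hlt | heq | hlt
  · have := h.le_of_le (c := c) (i := i + 1) (l := l) (by omega) hlt (by omega)
    have := hl2 (by omega)
    omega
  · exact heq
  · have := h.le_of_le (c := c) (i := l + 1) (l := i) (by omega) hlt (by omega)
    have := hi2 (by omega)
    omega

end Thresholds

/-! ### Powers of `I` as sums of pieces -/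

/-- The profile of a monomial ideal: for each `y`-degree the least `x`-degree of a monomial. -/
noncomputable def prof (I : Ideal (MvPolynomial (Fin 2) K)) (y : ℕ) : ℕ :=
  sInf {x | xy x y ∈ mons I}

theorem nsmul_mem_mons_pow {I : Ideal (MvPolynomial (Fin 2) K)} (hI : IsMonomialIdeal I)
    {f : Mon} (hf : f ∈ mons I) (N : ℕ) : N • f ∈ mons (I ^ N) := by
  refine (mem_mons_pow hI).2 ⟨Multiset.replicate N f, Multiset.card_replicate _ _, fun a ha => ?_,
    by rw [Multiset.sum_replicate]⟩
  rwa [Multiset.eq_of_mem_replicate ha]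

theorem mul_idist_le_of_rY_le {I : Ideal (MvPolynomial (Fin 2) K)} {g : ℕ → Mon} {k D n i : ℕ}
    (h : rY I g k D ≤ n) (hi : i ∈ Set.Icc 1 k) (hpos : 0 < pdist K 1 (g i) (g (i + 1))) :
    D * idist 1 I ≤ n * pdist K 1 (g i) (g (i + 1)) := by
  rw [rY, Nat.ceil_le] at h
  have h1 : (idist 1 I : ℚ≥0) / (pdist K 1 (g i) (g (i + 1)) : ℚ≥0) ≤ (Finset.Icc 1 k).sup
      (fun i => (idist 1 I : ℚ≥0) / (pdist K 1 (g i) (g (i + 1)) : ℚ≥0)) :=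
    Finset.le_sup (f := fun i => (idist 1 I : ℚ≥0) / (pdist K 1 (g i) (g (i + 1)) : ℚ≥0))
      (Finset.mem_Icc.2 hi)
  have h2 := (mul_le_mul_of_nonneg_left h1 (zero_le (a := (D : ℚ≥0)))).trans h
  rw [← mul_div_assoc, div_le_iff₀ (by exact_mod_cast hpos)] at h2
  exact_mod_cast h2

namespace GenChain
variable {I : Ideal (MvPolynomial (Fin 2) K)} {g : ℕ → Mon} {k D n : ℕ} (h : GenChain I g k)
include h

theorem x_le {i l : ℕ} (h1 : 1 ≤ i) (hil : i ≤ l) (hl : l ≤ k + 1) : g i 0 ≤ g l 0 := by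
  rcases hil.eq_or_lt with rfl | hil
  · exact le_rfl
  · exact (h.x_lt i l h1 hil hl).le

theorem y_le {i l : ℕ} (h1 : 1 ≤ i) (hil : i ≤ l) (hl : l ≤ k + 1) : g l 1 ≤ g i 1 := by
  rcases hil.eq_or_lt with rfl | hil
  · exact le_rfl
  · exact (h.y_lt i l h1 hil hl).le

theorem hasProf_pow (N : ℕ) : HasProf (I ^ N) (prof (I ^ N)) := by
  refine HasProf.of_mem (h.isMon.pow N) (a := N * g (k + 1) 0) ?_
  have := nsmul_mem_mons_pow h.isMon (h.mem (k + 1) (by omega) le_rfl).1 N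
  convert this using 1
  exact mon_ext (by simp) (by simp [h.y_last])

theorem prof_pow_eq_zero (N : ℕ) : prof (I ^ N) (N * g 1 1) = 0 := by
  have := nsmul_mem_mons_pow h.isMon (h.mem 1 le_rfl (by omega)).1 N
  rw [(h.hasProf_pow N).mem, Finsupp.smul_apply, Finsupp.smul_apply, h.x_one, smul_zero] at this
  exact Nat.le_zero.1 this

theorem exists_first_zero (N : ℕ) :
    ∃ t, prof (I ^ N) t = 0 ∧ ∀ y < t, prof (I ^ N) y ≠ 0 := by
  classical
  have hex : ∃ t, prof (I ^ N) t = 0 := ⟨_, h.prof_pow_eq_zero N⟩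
  exact ⟨Nat.find hex, Nat.find_spec hex, fun y hy => Nat.find_min hex hy⟩

theorem prof_succ_le {N l : ℕ} (h1 : 1 ≤ l) (h2 : l ≤ k + 1) (y : ℕ) :
    prof (I ^ (N + 1)) (y + g l 1) ≤ prof (I ^ N) y + g l 0 := by
  rw [← (h.hasProf_pow (N + 1)).mem_xy, pow_succ, mem_mons_mul (h.isMon.pow N) h.isMon]
  refine ⟨xy (prof (I ^ N) y) y, (h.hasProf_pow N).mem_xy.2 le_rfl, g l, (h.mem l h1 h2).1, ?_⟩
  rw [mon_le_iff]
  simp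

theorem hasProf_self : HasProf I (prof I) := by
  simpa using h.hasProf_pow 1

theorem prof_first : prof I (g 1 1) = 0 := by
  simpa using h.prof_pow_eq_zero 1

theorem idist_one : idist 1 I = g 1 1 := by
  refine h.hasProf_self.idist_one h.prof_first fun y hy => ?_
  have := (h.hasProf_self.mem_mingens.1 (h.mem 1 le_rfl (by omega))).2 y hy
  omega

theorem idist_zero : idist 0 I = g (k + 1) 0 := by
  rw [h.hasProf_self.idist_zero h.prof_first]
  have := (h.hasProf_self.mem_mingens.1 (h.mem (k + 1) (by omega) le_rfl)).1
  rw [this, h.y_last]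

theorem exists_adjacent_factor_of_le {P : Finset Mon}
    (hg : (P : Set Mon) = g '' Set.Icc 1 (k + 1))
    (hD : (mu I - P.card) * deltaP K g k + P.card * dP I P ≤ D) (M : ℕ) (m : Mon)
    (hm : m ∈ mons (I ^ (M + D))) :
    ∃ i, 1 ≤ i ∧ i ≤ k ∧ ∃ p q, p + q = M ∧ ∃ w ∈ mons (I ^ D),
      p • g i + q • g (i + 1) + w ≤ m := by
  have hcard : P.card = k + 1 := by
    have hinj : Set.InjOn g (Set.Icc 1 (k + 1)) := by
      intro i hi l hl hil
      by_contra hne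
      rcases lt_or_gt_of_ne hne with hlt | hlt
      · exact h.ne hi.1 hlt hl.2 hil
      · exact h.ne hl.1 hlt hi.2 hil.symm
    rw [← Set.ncard_coe_finset, hg, hinj.ncard_image, ← Finset.coe_Icc,
      Set.ncard_coe_finset, Nat.card_Icc]
    omega
  refine h.exists_adjacent_factor (P := P) (fun f => ?_)
    (h.hasProf_self.finite_mingens h.prof_first) (fun i h1 h2 => ?_) (fun hk => ?_) hD hm
  · rw [← Finset.mem_coe, hg]
    simp [and_assoc]
  · rw [← pdist_zero (K := K) (h.x_lt i (i + 1) h1 (by omega) (by omega))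
      (h.y_lt i (i + 1) h1 (by omega) (by omega)), ← pdist_one (K := K)
      (h.x_lt i (i + 1) h1 (by omega) (by omega)) (h.y_lt i (i + 1) h1 (by omega) (by omega))]
    have := Finset.le_sup (f := fun i => min (pdist K 0 (g i) (g (i + 1)))
      (pdist K 1 (g i) (g (i + 1)))) (Finset.mem_Icc.2 ⟨h1, h2⟩)
    rw [deltaP]
    omega
  · rw [dP, if_pos (by omega), h.idist_zero, h.idist_one]
    -- The variable with the smaller distance is used: that distance bounds its degree on the whole
    -- chain.
    rcases le_total (g (k + 1) 0) (g 1 1) with hle | hle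
    · refine ⟨0, fun i h1 h2 => ?_⟩
      have := h.x_le h1 h2 le_rfl
      omega
    · refine ⟨1, fun i h1 h2 => ?_⟩
      have := h.y_le le_rfl h1 h2
      omega

theorem pieces (hcov : ∀ (M : ℕ) (m : Mon), m ∈ mons (I ^ (M + D)) →
      ∃ i, 1 ≤ i ∧ i ≤ k ∧ ∃ p q, p + q = M ∧ ∃ w ∈ mons (I ^ D),
        p • g i + q • g (i + 1) + w ≤ m)
    (hn : ∀ i, 1 ≤ i → i ≤ k → D * g 1 1 ≤ n * (g i 1 - g (i + 1) 1)) :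
    Pieces (fun i => g i 0) (fun i => g i 1) (fun i => g (i + 1) 0 - g i 0)
      (fun i => g i 1 - g (i + 1) 1) (prof (I ^ D)) k (D * g 1 1) n (prof (I ^ (n + 1 + D))) where
  one_le := h.one_le
  a_succ i h1 h2 := by
    have := h.x_lt i (i + 1) h1 (by omega) (by omega)
    omega
  b_succ i h1 h2 := by
    have := h.y_lt i (i + 1) h1 (by omega) (by omega)
    omega
  u_pos i h1 h2 := by
    have := h.x_lt i (i + 1) h1 (by omega) (by omega)
    omega
  v_pos i h1 h2 := by
    have := h.y_lt i (i + 1) h1 (by omega) (by omega)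
    omega
  a_one := h.x_one
  b_last := h.y_last
  anti := (h.hasProf_pow _).antitone
  j_d := h.prof_pow_eq_zero D
  d_le := hn
  mem x y := by
    rw [← (h.hasProf_pow _).mem_xy]
    constructor
    · intro hm
      obtain ⟨i, h1, h2, p, q, hpq, w, hw, hle⟩ := hcov (n + 1) _ hm
      rw [mon_le_iff] at hle
      simp only [Finsupp.add_apply, Finsupp.smul_apply, smul_eq_mul, xy_apply_zero,
        xy_apply_one] at hle
      have := ((h.hasProf_pow D).mem w).1 hw
      exact ⟨i, h1, h2, p, q, w 1, hpq, hle.2, by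
        change p * g i 0 + q * g (i + 1) 0 + prof (I ^ D) (w 1) ≤ x
        omega⟩
    · rintro ⟨i, h1, h2, p, q, t, hpq, hy, hx⟩
      rw [pow_add, mem_mons_mul (h.isMon.pow _) (h.isMon.pow _)]
      refine ⟨p • g i + q • g (i + 1), ?_, xy (prof (I ^ D) t) t,
        (h.hasProf_pow D).mem_xy.2 le_rfl, ?_⟩
      · rw [← hpq, pow_add, mem_mons_mul (h.isMon.pow _) (h.isMon.pow _)]
        exact ⟨_, nsmul_mem_mons_pow h.isMon (h.mem i h1 (by omega)).1 p, _,
          nsmul_mem_mons_pow h.isMon (h.mem (i + 1) (by omega) (by omega)).1 q, le_rfl⟩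
      · rw [mon_le_iff]
        simp only [Finsupp.add_apply, Finsupp.smul_apply, smul_eq_mul, xy_apply_zero,
          xy_apply_one]
        exact ⟨hx, hy⟩

end GenChain

/-! ### Disjoint decompositions by `y`-degree -/

namespace Thresholds
variable {g : ℕ → Mon} {v : ℕ → ℕ} {k : ℕ} {η : ℕ → ℕ}

/-- The disjoint decompositions of the minimal generators of three consecutive powers. -/
theorem decomposition (h : Thresholds g v k η) {G G' G'' A : Set Mon} {B E : ℕ → Set Mon}
    {F : Mon → Set Mon} (s : ShiftStep g v k η G G')
    (s' : ShiftStep g v k (fun i => η i + g i 1) G' G'')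
    (hA : ∀ m, m ∈ A ↔ m ∈ G ∧ η 1 ≤ m 1)
    (hB : ∀ i, 1 ≤ i → i ≤ k → ∀ m, m ∈ B i ↔ m ∈ G ∧ η (i + 1) ≤ m 1 ∧ m 1 < η i)
    (hE : ∀ i, 1 ≤ i → i ≤ k → ∀ m, m ∈ E i ↔ m ∈ G ∧ η i ≤ m 1 ∧ m 1 < η i + v i)
    (hU : ∀ i, 1 ≤ i → i ≤ k → ∀ m,
      m ∈ B i ∪ E i ↔ m ∈ G ∧ η (i + 1) ≤ m 1 ∧ m 1 < η i + v i)
    (hF : ∀ f m : Mon, m ∈ F f ↔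
      ∃ i ≤ k, (η (i + 1) ≤ f 1 ∧ (1 ≤ i → f 1 < η i + v i)) ∧ g (i + 1) = m) :
    (G = A ∪ ⋃ i ∈ Set.Icc 1 k, B i) ∧
    (Set.Icc 1 k).PairwiseDisjoint B ∧
    (∀ i ∈ Set.Icc 1 k, Disjoint A (B i)) ∧
    (∀ i ∈ Set.Icc 1 k, Disjoint (B i) (E i)) ∧
    (G' = (g 1 +ᵥ A) ∪ ⋃ i ∈ Set.Icc 1 k, (g (i + 1) +ᵥ (B i ∪ E i))) ∧
    (Set.Icc 1 k).PairwiseDisjoint (fun i => g (i + 1) +ᵥ (B i ∪ E i)) ∧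
    (∀ i ∈ Set.Icc 1 k, Disjoint (g 1 +ᵥ A) (g (i + 1) +ᵥ (B i ∪ E i))) ∧
    (G'' = ((2 • g 1) +ᵥ A) ∪ (⋃ i ∈ Set.Icc 1 k, ((2 • g (i + 1)) +ᵥ (B i ∪ E i))) ∪
        ⋃ i ∈ Set.Icc 1 k, ((g i + g (i + 1)) +ᵥ E i)) ∧
    (Set.Icc 1 k).PairwiseDisjoint (fun i => (2 • g (i + 1)) +ᵥ (B i ∪ E i)) ∧
    (Set.Icc 1 k).PairwiseDisjoint (fun i => (g i + g (i + 1)) +ᵥ E i) ∧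
    (∀ i ∈ Set.Icc 1 k, Disjoint ((2 • g 1) +ᵥ A) ((2 • g (i + 1)) +ᵥ (B i ∪ E i))) ∧
    (∀ i ∈ Set.Icc 1 k, Disjoint ((2 • g 1) +ᵥ A) ((g i + g (i + 1)) +ᵥ E i)) ∧
    (∀ i ∈ Set.Icc 1 k, ∀ j ∈ Set.Icc 1 k,
      Disjoint ((2 • g (i + 1)) +ᵥ (B i ∪ E i)) ((g j + g (j + 1)) +ᵥ E j)) ∧
    (G' = ⋃ f ∈ G, (f +ᵥ F f)) ∧
    G.PairwiseDisjoint (fun f => f +ᵥ F f) := by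
  have hle : ∀ c i l, 1 ≤ i → i ≤ l → l ≤ k + 1 → η l + c * g l 1 ≤ η i + c * g i 1 :=
    fun c i l h1 h2 h3 => h.le_of_le h1 h2 h3
  have rB : ∀ i, 1 ≤ i → i ≤ k → ∀ m ∈ B i, η (i + 1) + 0 * g (i + 1) 1 ≤ m 1 ∧
      m 1 < η i + 0 * g i 1 := fun i h1 h2 m hm => by
    have := (hB i h1 h2 m).1 hm
    omega
  have rU : ∀ i, 1 ≤ i → i ≤ k → ∀ m ∈ g (i + 1) +ᵥ (B i ∪ E i),
      η (i + 1) + 1 * g (i + 1) 1 ≤ m 1 ∧ m 1 < η i + 1 * g i 1 := by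
    rintro i h1 h2 _ ⟨f, hf, rfl⟩
    have := (hU i h1 h2 f).1 hf
    have := h.y_succ i h1 h2
    simp only [vadd_eq_add, Finsupp.add_apply]
    omega
  -- The rows from `η (i + 1) + 2 * g (i + 1) 1` to `η i + 2 * g i 1` are cut at `η i + g i 1 + g (i
  -- + 1) 1`, separating the multiples by the square from those by the mixed product.
  have rU2 : ∀ i, 1 ≤ i → i ≤ k → ∀ m ∈ (2 • g (i + 1)) +ᵥ (B i ∪ E i),
      η (i + 1) + 2 * g (i + 1) 1 ≤ m 1 ∧ m 1 < η i + g i 1 + g (i + 1) 1 := by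
    rintro i h1 h2 _ ⟨f, hf, rfl⟩
    have := (hU i h1 h2 f).1 hf
    have := h.y_succ i h1 h2
    simp only [vadd_eq_add, Finsupp.add_apply, Finsupp.smul_apply, smul_eq_mul]
    omega
  have rE2 : ∀ i, 1 ≤ i → i ≤ k → ∀ m ∈ (g i + g (i + 1)) +ᵥ E i,
      η i + g i 1 + g (i + 1) 1 ≤ m 1 ∧ m 1 < η i + 2 * g i 1 := by
    rintro i h1 h2 _ ⟨f, hf, rfl⟩
    have := (hE i h1 h2 f).1 hf
    have := h.y_succ i h1 h2
    simp only [vadd_eq_add, Finsupp.add_apply]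
    omega
  have rA : ∀ c, ∀ m ∈ (c • g 1) +ᵥ A, η 1 + c * g 1 1 ≤ m 1 := by
    rintro c _ ⟨f, hf, rfl⟩
    have := (hA f).1 hf
    simp only [vadd_eq_add, Finsupp.add_apply, Finsupp.smul_apply, smul_eq_mul]
    omega
  have rA1 : ∀ m ∈ g 1 +ᵥ A, η 1 + 1 * g 1 1 ≤ m 1 := fun m hm =>
    rA 1 m (by rwa [one_smul])
  have gap : ∀ i, 1 ≤ i → i ≤ k → η (i + 1) + 2 * g (i + 1) 1 ≤ η i + g i 1 + g (i + 1) 1 ∧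
      η i + g i 1 + g (i + 1) 1 ≤ η i + 2 * g i 1 := fun i h1 h2 => by
    have := h.y_succ i h1 h2
    have := h.step h1 h2
    omega
  have sliceA : ∀ f, f ∈ A ↔ f ∈ G ∧ (η (0 + 1) ≤ f 1 ∧ (1 ≤ 0 → f 1 < η 0 + v 0)) :=
    fun f => by simp [hA]
  have sliceU : ∀ i, 1 ≤ i → i ≤ k → ∀ f,
      f ∈ B i ∪ E i ↔ f ∈ G ∧ (η (i + 1) ≤ f 1 ∧ (1 ≤ i → f 1 < η i + v i)) :=
    fun i h1 h2 f => by simp only [hU i h1 h2, h1, true_imp_iff]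
  refine ⟨?_, pairwiseDisjoint_of_deg (hle 0) rB, ?_, ?_, ?_, pairwiseDisjoint_of_deg (hle 1) rU,
    ?_, ?_, pairwiseDisjoint_of_deg (hle 2) ?_, pairwiseDisjoint_of_deg (hle 2) ?_, ?_, ?_, ?_, ?_,
    ?_⟩
  · ext m
    simp only [Set.mem_union, Set.mem_iUnion, exists_prop]
    constructor
    · intro hm
      obtain ⟨i, hik, h1, h2⟩ := h.exists_section (m 1)
      rcases Nat.eq_zero_or_pos i with rfl | hi
      · exact Or.inl ((hA m).2 ⟨hm, h1⟩)
      · exact Or.inr ⟨i, ⟨hi, hik⟩, (hB i hi hik m).2 ⟨hm, h1, h2 hi⟩⟩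
    · rintro (hm | ⟨i, hi, hm⟩)
      · exact ((hA m).1 hm).1
      · exact ((hB i hi.1 hi.2 m).1 hm).1
  · intro i hi
    refine disjoint_of_deg (η 1) (fun m hm => ((hA m).1 hm).2) fun m hm => ?_
    have := ((hB i hi.1 hi.2 m).1 hm).2.2
    have := hle 0 1 i le_rfl hi.1 (by have := hi.2; omega)
    omega
  · intro i hi
    exact (disjoint_of_deg (η i) (fun m hm => ((hE i hi.1 hi.2 m).1 hm).2.1)
      fun m hm => ((hB i hi.1 hi.2 m).1 hm).2.2).symm
  · ext m
    rw [h.mem_next s]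
    simp only [Set.mem_union, Set.mem_iUnion, exists_prop, mem_vadd_mon]
    constructor
    · rintro ⟨i, hik, f, hf, hf', rfl⟩
      rcases Nat.eq_zero_or_pos i with rfl | hi
      · exact Or.inl ⟨f, (sliceA f).2 ⟨hf, hf'⟩, rfl⟩
      · exact Or.inr ⟨i, ⟨hi, hik⟩, f, (sliceU i hi hik f).2 ⟨hf, hf'⟩, rfl⟩
    · rintro (⟨f, hf, rfl⟩ | ⟨i, hi, f, hf, rfl⟩)
      · obtain ⟨hf, hf'⟩ := (sliceA f).1 hf
        exact ⟨0, Nat.zero_le _, f, hf, hf', rfl⟩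
      · obtain ⟨hf, hf'⟩ := (sliceU i hi.1 hi.2 f).1 hf
        exact ⟨i, hi.2, f, hf, hf', rfl⟩
  · intro i hi
    exact disjoint_of_deg _ rA1 fun m hm => (rU i hi.1 hi.2 m hm).2.trans_le
      (hle 1 1 i le_rfl hi.1 (by have := hi.2; omega))
  · ext m
    rw [h.mem_next_next s s']
    simp only [Set.mem_union, Set.mem_iUnion, exists_prop, mem_vadd_mon]
    constructor
    · rintro (⟨i, hik, f, hf, hf', rfl⟩ | ⟨i, hi, hik, f, hf, hf', rfl⟩)
      · rcases Nat.eq_zero_or_pos i with rfl | hi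
        · exact Or.inl (Or.inl ⟨f, (sliceA f).2 ⟨hf, hf'⟩, rfl⟩)
        · exact Or.inl (Or.inr ⟨i, ⟨hi, hik⟩, f, (sliceU i hi hik f).2 ⟨hf, hf'⟩, rfl⟩)
      · exact Or.inr ⟨i, ⟨hi, hik⟩, f, (hE i hi hik f).2 ⟨hf, hf'⟩, rfl⟩
    · rintro ((⟨f, hf, rfl⟩ | ⟨i, hi, f, hf, rfl⟩) | ⟨i, hi, f, hf, rfl⟩)
      · obtain ⟨hf, hf'⟩ := (sliceA f).1 hf
        exact Or.inl ⟨0, Nat.zero_le _, f, hf, hf', rfl⟩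
      · obtain ⟨hf, hf'⟩ := (sliceU i hi.1 hi.2 f).1 hf
        exact Or.inl ⟨i, hi.2, f, hf, hf', rfl⟩
      · obtain ⟨hf, hf'⟩ := (hE i hi.1 hi.2 f).1 hf
        exact Or.inr ⟨i, hi.1, hi.2, f, hf, hf', rfl⟩
  · intro i h1 h2 m hm
    have := rU2 i h1 h2 m hm
    have := gap i h1 h2
    omega
  · intro i h1 h2 m hm
    have := rE2 i h1 h2 m hm
    have := gap i h1 h2
    omega
  · intro i hi
    refine disjoint_of_deg _ (rA 2) fun m hm => ?_
    have := rU2 i hi.1 hi.2 m hm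
    have := gap i hi.1 hi.2
    have := hle 2 1 i le_rfl hi.1 (by have := hi.2; omega)
    omega
  · intro i hi
    refine disjoint_of_deg _ (rA 2) fun m hm => ?_
    have := rE2 i hi.1 hi.2 m hm
    have := hle 2 1 i le_rfl hi.1 (by have := hi.2; omega)
    omega
  · intro i hi j hj
    have gi := gap i hi.1 hi.2
    have gj := gap j hj.1 hj.2
    rcases Nat.lt_or_ge i j with hij | hij
    · refine disjoint_of_deg _ (fun m hm => (rU2 i hi.1 hi.2 m hm).1) fun m hm => ?_
      have := rE2 j hj.1 hj.2 m hm
      have := hle 2 (i + 1) j (by omega) hij (by have := hj.2; omega)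
      omega
    · refine (disjoint_of_deg _ (fun m hm => (rE2 j hj.1 hj.2 m hm).1) fun m hm => ?_).symm
      have := rU2 i hi.1 hi.2 m hm
      rcases hij.eq_or_lt with rfl | hij
      · exact this.2
      · have := hle 2 (j + 1) i (by omega) hij (by have := hi.2; omega)
        omega
  · ext m
    rw [h.mem_next s]
    simp only [Set.mem_iUnion, exists_prop, mem_vadd_mon, hF]
    constructor
    · rintro ⟨i, hik, f, hf, hf', rfl⟩
      exact ⟨f, hf, g (i + 1), ⟨i, hik, hf', rfl⟩, add_comm _ _⟩
    · rintro ⟨f, hf, _, ⟨i, hik, hf', rfl⟩, rfl⟩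
      exact ⟨i, hik, f, hf, hf', add_comm _ _⟩
  · intro f hf f' hf' hne
    refine Set.disjoint_left.2 fun m hm hm' => hne ?_
    obtain ⟨_, hg, rfl⟩ := hm
    obtain ⟨_, hg', heq⟩ := hm'
    obtain ⟨i, hik, ⟨h1, h2⟩, rfl⟩ := (hF _ _).1 hg
    obtain ⟨l, hlk, ⟨h3, h4⟩, rfl⟩ := (hF _ _).1 hg'
    simp only [vadd_eq_add] at heq
    have hd : f' 1 + g (l + 1) 1 = f 1 + g (i + 1) 1 := by
      rw [← Finsupp.add_apply, heq, Finsupp.add_apply]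
    -- The row of the product determines its section in the next power, hence the multiplier, which
    -- can be cancelled.
    have hil : i = l := h.section_unique (c := 1) (y := f 1 + g (i + 1) 1) hik hlk (by omega)
      (fun hi => by have := h2 hi; have := h.y_succ i hi hik; omega) (by omega)
      (fun hl => by have := h4 hl; have := h.y_succ l hl hlk; omega)
    subst hil
    exact (add_right_cancel heq).symm

end Thresholds

end BivariateMonomial

/-! ### Assembly of the theorem -/

theorem corollary5 {K : Type*} [Field K] (I : Ideal (MvPolynomial (Fin 2) K))
    (hImon : IsMonomialIdeal I) (hIanch : Anchored I) (hInp : ¬ Submodule.IsPrincipal I)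
    (P : Finset Mon) (hP₁ : persistent I ⊆ (P : Set Mon))
    (hP₂ : (P : Set Mon) ⊆ weaklyPersistent I)
    (k : ℕ) (g : ℕ → Mon) (hg : (P : Set Mon) = g '' Set.Icc 1 (k + 1))
    (hgdesc : StrictAntiOn (fun i => g i 1) (Set.Icc 1 (k + 1)))
    (D : ℕ) (hD : (mu I - P.card) * deltaP K g k + P.card * dP I P ≤ D)
    (s : ℕ) (hs : D + rY I g k D + 1 ≤ s)
    (C H : ℕ → Ideal (MvPolynomial (Fin 2) K))
    (hC : ∀ i, C i = stableC I g k D s i) (hH : ∀ i, H i = stableH I g D s i)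
    (h q qhat : ℕ → Mon) (hh : ∀ i, h i = linkPoint C k i)
    (hq : ∀ i, q i = h i ⊓ h (i + 1))
    (hqhat : ∀ i, qhat i = h i - xy (pdist K 0 (g i) (g (i + 1))) 0) :
    -- `I^s` is the link of the `C_i`, and `x^{dist_x(g_i, g_{i+1})}` divides `h_i`
    I ^ s = iterLink C 0 k ∧
    (∀ i ∈ Set.Icc 1 k, xy (pdist K 0 (g i) (g (i + 1))) 0 ≤ h i) ∧
    -- minimal generators of `I^s`
    (mingens (I ^ s) =
        mingens (mulMon (q 0) (C 0)) ∪ ⋃ i ∈ Set.Icc 1 k, mingensStar (mulMon (q i) (C i))) ∧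
    (Set.Icc 1 k).PairwiseDisjoint (fun i => mingensStar (mulMon (q i) (C i))) ∧
    (∀ i ∈ Set.Icc 1 k,
      Disjoint (mingens (mulMon (q 0) (C 0))) (mingensStar (mulMon (q i) (C i)))) ∧
    -- the inner union in the second and third description is disjoint
    (∀ i ∈ Set.Icc 1 k,
      Disjoint (mingensStar (mulMon (q i) (C i))) (mingensStar (mulMon (qhat i) (H i)))) ∧
    -- minimal generators of `I^{s+1}`
    (mingens (I ^ (s + 1)) =
        (g 1 +ᵥ mingens (mulMon (q 0) (C 0))) ∪
        ⋃ i ∈ Set.Icc 1 k, (g (i + 1) +ᵥ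
          (mingensStar (mulMon (q i) (C i)) ∪ mingensStar (mulMon (qhat i) (H i))))) ∧
    (Set.Icc 1 k).PairwiseDisjoint (fun i => g (i + 1) +ᵥ
        (mingensStar (mulMon (q i) (C i)) ∪ mingensStar (mulMon (qhat i) (H i)))) ∧
    (∀ i ∈ Set.Icc 1 k,
      Disjoint (g 1 +ᵥ mingens (mulMon (q 0) (C 0)))
        (g (i + 1) +ᵥ
          (mingensStar (mulMon (q i) (C i)) ∪ mingensStar (mulMon (qhat i) (H i))))) ∧
    -- minimal generators of `I^{s+2}`
    (mingens (I ^ (s + 2)) =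
        ((2 • g 1) +ᵥ mingens (mulMon (q 0) (C 0))) ∪
        (⋃ i ∈ Set.Icc 1 k, ((2 • g (i + 1)) +ᵥ
          (mingensStar (mulMon (q i) (C i)) ∪ mingensStar (mulMon (qhat i) (H i))))) ∪
        ⋃ i ∈ Set.Icc 1 k, ((g i + g (i + 1)) +ᵥ mingensStar (mulMon (qhat i) (H i)))) ∧
    (Set.Icc 1 k).PairwiseDisjoint (fun i => (2 • g (i + 1)) +ᵥ
        (mingensStar (mulMon (q i) (C i)) ∪ mingensStar (mulMon (qhat i) (H i)))) ∧
    (Set.Icc 1 k).PairwiseDisjoint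
        (fun i => (g i + g (i + 1)) +ᵥ mingensStar (mulMon (qhat i) (H i))) ∧
    (∀ i ∈ Set.Icc 1 k,
      Disjoint ((2 • g 1) +ᵥ mingens (mulMon (q 0) (C 0)))
        ((2 • g (i + 1)) +ᵥ
          (mingensStar (mulMon (q i) (C i)) ∪ mingensStar (mulMon (qhat i) (H i))))) ∧
    (∀ i ∈ Set.Icc 1 k,
      Disjoint ((2 • g 1) +ᵥ mingens (mulMon (q 0) (C 0)))
        ((g i + g (i + 1)) +ᵥ mingensStar (mulMon (qhat i) (H i)))) ∧
    (∀ i ∈ Set.Icc 1 k, ∀ j ∈ Set.Icc 1 k,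
      Disjoint
        ((2 • g (i + 1)) +ᵥ
          (mingensStar (mulMon (q i) (C i)) ∪ mingensStar (mulMon (qhat i) (H i))))
        ((g j + g (j + 1)) +ᵥ mingensStar (mulMon (qhat j) (H j)))) ∧
    -- the resulting description of `G(I^{s+1})` generator by generator of `I^s`
    (mingens (I ^ (s + 1)) = ⋃ f ∈ mingens (I ^ s), (f +ᵥ multipliers K g h k f)) ∧
    (mingens (I ^ s)).PairwiseDisjoint (fun f => f +ᵥ multipliers K g h k f) := by
  have hG := genChain_of_persistent hImon hIanch hInp hP₁ hP₂ hg hgdesc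
  have hk := hG.one_le
  have hp0 : ∀ i, 1 ≤ i → i ≤ k → pdist K 0 (g i) (g (i + 1)) = g (i + 1) 0 - g i 0 :=
    fun i h1 h2 => pdist_zero (hG.x_lt i (i + 1) h1 (by omega) (by omega))
      (hG.y_lt i (i + 1) h1 (by omega) (by omega))
  have hp1 : ∀ i, 1 ≤ i → i ≤ k → pdist K 1 (g i) (g (i + 1)) = g i 1 - g (i + 1) 1 :=
    fun i h1 h2 => pdist_one (hG.x_lt i (i + 1) h1 (by omega) (by omega))
      (hG.y_lt i (i + 1) h1 (by omega) (by omega))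
  have hcov := hG.exists_adjacent_factor_of_le hg hD
  obtain ⟨n, rfl⟩ : ∃ n, s = n + 1 + D := ⟨s - D - 1, by omega⟩
  have hn : ∀ i, 1 ≤ i → i ≤ k → D * g 1 1 ≤ n * (g i 1 - g (i + 1) 1) := fun i h1 h2 => by
    rw [← hG.idist_one, ← hp1 i h1 h2]
    exact mul_idist_le_of_rY_le (by omega) ⟨h1, h2⟩ (by
      have := hG.y_lt i (i + 1) h1 (by omega) (by omega)
      rw [hp1 i h1 h2]
      omega)
  set u : ℕ → ℕ := fun i => g (i + 1) 0 - g i 0 with hu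
  set v : ℕ → ℕ := fun i => g i 1 - g (i + 1) 1 with hv
  have hn' : ∀ i, 1 ≤ i → i ≤ k → D * g 1 1 ≤ (n + 1) * v i := fun i h1 h2 =>
    (hn i h1 h2).trans (Nat.mul_le_mul_right _ (Nat.le_succ n))
  have hn'' : ∀ i, 1 ≤ i → i ≤ k → D * g 1 1 ≤ (n + 1 + 1) * v i := fun i h1 h2 =>
    (hn i h1 h2).trans (Nat.mul_le_mul_right _ (by omega))
  have p0 := hG.pieces hcov hn
  have p1 := hG.pieces hcov hn'
  have p2 := hG.pieces hcov hn''
  have hJ := hG.hasProf_pow D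
  have hS := hG.hasProf_pow (n + 1 + D)
  have hS1 := hG.hasProf_pow (n + 1 + 1 + D)
  have hS2 := hG.hasProf_pow (n + 1 + 1 + 1 + D)
  rw [show n + 1 + D + 1 = n + 1 + 1 + D by omega, show n + 1 + D + 2 = n + 1 + 1 + 1 + D by omega]
  have m0 : ∀ l, 1 ≤ l → l ≤ k + 1 → ∀ y, prof (I ^ (n + 1 + 1 + D)) (y + g l 1) ≤
      prof (I ^ (n + 1 + D)) y + g l 0 := fun l h1 h2 y => by
    rw [show n + 1 + 1 + D = n + 1 + D + 1 by omega]
    exact hG.prof_succ_le h1 h2 y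
  have m1 : ∀ l, 1 ≤ l → l ≤ k + 1 → ∀ y, prof (I ^ (n + 1 + 1 + 1 + D)) (y + g l 1) ≤
      prof (I ^ (n + 1 + 1 + D)) y + g l 0 := fun l h1 h2 y => by
    rw [show n + 1 + 1 + 1 + D = n + 1 + 1 + D + 1 by omega]
    exact hG.prof_succ_le h1 h2 y
  obtain ⟨t, ht0, ht⟩ := hG.exists_first_zero (n + 1 + D)
  set φ := prof (I ^ (n + 1 + D)) with hφ
  -- The thresholds are completed by `η 0 = t`, the first zero of `φ`, and `η (k + 1) = 0`, so that
  -- the outer slices are of the same form as the others.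
  have hex : ∀ i, ∃ e, (1 ≤ i → i ≤ k → FirstDrop φ (n * g i 1 + g (i + 1) 1) e) ∧
      (i = 0 → e = t) ∧ (i = k + 1 → e = 0) := fun i => by
    by_cases hi : 1 ≤ i ∧ i ≤ k
    · obtain ⟨e, he, -⟩ := p0.firstDrop_exists p1 m0 hi.1 hi.2
      exact ⟨e, fun _ _ => he, fun hc => by omega, fun hc => by omega⟩
    · by_cases h0 : i = 0
      · exact ⟨t, fun _ _ => by omega, fun _ => rfl, fun hc => by omega⟩
      · exact ⟨0, fun h1 h2 => absurd ⟨h1, h2⟩ hi, fun hc => absurd hc h0, fun _ => rfl⟩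
  choose η hη using hex
  have hη1 := fun i => (hη i).1
  have hη0 : η 0 = t := (hη 0).2.1 rfl
  have hηl : η (k + 1) = 0 := (hη (k + 1)).2.2 rfl
  have hthr : Thresholds g v k η := ⟨hk, p0.b_succ, hG.y_last, hηl, fun i h1 h2 =>
    p0.firstDrop_add_le p1 m0 h1 h2 (hη1 i h1 h2.le) (hη1 (i + 1) (by omega) h2)⟩
  have hdrop : ∀ i, i ≤ k + 1 → Drop φ (η i) := fun i hi => by
    rcases Nat.eq_zero_or_pos i with rfl | h1
    · intro z hz
      rw [hη0] at hz ⊢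
      rw [ht0]
      exact Nat.pos_of_ne_zero (ht z hz)
    · rcases hi.eq_or_lt with rfl | h2
      · rw [hηl]
        exact fun z hz => absurd hz (Nat.not_lt_zero z)
      · exact (hη1 i h1 (by omega)).drop
  have hdrop_le : ∀ y, Drop φ y → y ≤ η 0 := fun y hy => by
    by_contra! hc
    have := hy (η 0) hc
    rw [hη0, ht0] at this
    omega
  have hstep : ∀ i, i ≤ k → η (i + 1) ≤ η i := fun i hi => by
    rcases Nat.eq_zero_or_pos i with rfl | h1
    · exact hdrop_le _ (hdrop 1 (by omega))
    · exact hthr.step h1 hi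
  have s1 := p0.shiftStep p1 m0 hS hS1 hη1
  have s2 := p1.shiftStep p2 m1 hS1 hS2 (η := fun i => η i + g i 1)
    fun i h1 h2 => p0.firstDrop_succ p1 m0 h1 h2 (hη1 i h1 h2)
  have hCprof : ∀ i, i ≤ k → HasProf (C i) (fun y => φ (y + η (i + 1)) - φ (η i)) := by
    intro i hi
    have hsub : n + 1 + D - D = n + 1 := by omega
    have hcA : ∀ i, 1 ≤ i → i ≤ k →
        compA I g D (n + 1 + D) i = segA (u i) (v i) (I ^ D) n := fun i h1 h2 => by
      rw [compA, hp0 i h1 h2, hp1 i h1 h2, hsub, Nat.add_sub_cancel]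
    have hcB : ∀ i, 1 ≤ i → i ≤ k →
        compB I g D (n + 1 + D) i = segB (u i) (v i) (I ^ D) n := fun i h1 h2 => by
      rw [compB, hp0 i h1 h2, hp1 i h1 h2, hsub, Nat.add_sub_cancel]
    rw [hC, stableC]
    split_ifs with h0 h1
    · subst h0
      rw [hcA 1 le_rfl hk]
      refine (p0.hasProf_segA_first p1 m0 hJ (hη1 1 le_rfl hk)).congr fun y => ?_
      rw [hη0, ht0, Nat.sub_zero]
    · subst h1
      rw [hcB i hk le_rfl]
      refine (p0.hasProf_segB_last p1 m0 hJ (hη1 i hk le_rfl)).congr fun y => ?_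
      rw [hηl, add_zero]
    · have h2 : 1 ≤ i := by omega
      rw [hcA i h2 hi, hcB i h2 hi, hcA (i + 1) (by omega) (by omega),
        hcB (i + 1) (by omega) (by omega), hp0 i h2 hi, hp1 (i + 1) (by omega) (by omega), hsub]
      exact p0.hasProf_glue p1 m0 hJ h2 (by omega) (hη1 i h2 hi) (hη1 (i + 1) (by omega) (by omega))
  have hφ0 : φ (η 0) = 0 := by rw [hη0, ht0]
  have hh' : ∀ i, i ≤ k + 1 → h i = xy (φ (η i)) (η i) := fun i hi => by
    rw [hh, linkPoint_eq hS hstep hdrop hCprof hk hφ0 hηl hi]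
  have hq' : ∀ i, i ≤ k → q i = xy (φ (η i)) (η (i + 1)) := fun i hi => by
    have e1 := hstep i hi
    have e2 := hS.antitone e1
    rw [hq, hh' i (by omega), hh' (i + 1) (by omega)]
    exact mon_ext (by simpa using e2) (by simpa using e1)
  have hper : ∀ i, 1 ≤ i → i ≤ k → φ (η i + v i) + u i = φ (η i) := fun i h1 h2 =>
    p0.u_le_firstDrop p1 m0 h1 h2 (hη1 i h1 h2)
  -- By periodicity, dividing `h i` by `x^(u i)` gives the corner of the slice from `η i` to `η i +
  -- v i`.
  have hqhat' : ∀ i, 1 ≤ i → i ≤ k → qhat i = xy (φ (η i + v i)) (η i) := fun i h1 h2 => by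
    have := hper i h1 h2
    rw [hqhat, hh' i (by omega), hp0 i h1 h2]
    refine mon_ext ?_ (by simp)
    simp only [Finsupp.tsub_apply, xy_apply_zero]
    change φ (η i) - u i = _
    omega
  have hHprof : ∀ i, 1 ≤ i → i ≤ k →
      HasProf (H i) (fun y => φ (y + η i) - φ (η i + v i)) := fun i h1 h2 => by
    have := hper i h1 h2
    rw [hH, stableH, hp0 i h1 h2, hp1 i h1 h2, show n + 1 + D - D - 1 = n by omega]
    refine (p0.hasProf_segH p1 m0 hJ h1 h2 (hη1 i h1 h2)).congr fun y => ?_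
    rw [← this, Nat.add_sub_cancel]
  have memC0 : ∀ m, m ∈ mingens (mulMon (q 0) (C 0)) ↔ m ∈ mingens (I ^ (n + 1 + D)) ∧ η 1 ≤ m 1 :=
    fun m => by
      rw [hq' 0 (by omega), mem_mingens_slice hS (hCprof 0 (by omega)) (hdrop _ (by omega))
        (hstep 0 (by omega))]
      exact ⟨fun hm => ⟨hm.1, hm.2.1⟩, fun hm => ⟨hm.1, hm.2,
        hdrop_le _ (hS.mem_mingens.1 hm.1).2⟩⟩
  have memC : ∀ i, 1 ≤ i → i ≤ k → ∀ m, m ∈ mingensStar (mulMon (q i) (C i)) ↔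
      m ∈ mingens (I ^ (n + 1 + D)) ∧ η (i + 1) ≤ m 1 ∧ m 1 < η i := fun i h1 h2 m => by
    rw [hq' i h2, mem_mingensStar_slice hS (hCprof i h2) (hdrop _ (by omega))
      (hdrop _ (by omega)) (hstep i h2)]
  have memH : ∀ i, 1 ≤ i → i ≤ k → ∀ m, m ∈ mingensStar (mulMon (qhat i) (H i)) ↔
      m ∈ mingens (I ^ (n + 1 + D)) ∧ η i ≤ m 1 ∧ m 1 < η i + v i := fun i h1 h2 m => by
    rw [hqhat' i h1 h2, mem_mingensStar_slice hS (hHprof i h1 h2) (hdrop _ (by omega))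
      (p0.drop_firstDrop_add p1 m0 h1 h2 (hη1 i h1 h2)) (Nat.le_add_right _ _)]
  have memU : ∀ i, 1 ≤ i → i ≤ k → ∀ m,
      m ∈ mingensStar (mulMon (q i) (C i)) ∪ mingensStar (mulMon (qhat i) (H i)) ↔
      m ∈ mingens (I ^ (n + 1 + D)) ∧ η (i + 1) ≤ m 1 ∧ m 1 < η i + v i := fun i h1 h2 m => by
    rw [Set.mem_union, memC i h1 h2, memH i h1 h2]
    have := hstep i h2
    by_cases hm : m ∈ mingens (I ^ (n + 1 + D))
    · simp only [hm, true_and]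
      omega
    · simp only [hm, false_and, or_self]
  have hmult : ∀ f m : Mon, m ∈ multipliers K g h k f ↔
      ∃ i ≤ k, (η (i + 1) ≤ f 1 ∧ (1 ≤ i → f 1 < η i + v i)) ∧ g (i + 1) = m := fun f m =>
    hthr.mem_multipliers (fun i h1 h2 => by rw [hh' i (by omega), xy_apply_one]) hp1
  -- From here on only the `y`-degrees of the generators matter, so the ideals are abstracted away.
  generalize hG0 : mingens (I ^ (n + 1 + D)) = G₀ at *
  generalize hG1 : mingens (I ^ (n + 1 + 1 + D)) = G₁ at *
  generalize hG2 : mingens (I ^ (n + 1 + 1 + 1 + D)) = G₂ at *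
  generalize hA : mingens (mulMon (q 0) (C 0)) = A at *
  generalize hB : (fun i => mingensStar (mulMon (q i) (C i))) = B at *
  have hB' : ∀ i, mingensStar (mulMon (q i) (C i)) = B i := fun i => congrFun hB i
  generalize hE : (fun i => mingensStar (mulMon (qhat i) (H i))) = E at *
  have hE' : ∀ i, mingensStar (mulMon (qhat i) (H i)) = E i := fun i => congrFun hE i
  simp only [hB', hE'] at *
  refine ⟨eq_iterLink hS hstep hdrop hCprof hφ0 hηl, ?_, ?_⟩
  · intro i hi
    have := hper i hi.1 hi.2
    rw [hh' i (by have := hi.2; omega), hp0 i hi.1 hi.2, mon_le_iff]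
    simp only [xy_apply_zero, xy_apply_one, Nat.zero_le, and_true]
    change u i ≤ _
    omega
  · exact hthr.decomposition s1 s2 memC0 memC memH memU hmult
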